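/- Let $F,G$ be distributions on $[0,\infty)$ with tails $\overline F=1-F$, $\overline G=1-G$, and let $\alpha>0$. Assume $F,G\in\mathcal L_\alpha$, i.e. the tails are positive on $(0,\infty)$ and $\overline F(t-u)/\overline F(t)\to e^{\alpha u}$, $\overline G(t-u)/\overline G(t)\to e^{\alpha u}$ as $t\to\infty$ for every $u\in\mathbb R$. Put $b(t)=e^{\alpha t}\overline F(t)$, $c(t)=e^{\alpha t}\overline G(t)$ and $m_G(\alpha)=\int_{[0,\infty)}e^{\alpha u}\,dG(u)\in(0,\infty]$. A measurable, eventually positive function $\chi$ is in $RV_\kappa$ if $\chi(tx)/\chi(t)\to x^\kappa$ as $t\to\infty$ for all $x>0$; it is in $2RV_{\kappa,\rho}$ ($\rho\le 0$) with auxiliary function $A$ if $A$ is ultimately of one strict sign, $A(t)\to0$, and $\big(\chi(tx)/\chi(t)-x^\kappa\big)/A(t)\to x^\kappa h_\rho(x)$ as $t\to\infty$ for all $x>0$, where $h_\rho(x)=\frac{x^\rho-1}{\rho}$ for $\rho\neq0$ and $h_0(x)=\log x$. Assume $b\in 2RV_{\beta,\rho_2}$ with auxiliary function $A_2$ ($\beta\in\mathbb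 R$, $\rho_2\le0$) and $c\in RV_\gamma$ ($\gamma\in\mathbb R$). Then for large $t$ $$\int_{[0,t/2]}\overline F(t-u)\,dG(u)=\overline F(t)\,M_1(\beta,\gamma,t),$$ where, as $t\to\infty$: (i)(a) if $\gamma=-1$ and $m_G(\alpha)=\infty$, then with $L(t)=\int_0^{t/2}c(u)\,du$, $$M_1=L(t)\left(\alpha+\frac{\alpha t c(t)}{L(t)}\Big(\beta\int_0^{1/2}(1-u)^{\beta-1}\log u\,du+(\log2)(1-2^{-\beta})\Big)+\frac1{L(t)}+o\Big(\frac{1+tc(t)}{L(t)}+|A_2(t)|\Big)\right);$$ (i)(b) if $\gamma=-1$ and $m_G(\alpha)<\infty$, then $\int_0^\infty c(u)\,du<\infty$ and $$M_1=m_G(\alpha)-\alpha\int_{t/2}^\infty c(u)\,du+o\Big(\int_{t/2}^\infty c(u)\,du+|A_2(t)|\Big);$$ (i)(c) if $-2<\gamma<-1$, then $m_G(\alpha)<\infty$ and $$M_1=m_G(\alpha)+\alpha\Big(\int_0^{1/2}\big((1-u)^\beta-1\big)u^\gamma du+\frac1{(1+\gamma)2^{1+\gamma}}\Big)tc(t)+o\big(tc(t)+|A_2(t)|\big);$$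 (i)(d) if $\gamma=-2$ and $\int_1^\infty uc(u)\,du=\infty$, then $m_G(\alpha)<\infty$ and $$M_1=m_G(\alpha)-\alpha\beta t^{-1}\int_1^{t/2}uc(u)\,du+o\Big(t^{-1}\int_1^{t/2}uc(u)\,du+|A_2(t)|\Big);$$ (i)(e) if $\gamma\le-2$ and $\int_1^\infty uc(u)\,du<\infty$, then $m_G(\alpha)<\infty$, $\int_{[0,\infty)}ue^{\alpha u}\,dG(u)<\infty$ and $$M_1=m_G(\alpha)-\beta t^{-1}\int_{[0,\infty)}ue^{\alpha u}\,dG(u)+o\big(t^{-1}+|A_2(t)|\big);$$ (ii) if $\gamma>-1$ and moreover $c\in2RV_{\gamma,\rho_3}$ with auxiliary function $A_3$, $\rho_3\le0$ and $\gamma+\rho_3+1>0$, then $$\begin{aligned}M_1=tc(t)\Big(&\alpha\int_0^{1/2}(1-u)^\beta u^\gamma du+\alpha\int_0^{1/2}h_{\rho_2}(1-u)(1-u)^\beta u^\gamma du\,A_2(t)\\&+\Big(\beta\int_0^{1/2}(1-u)^{\beta-1}u^\gamma(2u-1)\,du-2(1+\gamma)\int_0^{1/2}(1-u)^\beta u^\gamma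 du\Big)t^{-1}\\&+\alpha\Big(\frac{2^{-\rho_3}\beta}{\gamma+\rho_3+1}\int_0^{1/2}(1-u)^{\beta-1}u^{\gamma+1}h_{\rho_3}(2u)\,du+\kappa\int_0^{1/2}(1-u)^\beta u^\gamma du\Big)A_3(t)\\&+o\big(t^{-1}+|A_2(t)|+|A_3(t)|\big)\Big),\end{aligned}$$ where $\kappa=\dfrac{2^{-\rho_3}(\gamma+1)-\gamma-\rho_3-1}{\rho_3(\gamma+\rho_3+1)}$ if $\rho_3\ne0$ and $\kappa=-\log2-\dfrac1{\gamma+1}$ (its limit as $\rho_3\to0$) if $\rho_3=0$. -/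

import Mathlib

open Set Filter Topology MeasureTheory Asymptotics

noncomputable section

/-- The right tail `t ↦ 1 - F(t) = F((t, ∞))` of a distribution `F` on the line. -/
def tail (F : Measure ℝ) (t : ℝ) : ℝ := F.real (Ioi t)

/-- The class `𝓛_α`: the distributions on `[0, ∞)` with positive tail such that
`tail F (t - u) / tail F t → exp (α u)` as `t → ∞` for every real `u`. -/
structure ExpTailClass (α : ℝ) (F : Measure ℝ) : Prop where
  isProbabilityMeasure : IsProbabilityMeasure F
  nonneg_support : F (Iio 0) = 0
  tail_pos : ∀ t : ℝ, 0 < t → 0 < tail F t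
  tendsto_ratio : ∀ u : ℝ,
    Tendsto (fun t => tail F (t - u) / tail F t) atTop (𝓝 (Real.exp (α * u)))

/-- The exponential moment `m_F(α) = ∫_{[0,∞)} exp (α u) dF(u)`, possibly `∞`. -/
def expMoment (F : Measure ℝ) (α : ℝ) : ENNReal :=
  ∫⁻ u in Ici (0 : ℝ), ENNReal.ofReal (Real.exp (α * u)) ∂F

/-- The function `(x ^ ρ - 1) / ρ`, read as `log x` when `ρ = 0`. -/
def powLog (ρ x : ℝ) : ℝ := if ρ = 0 then Real.log x else (x ^ ρ - 1) / ρ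

/-- `χ ∈ RV_κ`: regular variation at infinity with index `κ`. -/
structure IsRV (χ : ℝ → ℝ) (κ : ℝ) : Prop where
  measurable : Measurable ((Ici (0 : ℝ)).domRestrict χ)
  eventually_pos : ∀ᶠ t in atTop, 0 < χ t
  tendsto_ratio : ∀ x : ℝ, 0 < x →
    Tendsto (fun t => χ (t * x) / χ t) atTop (𝓝 (x ^ κ))

/-- `χ ∈ 2RV_{κ,ρ}` with auxiliary function `A`: second-order regular variation at infinity. -/
structure IsTwoRV (χ : ℝ → ℝ) (κ ρ : ℝ) (A : ℝ → ℝ) : Prop where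
  measurable : Measurable ((Ici (0 : ℝ)).domRestrict χ)
  eventually_pos : ∀ᶠ t in atTop, 0 < χ t
  rho_nonpos : ρ ≤ 0
  aux_sign : (∀ᶠ t in atTop, 0 < A t) ∨ (∀ᶠ t in atTop, A t < 0)
  aux_tendsto : Tendsto A atTop (𝓝 0)
  tendsto_second : ∀ x : ℝ, 0 < x →
    Tendsto (fun t => (χ (t * x) / χ t - x ^ κ) / A t) atTop (𝓝 (x ^ κ * powLog ρ x))

/-- The constant `(2^{-ρ} (γ + 1) - γ - ρ - 1) / (ρ (γ + ρ + 1))`,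
read as its limit `-log 2 - 1 / (γ + 1)` when `ρ = 0`. -/
def auxCoeff (γ ρ : ℝ) : ℝ :=
  if ρ = 0 then -Real.log 2 - 1 / (γ + 1)
  else ((2 : ℝ) ^ (-ρ) * (γ + 1) - γ - ρ - 1) / (ρ * (γ + ρ + 1))

/-- The truncated convolution integral `∫_{[0, t/2]} tail F (t - u) dG(u)`. -/
def halfConv (F G : Measure ℝ) (t : ℝ) : ℝ :=
  ∫ u in Icc (0 : ℝ) (t / 2), tail F (t - u) ∂G

end

/-!
Write `b(t) = exp (α t) * tail F t` and `c(t) = exp (α t) * tail G t`. Then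
`tail F (t - u) / tail F t = exp (α u) * b(t - u) / b(t)`, so the half convolution divided by
`tail F t` is the integral of `b(t (1 - u / t)) / b(t)` over `[0, t / 2]` against the tilted measure
`exp (α u) dG(u)`. Only the values of `b` between `t / 2` and `t` enter, and there the second-order
expansion of `b` holds uniformly (`IsTwoRV.uniform`). Hence the quotient is
`E φ₁ + A₂ E φ₂ + o(A₂ E 1)` with `φ₁ x = (1 - x) ^ β` and `φ₂ x = (1 - x) ^ β h(1 - x)`, where
`E φ` is the integral of `φ (u / t)` against the tilted measure (`halfConv_expansion`).

The weights are smooth, so integration by parts (`expConv_eq`) replaces `exp (α u) dG(u)` by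
`α c(u) du` up to boundary terms and a term of relative size `1 / t`. What is left are integrals of
the regularly varying function `c`, evaluated by Karamata-type theorems: `IsRV.tendsto_integral` for
weights vanishing at the origin to sufficient order, `IsRV.tendsto_integral_Ioi` for the tail, and
comparison with slowly varying integrals at the boundary indices (`IsRV.isLittleO_integral_Ioi`,
`IsRV.isLittleO_integral_one`). The regimes for the index `γ` differ in which of these terms
dominates. When the exponential moment is finite, `φ₂ 0 = 0` makes the second-order term of `b`
negligible (`halfConv_expansion_of_moment`). For `γ > -1` the second-order behaviour of `c` is
needed as well (`IsTwoRV.tendsto_integral`); the domination near the origin is the second-order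
Potter bound `IsTwoRV.potter_zero`.

The uniform convergence theorems rest on one measure-theoretic statement about additive increments,
`uniform_increment`. The auxiliary function of a second-order regularly varying function need not be
measurable; it is replaced by an asymptotically equal measurable one
(`IsTwoRV.exists_measurable_aux`).
-/

/-! ### Uniform convergence of increments -/

/-- Uniform convergence theorem for increments in additive notation. Two sets of large measure, one
translated by `v`, must meet; at a common point `w` the increments over `[s, s + w]` and
`[s + v, s + w]` are both close to their limits, hence so is the increment over `[s, s + v]`. -/
theorem uniform_increment {K N H : ℝ → ℝ} {ρ p q : ℝ} (hK : Measurable K) (hH : Continuous H)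
    (hlim : ∀ v, Tendsto (fun s => (K (s + v) - K s) / N s) atTop (𝓝 (H v)))
    (hN : ∀ᶠ s in atTop, N s ≠ 0)
    (hNr : ∀ ε > 0, ∀ᶠ s in atTop, ∀ v ∈ Icc p q, |N (s + v) / N s - Real.exp (ρ * v)| ≤ ε)
    (hadd : ∀ v w, H w - Real.exp (ρ * v) * H (w - v) = H v) :
    ∀ ε > 0, ∀ᶠ s in atTop, ∀ v ∈ Icc p q, |(K (s + v) - K s) / N s - H v| ≤ ε := by
  intro ε hε
  by_contra hcon
  rw [not_eventually] at hcon
  have hcon' := fun n : ℕ => (frequently_atTop.1 hcon) n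
  push Not at hcon'
  choose s hs v hv hbad using hcon'
  have hsT : Tendsto s atTop atTop :=
    tendsto_atTop_mono hs tendsto_natCast_atTop_atTop
  have hsvT : Tendsto (fun n => s n + v n) atTop atTop := by
    refine tendsto_atTop_mono (f := fun n => s n + p) (fun n => ?_)
      (tendsto_atTop_add_const_right _ _ hsT)
    have := (hv n).1
    linarith
  obtain ⟨R, hR⟩ := (isCompact_Icc (a := p) (b := q)).exists_bound_of_continuousOn
    (f := fun v => Real.exp (ρ * v)) (by fun_prop)
  obtain ⟨B, hB⟩ := (isCompact_Icc (a := (0 : ℝ)) (b := q + 1 - p)).exists_bound_of_continuousOn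
    hH.continuousOn
  have hR0 : 0 ≤ R := (norm_nonneg _).trans (hR _ (hv 0))
  have hpq : p ≤ q := (hv 0).1.trans (hv 0).2
  have hB0 : 0 ≤ B := (norm_nonneg _).trans (hB 0 ⟨le_rfl, by linarith⟩)
  -- The three error terms in the splitting below are bounded by `(R + 1) * ε₁`, `ε₁`, `B * ε₃`.
  set ε₁ : ℝ := ε / (4 * (R + 2)) with hε₁
  set ε₃ : ℝ := min 1 (ε / (4 * (B + 1))) with hε₃
  have hε₁0 : 0 < ε₁ := by positivity
  have hε₃0 : 0 < ε₃ := by positivity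
  set D : ℝ → ℝ → ℝ := fun t w => (K (t + w) - K t) / N t with hD
  have hDm : ∀ t, Measurable (D t) := fun t =>
    ((hK.comp (measurable_const_add t)).sub_const _).div_const _
  have key : ∀ (r : ℕ → ℝ), Tendsto r atTop atTop → ∀ a b : ℝ,
      ∀ᶠ n in atTop, volume ({w | ENNReal.ofReal ε₁ ≤ edist (D (r n) w) (H w)} ∩ Icc a b)
        < 1 / 2 := by
    intro r hr a b
    have := tendstoInMeasure_of_tendsto_ae (μ := volume.restrict (Icc a b))
      (f := fun n => D (r n)) (g := H) (fun n => (hDm _).aestronglyMeasurable)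
      (Eventually.of_forall fun w => (hlim w).comp hr) (ENNReal.ofReal ε₁) (by simpa using hε₁0)
    have h2 := this.eventually (gt_mem_nhds (show (0 : ENNReal) < 1 / 2 by simp))
    filter_upwards [h2] with n hn
    rwa [Measure.restrict_apply' measurableSet_Icc] at hn
  obtain ⟨n, h1, h2, h3, h4⟩ := ((key s hsT q (q + 1)).and ((key _ hsvT 0 (q + 1 - p)).and
    ((hsT.eventually (hNr ε₃ hε₃0)).and
      ((hsT.eventually hN).and (hsvT.eventually hN))))).exists
  -- The two exceptional sets, one of them translated by `v n`, cannot cover an interval of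
  -- length one.
  obtain ⟨w, hw, hw1, hw2⟩ : ∃ w ∈ Icc q (q + 1), edist (D (s n) w) (H w) < ENNReal.ofReal ε₁ ∧
      edist (D (s n + v n) (w - v n)) (H (w - v n)) < ENNReal.ofReal ε₁ := by
    by_contra hno
    push Not at hno
    set S₁ := {w | ENNReal.ofReal ε₁ ≤ edist (D (s n) w) (H w)} ∩ Icc q (q + 1)
    set S₂ := {w | ENNReal.ofReal ε₁ ≤ edist (D (s n + v n) w) (H w)} ∩ Icc 0 (q + 1 - p)
    have hsub : Icc q (q + 1) ⊆ S₁ ∪ (fun w => w + -v n) ⁻¹' S₂ := by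
      intro w hw
      by_cases hw1 : edist (D (s n) w) (H w) < ENNReal.ofReal ε₁
      · right
        refine ⟨by simpa [sub_eq_add_neg] using hno w hw hw1, ?_⟩
        have := hv n
        constructor <;> simp only [mem_Icc] at hw this ⊢ <;> linarith [hw.1, hw.2, this.1, this.2]
      · left
        exact ⟨not_lt.1 hw1, hw⟩
    have hle := (measure_mono (μ := volume) hsub).trans (measure_union_le _ _)
    rw [measure_preimage_add_right, Real.volume_Icc] at hle
    have hlt := ENNReal.add_lt_add h1 h2
    rw [ENNReal.add_halves] at hlt
    have : ENNReal.ofReal (q + 1 - q) = 1 := by simp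
    rw [this] at hle
    exact absurd (hle.trans_lt hlt) (lt_irrefl _)
  rw [edist_dist, ENNReal.ofReal_lt_ofReal_iff hε₁0, Real.dist_eq] at hw1 hw2
  have hvn := hv n
  have h3' := h3 _ hvn
  have hr : |N (s n + v n) / N (s n)| ≤ R + 1 := by
    have e1 := hR _ hvn
    rw [Real.norm_eq_abs] at e1
    have : ε₃ ≤ 1 := min_le_left _ _
    have := abs_le.1 h3'
    have := abs_le.1 e1
    rw [abs_le]; constructor <;> linarith [abs_le.1 h3', abs_le.1 e1]
  have hHw : |H (w - v n)| ≤ B := by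
    have := hB (w - v n) ⟨by linarith [hw.1, hvn.2], by linarith [hw.2, hvn.1]⟩
    simpa using this
  have hsplit : (K (s n + v n) - K (s n)) / N (s n) - H (v n)
      = (D (s n) w - H w)
        - N (s n + v n) / N (s n) * (D (s n + v n) (w - v n) - H (w - v n))
        - (N (s n + v n) / N (s n) - Real.exp (ρ * v n)) * H (w - v n) := by
    rw [← hadd (v n) w]
    simp only [hD]
    have : s n + v n + (w - v n) = s n + w := by ring
    rw [this]
    field_simp [h4.1, h4.2]
    ring
  have hfin : |(K (s n + v n) - K (s n)) / N (s n) - H (v n)| < ε := by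
    rw [hsplit]
    have t2 : |N (s n + v n) / N (s n) * (D (s n + v n) (w - v n) - H (w - v n))|
        ≤ (R + 1) * ε₁ := by
      rw [abs_mul]; gcongr
    have t3 : |(N (s n + v n) / N (s n) - Real.exp (ρ * v n)) * H (w - v n)| ≤ ε₃ * B := by
      rw [abs_mul]; gcongr
    have t3' : ε₃ * B ≤ ε / 4 := by
      have : ε₃ * (B + 1) ≤ ε / (4 * (B + 1)) * (B + 1) := by
        gcongr; exact min_le_right _ _
      have e : ε / (4 * (B + 1)) * (B + 1) = ε / 4 := by field_simp
      nlinarith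
    have t2' : (R + 2) * ε₁ = ε / 4 := by
      rw [hε₁]; field_simp
    have := abs_sub (D (s n) w - H w
        - N (s n + v n) / N (s n) * (D (s n + v n) (w - v n) - H (w - v n)))
        ((N (s n + v n) / N (s n) - Real.exp (ρ * v n)) * H (w - v n))
    have := abs_sub (D (s n) w - H w)
        (N (s n + v n) / N (s n) * (D (s n + v n) (w - v n) - H (w - v n)))
    nlinarith
  exact absurd hfin (not_lt.2 (hbad n).le)

/-! ### Regular variation -/

theorem eventually_forall_mul {P : ℝ → Prop} (hP : ∀ᶠ t in atTop, P t) {p : ℝ} (hp : 0 < p)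
    {q : ℝ} : ∀ᶠ t in atTop, ∀ x ∈ Icc p q, P (t * x) := by
  obtain ⟨T, hT⟩ := eventually_atTop.1 hP
  filter_upwards [eventually_ge_atTop (|T| / p)] with t ht x hx
  apply hT
  have ht' : |T| ≤ t * p := (div_le_iff₀ hp).1 ht
  have ht0 : 0 ≤ t := (div_nonneg (abs_nonneg _) hp.le).trans ht
  nlinarith [le_abs_self T, hx.1]

/-- A regularly varying function converges to its limiting power uniformly on compact subsets of
`(0, ∞)`. -/
theorem IsRV.uniform {f : ℝ → ℝ} {κ : ℝ} (hf : IsRV f κ) (hm : Measurable f) {p q : ℝ}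
    (hp : 0 < p) :
    ∀ ε > 0, ∀ᶠ t in atTop, ∀ x ∈ Icc p q, |f (t * x) / f t - x ^ κ| ≤ ε := by
  intro ε hε
  rcases lt_or_ge q p with hqp | hpq
  · exact Eventually.of_forall fun t x hx => absurd (hx.1.trans hx.2) (not_le.2 hqp)
  have hq : 0 < q := hp.trans_le hpq
  obtain ⟨B, hB⟩ := (isCompact_Icc (a := p) (b := q)).exists_bound_of_continuousOn
    (f := fun x => x ^ κ)
    (fun x hx => (Real.continuousAt_rpow_const _ _ (Or.inl (hp.trans_le hx.1).ne')).continuousWithinAt)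
  have hB0 : 0 ≤ B := (norm_nonneg _).trans (hB p ⟨le_rfl, hpq⟩)
  have hpos_exp : ∀ᶠ s in atTop, 0 < f (Real.exp s) :=
    Real.tendsto_exp_atTop.eventually hf.eventually_pos
  have hlog : ∀ v, Tendsto (fun s => (Real.log (f (Real.exp (s + v)))
      - Real.log (f (Real.exp s))) / 1) atTop (𝓝 (κ * v)) := by
    intro v
    have h1 := (hf.tendsto_ratio _ (Real.exp_pos v)).comp Real.tendsto_exp_atTop
    have h2 := h1.log (by positivity)
    rw [← Real.exp_mul, Real.log_exp, mul_comm v κ] at h2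
    refine h2.congr' ?_
    have hv := (tendsto_atTop_add_const_right _ v (tendsto_id (α := ℝ))).eventually hpos_exp
    filter_upwards [hpos_exp, hv] with s hs hsv
    simp only [Function.comp, ← Real.exp_add, div_one]
    exact Real.log_div hsv.ne' hs.ne'
  have hu := uniform_increment (K := fun s => Real.log (f (Real.exp s))) (N := fun _ => 1)
    (H := fun v => κ * v) (ρ := 0) (p := Real.log p) (q := Real.log q)
    ((hm.comp Real.measurable_exp).log) (by fun_prop) hlog (by simp)
    (fun ε hε => Eventually.of_forall fun s v _ => by simpa using hε.le)
    (fun v w => by simp only [zero_mul, Real.exp_zero]; ring)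
  set η := min 1 (ε / (2 * (B + 1))) with hη
  have hη0 : 0 < η := by positivity
  have := Real.tendsto_log_atTop.eventually (hu η hη0)
  have hpos2 : ∀ᶠ t in atTop, ∀ x ∈ Icc p q, 0 < f (t * x) := by
    exact eventually_forall_mul hf.eventually_pos hp
  filter_upwards [this, hpos2, hf.eventually_pos, eventually_gt_atTop 0] with t ht hpx hft ht0 x hx
  have hx0 : 0 < x := hp.trans_le hx.1
  have h1 := ht (Real.log x) ⟨Real.log_le_log hp hx.1, Real.log_le_log hx0 hx.2⟩
  simp only [Real.exp_add, Real.exp_log ht0, Real.exp_log hx0, div_one] at h1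
  rw [← Real.log_div (hpx x hx).ne' hft.ne'] at h1
  set d := Real.log (f (t * x) / f t) - κ * Real.log x with hd
  have hratio : f (t * x) / f t = x ^ κ * Real.exp d := by
    rw [hd, Real.exp_sub, Real.exp_log (div_pos (hpx x hx) hft), Real.rpow_def_of_pos hx0,
      mul_comm κ]
    field_simp
  have h2 := Real.abs_exp_sub_one_le (h1.trans (min_le_left _ _))
  have h3 := hB x hx
  rw [Real.norm_eq_abs] at h3
  have : f (t * x) / f t - x ^ κ = x ^ κ * (Real.exp d - 1) := by rw [hratio]; ring
  rw [this, abs_mul]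
  have h4 : |d| ≤ ε / (2 * (B + 1)) := h1.trans (min_le_right _ _)
  calc |x ^ κ| * |Real.exp d - 1| ≤ B * (2 * (ε / (2 * (B + 1)))) := by
        gcongr; linarith
    _ ≤ ε := by
        have : B * (2 * (ε / (2 * (B + 1)))) = B / (B + 1) * ε := by field_simp
        rw [this]
        have : B / (B + 1) ≤ 1 := by rw [div_le_one (by positivity)]; linarith
        nlinarith

theorem IsRV.mul_rpow {f : ℝ → ℝ} {κ : ℝ} (hf : IsRV f κ) (hm : Measurable f) (a : ℝ) :
    IsRV (fun t => t ^ a * f t) (a + κ) where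
  measurable := (by fun_prop : Measurable fun t => t ^ a * f t).comp measurable_subtype_coe
  eventually_pos := by
    filter_upwards [hf.eventually_pos, eventually_gt_atTop 0] with t h h0
    positivity
  tendsto_ratio x hx := by
    rw [Real.rpow_add hx]
    refine ((hf.tendsto_ratio x hx).const_mul (x ^ a)).congr' ?_
    filter_upwards [hf.eventually_pos, eventually_gt_atTop 0] with t h h0
    rw [Real.mul_rpow h0.le hx.le]
    have := (Real.rpow_pos_of_pos h0 a).ne'
    field_simp

theorem IsRV.mul {f g : ℝ → ℝ} {κ κ' : ℝ} (hf : IsRV f κ) (hg : IsRV g κ') (hm : Measurable f)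
    (hm' : Measurable g) : IsRV (fun t => f t * g t) (κ + κ') where
  measurable := (by fun_prop : Measurable fun t => f t * g t).comp measurable_subtype_coe
  eventually_pos := by
    filter_upwards [hf.eventually_pos, hg.eventually_pos] with t h h0
    positivity
  tendsto_ratio x hx := by
    rw [Real.rpow_add hx]
    refine ((hf.tendsto_ratio x hx).mul (hg.tendsto_ratio x hx)).congr fun t => ?_
    rw [div_mul_div_comm]

theorem IsRV.inv {f : ℝ → ℝ} {κ : ℝ} (hf : IsRV f κ) (hm : Measurable f) :
    IsRV (fun t => (f t)⁻¹) (-κ) where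
  measurable := (by fun_prop : Measurable fun t => (f t)⁻¹).comp measurable_subtype_coe
  eventually_pos := by
    filter_upwards [hf.eventually_pos] with t h
    positivity
  tendsto_ratio x hx := by
    rw [Real.rpow_neg hx.le]
    refine ((hf.tendsto_ratio x hx).inv₀ (by positivity)).congr fun t => ?_
    rw [inv_div, inv_div_inv]

/-- Induction over the dyadic scales between `s` and `t`. -/
theorem dyadic_induction {P : ℝ → ℝ → Prop} {t₀ : ℝ} (ht₀ : 0 < t₀)
    (base : ∀ s t, t₀ ≤ s → s ≤ t → t ≤ 2 * s → P s t)
    (step : ∀ s t, t₀ ≤ s → 2 * s ≤ t → P s (t / 2) → P s t) :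
    ∀ s t, t₀ ≤ s → s ≤ t → P s t := by
  have h : ∀ n : ℕ, ∀ s t, t₀ ≤ s → s ≤ t → t ≤ 2 ^ n * s → P s t := by
    intro n
    induction n with
    | zero =>
      intro s t hs hst ht
      exact base s t hs hst (by rw [pow_zero, one_mul] at ht; linarith)
    | succ n ih =>
      intro s t hs hst ht
      rcases le_total t (2 * s) with h | h
      · exact base s t hs hst h
      · refine step s t hs h (ih s (t / 2) hs (by linarith) ?_)
        rw [pow_succ] at ht
        linarith
  intro s t hs hst
  have hs0 : 0 < s := ht₀.trans_le hs
  obtain ⟨n, hn⟩ := pow_unbounded_of_one_lt (t / s) (one_lt_two)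
  exact h n s t hs hst (by rw [div_lt_iff₀ hs0] at hn; exact hn.le)

/-- A regularly varying function of positive index is almost increasing. -/
theorem IsRV.almost_increasing {f : ℝ → ℝ} {κ : ℝ} (hf : IsRV f κ) (hm : Measurable f)
    (hκ : 0 < κ) :
    ∃ C > 0, ∃ t₀ > 0, (∀ t ≥ t₀, 0 < f t) ∧ ∀ s t, t₀ ≤ s → s ≤ t → f s ≤ C * f t := by
  have hu := hf.uniform hm (p := 1) (q := 2) one_pos (1 / 2) (by norm_num)
  have h2 := (hf.tendsto_ratio 2 two_pos).eventually
    (lt_mem_nhds (Real.one_lt_rpow one_lt_two hκ))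
  obtain ⟨t₀, ht₀⟩ := eventually_atTop.1
    ((hu.and h2).and (hf.eventually_pos.and (eventually_gt_atTop 0)))
  have hT0 : 0 < t₀ := (ht₀ t₀ le_rfl).2.2
  refine ⟨2, two_pos, t₀, hT0, fun t ht => (ht₀ t ht).2.1,
    dyadic_induction (P := fun s t => f s ≤ 2 * f t) hT0 ?_ ?_⟩
  · intro s t hs hst ht
    have hs0 := hT0.trans_le hs
    obtain ⟨⟨h1, -⟩, hfs, -⟩ := ht₀ s hs
    have hx := h1 (t / s) ⟨by rwa [le_div_iff₀ hs0, one_mul], by rwa [div_le_iff₀ hs0]⟩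
    rw [mul_div_cancel₀ _ hs0.ne'] at hx
    have : 1 ≤ (t / s) ^ κ := Real.one_le_rpow (by rwa [le_div_iff₀ hs0, one_mul]) hκ.le
    have h3 : 1 / 2 ≤ f t / f s := by linarith [(abs_le.1 hx).1]
    rw [le_div_iff₀ hfs] at h3
    linarith
  · intro s t hs hst ih
    obtain ⟨⟨-, h1⟩, hfs, -⟩ := ht₀ (t / 2) (by linarith)
    rw [div_mul_cancel₀ _ two_ne_zero, lt_div_iff₀ hfs] at h1
    linarith

/-- A regularly varying function of negative index is almost decreasing. -/
theorem IsRV.almost_decreasing {f : ℝ → ℝ} {κ : ℝ} (hf : IsRV f κ) (hm : Measurable f)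
    (hκ : κ < 0) :
    ∃ C > 0, ∃ t₀ > 0, (∀ t ≥ t₀, 0 < f t) ∧ ∀ s t, t₀ ≤ s → s ≤ t → f t ≤ C * f s := by
  obtain ⟨C, hC, t₀, ht₀, hpos, h⟩ := (hf.inv hm).almost_increasing hm.inv (neg_pos.2 hκ)
  refine ⟨C, hC, t₀, ht₀, fun t ht => inv_pos.1 (hpos t ht), fun s t hs hst => ?_⟩
  have h1 := h s t hs hst
  have p1 := inv_pos.1 (hpos s hs)
  have p2 := inv_pos.1 (hpos t (hs.trans hst))
  rw [← div_eq_mul_inv, le_div_iff₀ p2, inv_mul_le_iff₀ p1] at h1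
  linarith

theorem IsRV.tendsto_atTop {f : ℝ → ℝ} {κ : ℝ} (hf : IsRV f κ) (hm : Measurable f)
    (hκ : 0 < κ) : Tendsto f atTop atTop := by
  obtain ⟨C, hC, t₀, ht₀, hpos, h⟩ := (hf.mul_rpow hm (-(κ / 2))).almost_increasing (by fun_prop)
    (by linarith : 0 < -(κ / 2) + κ)
  have h1 : Tendsto (fun t : ℝ => t₀ ^ (-(κ / 2)) * f t₀ / C * t ^ (κ / 2)) atTop atTop :=
    (tendsto_rpow_atTop (by linarith)).const_mul_atTop (div_pos (hpos t₀ le_rfl) hC)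
  refine tendsto_atTop_mono' _ ?_ h1
  filter_upwards [eventually_ge_atTop t₀] with t ht
  have ht0 : 0 < t := ht₀.trans_le ht
  have h2 := h t₀ t le_rfl ht
  rw [Real.rpow_neg ht0.le] at h2
  have := Real.rpow_pos_of_pos ht0 (κ / 2)
  rw [div_mul_eq_mul_div, div_le_iff₀ hC]
  calc _ ≤ C * ((t ^ (κ / 2))⁻¹ * f t) * t ^ (κ / 2) := by gcongr
    _ = _ := by field_simp

theorem IsRV.tendsto_zero {f : ℝ → ℝ} {κ : ℝ} (hf : IsRV f κ) (hm : Measurable f)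
    (hκ : κ < 0) : Tendsto f atTop (𝓝 0) := by
  have := ((hf.inv hm).tendsto_atTop hm.inv (neg_pos.2 hκ)).inv_tendsto_atTop
  exact this.congr fun t => inv_inv (f t)

/-- Potter-type bound on the whole interval `(0, t]`. Requiring `0 ≤ δ` besides `-κ < δ` makes
`s ^ δ * f s` bounded near the origin, where regular variation says nothing. -/
theorem IsRV.potter {f : ℝ → ℝ} {κ δ : ℝ} (hf : IsRV f κ) (hm : Measurable f)
    (hpos : ∀ t, 0 < t → 0 ≤ f t) (hbd : ∀ T, ∃ B, ∀ t ∈ Ioc 0 T, f t ≤ B)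
    (hδ : 0 ≤ δ) (hδκ : -κ < δ) :
    ∃ C > 0, ∃ t₀ > 0, ∀ t ≥ t₀, 0 < f t ∧ ∀ x ∈ Ioc (0 : ℝ) 1, f (t * x) ≤ C * x ^ (-δ) * f t := by
  obtain ⟨C, hC, t₀, ht₀, hp, h⟩ := (hf.mul_rpow hm δ).almost_increasing (by fun_prop)
    (by linarith : 0 < δ + κ)
  obtain ⟨B, hB⟩ := hbd t₀
  have hB0 : 0 ≤ B := (hpos t₀ ht₀).trans (hB t₀ ⟨ht₀, le_rfl⟩)
  set m := t₀ ^ δ * f t₀ with hmdef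
  have hm0 : 0 < m := hp t₀ le_rfl
  refine ⟨C + t₀ ^ δ * B * C / m, by positivity, t₀, ht₀, fun t ht => ?_⟩
  have ht0 : 0 < t := ht₀.trans_le ht
  have hft : 0 < f t := by
    have := hp t ht
    have h2 := Real.rpow_pos_of_pos ht0 δ
    exact (pos_iff_pos_of_mul_pos this).1 h2
  refine ⟨hft, fun x hx => ?_⟩
  have htx : 0 < t * x := mul_pos ht0 hx.1
  have hxδ := Real.rpow_pos_of_pos hx.1 δ
  have htδ := Real.rpow_pos_of_pos ht0 δ
  rw [Real.rpow_neg hx.1.le]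
  have main : (t * x) ^ δ * f (t * x) ≤ (C + t₀ ^ δ * B * C / m) * (t ^ δ * f t) := by
    rcases le_total t₀ (t * x) with h1 | h1
    · have := h (t * x) t h1 (mul_le_of_le_one_right ht0.le hx.2)
      have h2 : 0 ≤ t₀ ^ δ * B * C / m * (t ^ δ * f t) := by positivity
      linarith
    · have h2 := hB (t * x) ⟨htx, h1⟩
      have h3 : (t * x) ^ δ ≤ t₀ ^ δ := Real.rpow_le_rpow htx.le h1 hδ
      have h4 := h t₀ t le_rfl ht
      calc (t * x) ^ δ * f (t * x) ≤ t₀ ^ δ * B :=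
            mul_le_mul h3 h2 (hpos _ htx) (by positivity)
        _ = t₀ ^ δ * B / m * m := by field_simp
        _ ≤ t₀ ^ δ * B / m * (C * (t ^ δ * f t)) := by gcongr
        _ ≤ _ := by
          have : 0 ≤ C * (t ^ δ * f t) := by positivity
          have e : t₀ ^ δ * B / m * (C * (t ^ δ * f t))
            = t₀ ^ δ * B * C / m * (t ^ δ * f t) := by ring
          rw [e, add_mul]; linarith
  rw [Real.mul_rpow ht0.le hx.1.le] at main
  have e1 : f (t * x) = (t ^ δ * x ^ δ * f (t * x)) / (t ^ δ * x ^ δ) := by field_simp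
  rw [e1, div_le_iff₀ (by positivity)]
  refine main.trans (le_of_eq ?_)
  field_simp

/-! ### Second-order regular variation -/

theorem powLog_one (ρ : ℝ) : powLog ρ 1 = 0 := by
  unfold powLog; split_ifs <;> simp

theorem powLog_mul (ρ : ℝ) {x y : ℝ} (hx : 0 < x) (hy : 0 < y) :
    powLog ρ (x * y) = powLog ρ x + x ^ ρ * powLog ρ y := by
  unfold powLog
  split_ifs with h
  · rw [Real.log_mul hx.ne' hy.ne', h, Real.rpow_zero, one_mul]
  · rw [Real.mul_rpow hx.le hy.le]; field_simp; ring

theorem powLog_two_pos (ρ : ℝ) : 0 < powLog ρ 2 := by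
  unfold powLog
  split_ifs with h
  · exact Real.log_pos one_lt_two
  · rcases lt_or_gt_of_ne h with h | h
    · exact div_pos_of_neg_of_neg (by linarith [Real.rpow_lt_one_of_one_lt_of_neg one_lt_two h]) h
    · exact div_pos (by linarith [Real.one_lt_rpow one_lt_two h]) h

theorem hasDerivAt_powLog (ρ : ℝ) {x : ℝ} (hx : 0 < x) :
    HasDerivAt (powLog ρ) (x ^ (ρ - 1)) x := by
  by_cases h : ρ = 0
  · have : powLog ρ = Real.log := by funext y; simp [powLog, h]
    rw [this, h, zero_sub, Real.rpow_neg_one]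
    exact Real.hasDerivAt_log hx.ne'
  · have : powLog ρ = fun y => (y ^ ρ - 1) / ρ := by funext y; simp [powLog, h]
    rw [this]
    refine (((Real.hasDerivAt_rpow_const (p := ρ) (Or.inl hx.ne')).sub_const 1).div_const ρ).congr_deriv ?_
    field_simp

theorem measurable_powLog (ρ : ℝ) : Measurable (powLog ρ) := by
  unfold powLog
  split_ifs <;> fun_prop

theorem IsTwoRV.aux_ne {χ A : ℝ → ℝ} {κ ρ : ℝ} (h : IsTwoRV χ κ ρ A) : ∀ᶠ t in atTop, A t ≠ 0 := by
  rcases h.aux_sign with h | h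
  · filter_upwards [h] with t ht using ht.ne'
  · filter_upwards [h] with t ht using ht.ne

theorem IsTwoRV.isRV {χ A : ℝ → ℝ} {κ ρ : ℝ} (h : IsTwoRV χ κ ρ A) : IsRV χ κ where
  measurable := h.measurable
  eventually_pos := h.eventually_pos
  tendsto_ratio x hx := by
    have h1 := ((h.tendsto_second x hx).mul h.aux_tendsto).add_const (x ^ κ)
    rw [mul_zero, zero_add] at h1
    refine h1.congr' ?_
    filter_upwards [h.aux_ne] with t ht
    field_simp
    ring

theorem IsTwoRV.mul_rpow {χ A : ℝ → ℝ} {κ ρ : ℝ} (h : IsTwoRV χ κ ρ A) (hm : Measurable χ)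
    (a : ℝ) : IsTwoRV (fun t => t ^ a * χ t) (a + κ) ρ A where
  measurable := (h.isRV.mul_rpow hm a).measurable
  eventually_pos := (h.isRV.mul_rpow hm a).eventually_pos
  rho_nonpos := h.rho_nonpos
  aux_sign := h.aux_sign
  aux_tendsto := h.aux_tendsto
  tendsto_second x hx := by
    rw [Real.rpow_add hx, mul_assoc]
    refine ((h.tendsto_second x hx).const_mul (x ^ a)).congr' ?_
    filter_upwards [h.eventually_pos, eventually_gt_atTop 0] with t ht h0
    rw [Real.mul_rpow h0.le hx.le]
    have := (Real.rpow_pos_of_pos h0 a).ne'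
    field_simp

/-- The auxiliary function may be replaced by a measurable one, obtained from the increment of `f`
over `[t, 2 t]`; its absolute value is regularly varying. -/
theorem IsTwoRV.exists_measurable_aux {f A : ℝ → ℝ} {ρ : ℝ} (h : IsTwoRV f 0 ρ A)
    (hm : Measurable f) :
    ∃ A' : ℝ → ℝ, Measurable A' ∧ Tendsto (fun t => A' t / A t) atTop (𝓝 1) ∧
      IsRV (fun t => |A' t|) ρ := by
  have hh := powLog_two_pos ρ
  set A' : ℝ → ℝ := fun t => (f (t * 2) / f t - 1) / powLog ρ 2 with hA'
  have hA'm : Measurable A' :=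
    (((hm.comp (measurable_mul_const 2)).div hm).sub_const 1).div_const _
  have hsec : ∀ x, 0 < x →
      Tendsto (fun t => (f (t * x) / f t - 1) / A t) atTop (𝓝 (powLog ρ x)) := fun x hx => by
    simpa using h.tendsto_second x hx
  have hshift : ∀ x, 0 < x → Tendsto (fun t => A' (t * x) / A t) atTop (𝓝 (x ^ ρ)) := by
    intro x hx
    have h1 := ((hsec (x * 2) (by positivity)).sub (hsec x hx)).div_const (powLog ρ 2)
    have h2 := h1.div (h.isRV.tendsto_ratio x hx) (by simp)
    have e : (powLog ρ (x * 2) - powLog ρ x) / powLog ρ 2 / x ^ (0 : ℝ) = x ^ ρ := by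
      rw [powLog_mul ρ hx two_pos, Real.rpow_zero]
      field_simp; ring
    rw [e] at h2
    refine h2.congr' ?_
    have hpx := (eventually_forall_mul h.eventually_pos hx (q := x))
    filter_upwards [h.aux_ne, h.eventually_pos, hpx] with t ht hft hx'
    have hfx := hx' x ⟨le_rfl, le_rfl⟩
    simp only [Pi.div_apply, hA', ← mul_assoc]
    field_simp
    ring
  have h1 : Tendsto (fun t => A' t / A t) atTop (𝓝 1) := by
    simpa using hshift 1 one_pos
  refine ⟨A', hA'm, h1, ?_⟩
  have hne : ∀ᶠ t in atTop, A' t ≠ 0 := by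
    filter_upwards [h1.eventually_ne one_ne_zero] with t ht h0
    simp [h0] at ht
  refine ⟨hA'm.abs.comp measurable_subtype_coe, by filter_upwards [hne] with t ht; positivity,
    fun x hx => ?_⟩
  have h2 := ((hshift x hx).div h1 one_ne_zero).abs
  rw [div_one, abs_of_pos (Real.rpow_pos_of_pos hx ρ)] at h2
  refine h2.congr' ?_
  filter_upwards [hne, h.aux_ne] with t ht hA
  simp only [Pi.div_apply, ← abs_div]
  congr 1
  field_simp

/-- Uniform second-order expansion for index `0`: `uniform_increment` applies with the regularly
varying normalization `|A'| * f`, where the sign `σ` of the auxiliary function is split off. -/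
theorem IsTwoRV.uniform_zero {f A : ℝ → ℝ} {ρ : ℝ} (h : IsTwoRV f 0 ρ A)
    (hm : Measurable f) {p q : ℝ} (hp : 0 < p) :
    ∀ ε > 0, ∀ᶠ t in atTop, ∀ x ∈ Icc p q,
      |f (t * x) / f t - 1 - A t * powLog ρ x| ≤ ε * |A t| := by
  intro ε hε
  rcases lt_or_ge q p with hqp | hpq
  · exact Eventually.of_forall fun t x hx => absurd (hx.1.trans hx.2) (not_le.2 hqp)
  have hq : 0 < q := hp.trans_le hpq
  obtain ⟨A', hA'm, hAA, hRV⟩ := h.exists_measurable_aux hm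
  obtain ⟨σ, hσ1, hσ⟩ : ∃ σ : ℝ, |σ| = 1 ∧ ∀ᶠ t in atTop, A' t = σ * |A' t| := by
    have hpos := hAA.eventually (lt_mem_nhds zero_lt_one)
    rcases h.aux_sign with hs | hs
    · refine ⟨1, by simp, ?_⟩
      filter_upwards [hpos, hs] with t h1 h2
      rw [abs_of_pos ((div_pos_iff_of_pos_right h2).1 h1), one_mul]
    · refine ⟨-1, by simp, ?_⟩
      filter_upwards [hpos, hs] with t h1 h2
      have : A' t < 0 := by
        by_contra hcon
        exact absurd (div_nonpos_of_nonneg_of_nonpos (not_lt.1 hcon) h2.le) (not_le.2 h1)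
      rw [abs_of_neg this]; ring
  have hσ0 : σ ≠ 0 := by rintro rfl; simp at hσ1
  set a : ℝ → ℝ := fun t => |A' t| * f t with ha
  have haRV : IsRV a ρ := by simpa using hRV.mul h.isRV hA'm.abs hm
  have ham : Measurable a := hA'm.abs.mul hm
  have hane := haRV.eventually_pos
  have hlim : ∀ v, Tendsto (fun s => (f (Real.exp (s + v)) - f (Real.exp s))
      / (σ * a (Real.exp s))) atTop (𝓝 (powLog ρ (Real.exp v))) := by
    intro v
    have h1 := ((h.tendsto_second _ (Real.exp_pos v)).div hAA one_ne_zero).comp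
      Real.tendsto_exp_atTop
    rw [Real.rpow_zero, one_mul, div_one] at h1
    refine h1.congr' ?_
    filter_upwards [Real.tendsto_exp_atTop.eventually h.aux_ne,
      Real.tendsto_exp_atTop.eventually h.eventually_pos,
      Real.tendsto_exp_atTop.eventually hane, Real.tendsto_exp_atTop.eventually hσ]
      with s h1 h2 h3 h4
    have h5 : A' (Real.exp s) * f (Real.exp s) = σ * a (Real.exp s) := by
      rw [ha, h4]; ring
    have h6 : A' (Real.exp s) ≠ 0 := by
      intro h0
      rw [h0, zero_mul] at h5
      exact (mul_ne_zero hσ0 h3.ne') h5.symm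
    simp only [Function.comp, Pi.div_apply, Real.exp_add, ← h5]
    field_simp
  have hu := uniform_increment (K := fun s => f (Real.exp s)) (N := fun s => σ * a (Real.exp s))
    (H := fun v => powLog ρ (Real.exp v)) (ρ := ρ) (p := Real.log p) (q := Real.log q)
    (hm.comp Real.measurable_exp)
    (continuous_iff_continuousAt.2 fun v =>
      (hasDerivAt_powLog ρ (Real.exp_pos v)).continuousAt.comp Real.continuous_exp.continuousAt)
    hlim
    (by
      filter_upwards [Real.tendsto_exp_atTop.eventually hane] with s hs
      exact mul_ne_zero hσ0 hs.ne')
    (by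
      intro η hη
      have := Real.tendsto_exp_atTop.eventually (haRV.uniform ham (p := p) (q := q) hp η hη)
      filter_upwards [this] with s hs v hv
      have h1 := hs (Real.exp v) ⟨(Real.log_le_iff_le_exp hp).1 hv.1, by
        rw [← Real.log_exp v] at hv
        exact (Real.log_le_log_iff (Real.exp_pos v) hq).1 hv.2⟩
      rw [← Real.exp_mul, mul_comm v, ← Real.exp_add] at h1
      rwa [mul_div_mul_left _ _ hσ0])
    (fun v w => by
      have : Real.exp w = Real.exp v * Real.exp (w - v) := by rw [← Real.exp_add]; ring_nf
      rw [this, powLog_mul ρ (Real.exp_pos v) (Real.exp_pos _), ← Real.exp_mul, mul_comm v]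
      ring)
  obtain ⟨B, hB⟩ := (isCompact_Icc (a := p) (b := q)).exists_bound_of_continuousOn
    (f := powLog ρ) (fun x hx => (hasDerivAt_powLog ρ (hp.trans_le hx.1)).continuousAt.continuousWithinAt)
  have hB0 : 0 ≤ B := (norm_nonneg _).trans (hB p ⟨le_rfl, hpq⟩)
  have hA2 : ∀ᶠ t in atTop, |A' t / A t - 1| ≤ min 1 (ε / (2 * (B + 1))) := by
    have := hAA.sub_const 1
    rw [sub_self] at this
    have h0 := this.abs
    rw [abs_zero] at h0
    exact h0.eventually (ge_mem_nhds (by positivity))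
  filter_upwards [hA2, Real.tendsto_log_atTop.eventually (hu (ε / 4) (by positivity)),
    eventually_gt_atTop 0, h.aux_ne, h.eventually_pos, hane, hσ] with t h1 h2 ht0 hAt hft hat hσt x hx
  have hx0 : 0 < x := hp.trans_le hx.1
  have h3 := h2 (Real.log x) ⟨Real.log_le_log hp hx.1, Real.log_le_log hx0 hx.2⟩
  simp only [Real.exp_add, Real.exp_log ht0, Real.exp_log hx0] at h3
  have h5 : A' t * f t = σ * a t := by
    rw [ha, hσt]; ring
  have h6 : A' t ≠ 0 := by
    intro h0
    rw [h0, zero_mul] at h5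
    exact (mul_ne_zero hσ0 hat.ne') h5.symm
  rw [← h5] at h3
  set r := A' t / A t with hr
  have hA' : A' t = r * A t := by rw [hr]; field_simp
  have hPB := hB x hx
  rw [Real.norm_eq_abs] at hPB
  set d := (f (t * x) - f t) / (A' t * f t) - powLog ρ x with hd
  have e : f (t * x) / f t - 1 - A t * powLog ρ x = (r * d + (r - 1) * powLog ρ x) * A t := by
    have : f (t * x) / f t - 1 = A' t * (d + powLog ρ x) := by
      rw [hd]; field_simp; ring
    rw [this, hA']; ring
  rw [e, abs_mul]
  refine mul_le_mul_of_nonneg_right ?_ (abs_nonneg _)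
  have hr2 : |r| ≤ 2 := by
    have := abs_le.1 (h1.trans (min_le_left _ _))
    rw [abs_le]; constructor <;> linarith [this.1, this.2]
  refine (abs_add_le _ _).trans ?_
  rw [abs_mul, abs_mul]
  have b1 : |r| * |d| ≤ 2 * (ε / 4) := by gcongr
  have b2 : |r - 1| * |powLog ρ x| ≤ ε / (2 * (B + 1)) * (B + 1) := by
    gcongr
    · exact h1.trans (min_le_right _ _)
    · linarith
  have b3 : ε / (2 * (B + 1)) * (B + 1) = ε / 2 := by field_simp
  linarith

theorem ratio_eq_of_rpow {χ : ℝ → ℝ} (κ : ℝ) {t x : ℝ} (ht : 0 < t) (hx : 0 < x) :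
    χ (t * x) / χ t = x ^ κ * (((t * x) ^ (-κ) * χ (t * x)) / (t ^ (-κ) * χ t)) := by
  rw [Real.mul_rpow ht.le hx.le, Real.rpow_neg hx.le]
  have h1 := (Real.rpow_pos_of_pos ht (-κ)).ne'
  have h2 := (Real.rpow_pos_of_pos hx κ).ne'
  field_simp

/-- The second-order expansion holds uniformly on compact subsets of `(0, ∞)`. -/
theorem IsTwoRV.uniform {χ A : ℝ → ℝ} {κ ρ : ℝ} (h : IsTwoRV χ κ ρ A)
    (hm : Measurable χ) {p q : ℝ} (hp : 0 < p) :
    ∀ ε > 0, ∀ᶠ t in atTop, ∀ x ∈ Icc p q,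
      |χ (t * x) / χ t - x ^ κ - A t * (x ^ κ * powLog ρ x)| ≤ ε * |A t| := by
  intro ε hε
  obtain ⟨B, hB⟩ := (isCompact_Icc (a := p) (b := q)).exists_bound_of_continuousOn
    (f := fun x => x ^ κ)
    (fun x hx => (Real.continuousAt_rpow_const _ _ (Or.inl (hp.trans_le hx.1).ne')).continuousWithinAt)
  have h0 := h.mul_rpow hm (-κ)
  rw [neg_add_cancel] at h0
  filter_upwards [h0.uniform_zero (by fun_prop) (p := p) (q := q) hp (ε / (|B| + 1)) (by positivity),
    eventually_gt_atTop 0] with t ht ht0 x hx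
  have hx0 := hp.trans_le hx.1
  have h1 := ht x hx
  have h2 := (hB x hx).trans (le_abs_self B)
  rw [Real.norm_eq_abs] at h2
  rw [ratio_eq_of_rpow κ ht0 hx0]
  have e : x ^ κ * ((t * x) ^ (-κ) * χ (t * x) / (t ^ (-κ) * χ t)) - x ^ κ
      - A t * (x ^ κ * powLog ρ x)
      = x ^ κ * ((t * x) ^ (-κ) * χ (t * x) / (t ^ (-κ) * χ t) - 1 - A t * powLog ρ x) := by ring
  rw [e, abs_mul]
  calc _ ≤ (|B| + 1) * (ε / (|B| + 1) * |A t|) := by gcongr; linarith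
    _ = ε * |A t| := by field_simp

/-- Second-order Potter bound for increments of a slowly varying function. The increment over
`[s, t]` is summed over the dyadic scales, on which the auxiliary function decays geometrically. -/
theorem IsTwoRV.potter_zero {f A : ℝ → ℝ} {ρ δ : ℝ} (h : IsTwoRV f 0 ρ A)
    (hm : Measurable f) (hδ : -ρ < δ) :
    ∃ C > 0, ∃ t₀ > 0, ∀ s t, t₀ ≤ s → s ≤ t → |f s - f t| ≤ C * (t / s) ^ δ * (|A t| * f t) := by
  obtain ⟨A', hA'm, hAA, hRV⟩ := h.exists_measurable_aux hm
  have hδ0 : 0 ≤ δ := by linarith [h.rho_nonpos]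
  obtain ⟨δ', hδ'1, hδ'2⟩ := exists_between hδ
  set a : ℝ → ℝ := fun t => |A' t| * f t with ha
  have haRV : IsRV a ρ := by simpa using hRV.mul h.isRV hA'm.abs hm
  have hane := haRV.eventually_pos
  obtain ⟨B, hB⟩ := (isCompact_Icc (a := (1 / 2 : ℝ)) (b := 1)).exists_bound_of_continuousOn
    (f := powLog ρ)
    (fun x hx => (hasDerivAt_powLog ρ (by linarith [hx.1])).continuousAt.continuousWithinAt)
  have hB0 : 0 ≤ B := (norm_nonneg _).trans (hB 1 ⟨by norm_num, le_rfl⟩)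
  have hhalf := (haRV.tendsto_ratio (1 / 2) (by norm_num)).eventually_lt_const
    (show (1 / 2 : ℝ) ^ ρ < 2 ^ δ' by
      rw [one_div, Real.inv_rpow two_pos.le, ← Real.rpow_neg two_pos.le]
      exact Real.rpow_lt_rpow_of_exponent_lt one_lt_two hδ'1)
  have hr := hAA.eventually (lt_mem_nhds (show (1 / 2 : ℝ) < 1 by norm_num))
  have hr' := hAA.eventually (gt_mem_nhds (show (1 : ℝ) < 2 by norm_num))
  obtain ⟨t₀, ht₀⟩ := eventually_atTop.1 ((((h.uniform_zero hm (p := 1 / 2) (q := 1) (by norm_num)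
    1 one_pos).and hhalf).and (hr.and hr')).and ((hane.and h.eventually_pos).and
      ((eventually_gt_atTop 0).and h.aux_ne)))
  have hT0 : 0 < t₀ := (ht₀ t₀ le_rfl).2.2.1
  have habs : ∀ t ≥ t₀, |A t| ≤ 2 * |A' t| ∧ |A' t| ≤ 2 * |A t| := by
    intro t ht
    obtain ⟨⟨-, h1, h2⟩, -, -, h3⟩ := ht₀ t ht
    have h4 : |A' t| / |A t| = A' t / A t := by
      rw [← abs_div, abs_of_pos (by linarith)]
    have h5 : 0 < |A t| := abs_pos.2 h3
    rw [← h4, lt_div_iff₀ h5] at h1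
    rw [← h4, div_lt_iff₀ h5] at h2
    constructor <;> linarith
  set C₀ := 2 * (B + 1) with hC₀
  have hone : ∀ t ≥ t₀, ∀ x ∈ Icc (1 / 2 : ℝ) 1, |f (t * x) - f t| ≤ C₀ * a t := by
    intro t ht x hx
    obtain ⟨⟨⟨h1, -⟩, -⟩, ⟨-, hft⟩, -, -⟩ := ht₀ t ht
    have h2 := h1 x hx
    have h3 := hB x hx
    rw [Real.norm_eq_abs] at h3
    have h4 : |f (t * x) / f t - 1| ≤ (B + 1) * |A t| := by
      have e : f (t * x) / f t - 1
        = (f (t * x) / f t - 1 - A t * powLog ρ x) + A t * powLog ρ x := by ring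
      rw [e]
      refine (abs_add_le _ _).trans ?_
      rw [abs_mul (A t)]
      have : |A t| * |powLog ρ x| ≤ |A t| * B := by gcongr
      linarith
    have e : f (t * x) - f t = (f (t * x) / f t - 1) * f t := by field_simp
    rw [e, abs_mul, abs_of_pos hft, ha, hC₀]
    calc _ ≤ (B + 1) * (2 * |A' t|) * f t := by
          gcongr; exact h4.trans (by gcongr; exact (habs t ht).1)
      _ = _ := by ring
  -- `θ` is the ratio of the geometric series over the dyadic scales, and `C₁` absorbs its sum.
  set θ : ℝ := 2 ^ (δ' - δ) with hθ
  have hθ1 : θ < 1 := Real.rpow_lt_one_of_one_lt_of_neg one_lt_two (by linarith)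
  have hθ0 : 0 < θ := by positivity
  set C₁ := C₀ / (1 - θ) with hC₁
  have hC₁0 : 0 < C₁ := div_pos (by positivity) (by linarith)
  have hC₁e : C₁ * θ + C₀ = C₁ := by
    have : 1 - θ ≠ 0 := by linarith
    rw [hC₁]; field_simp; ring
  have hind := dyadic_induction (P := fun s t => |f s - f t| ≤ C₁ * (t / s) ^ δ * a t) hT0
    (by
      intro s t hs hst ht
      have hs0 := hT0.trans_le hs
      have htt := hs.trans hst
      have ht0' := hT0.trans_le htt
      have h1 := hone t htt (s / t) ⟨by rw [le_div_iff₀ ht0']; linarith, by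
        rw [div_le_iff₀ ht0']; linarith⟩
      rw [mul_div_cancel₀ _ ht0'.ne'] at h1
      have hat := (ht₀ t htt).2.1.1
      have h2 : 1 ≤ (t / s) ^ δ := Real.one_le_rpow (by rwa [le_div_iff₀ hs0, one_mul]) hδ0
      have h3 : C₀ ≤ C₁ := by nlinarith
      calc |f s - f t| ≤ C₀ * a t := h1
        _ ≤ C₁ * 1 * a t := by rw [mul_one]; gcongr
        _ ≤ _ := by gcongr)
    (by
      intro s t hs hst ih
      have hs0 := hT0.trans_le hs
      have htt : t₀ ≤ t := by linarith
      have ht0' := hT0.trans_le htt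
      have hat := (ht₀ t htt).2.1.1
      have h1 := hone t htt (1 / 2) ⟨le_rfl, by norm_num⟩
      have h2 := (ht₀ t htt).1.1.2
      rw [div_lt_iff₀ hat] at h2
      rw [mul_one_div] at h1 h2
      have h3 : 1 ≤ (t / s) ^ δ :=
        Real.one_le_rpow (by rw [le_div_iff₀ hs0]; linarith) hδ0
      have h4 : (t / 2 / s) ^ δ * 2 ^ δ' = (t / s) ^ δ * θ := by
        have : t / 2 / s = (t / s) / 2 := by ring
        rw [this, Real.div_rpow (by positivity) two_pos.le, hθ, Real.rpow_sub two_pos]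
        ring
      calc |f s - f t| ≤ |f s - f (t / 2)| + |f (t / 2) - f t| := abs_sub_le _ _ _
        _ ≤ C₁ * (t / 2 / s) ^ δ * (2 ^ δ' * a t) + C₀ * 1 * a t := by
          refine add_le_add (ih.trans ?_) (by linarith)
          gcongr
        _ ≤ C₁ * (t / 2 / s) ^ δ * (2 ^ δ' * a t) + C₀ * (t / s) ^ δ * a t := by gcongr
        _ = (C₁ * θ + C₀) * (t / s) ^ δ * a t := by
          have : C₁ * (t / 2 / s) ^ δ * (2 ^ δ' * a t)
            = C₁ * ((t / 2 / s) ^ δ * 2 ^ δ') * a t := by ring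
          rw [this, h4]; ring
        _ = _ := by rw [hC₁e])
  refine ⟨C₁ * 2, by positivity, t₀, hT0, fun s t hs hst => (hind s t hs hst).trans ?_⟩
  have htt := hs.trans hst
  have hft := (ht₀ t htt).2.1.2
  have hs0 := hT0.trans_le hs
  have ht0' := hT0.trans_le htt
  calc C₁ * (t / s) ^ δ * (|A' t| * f t) ≤ C₁ * (t / s) ^ δ * (2 * |A t| * f t) := by
        gcongr; exact (habs t htt).2
    _ = _ := by ring

/-- The auxiliary function has index `ρ` as far as growth is concerned: it is not assumed measurable,
but it is asymptotic to a regularly varying one. -/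
theorem IsTwoRV.aux_mul_tendsto {f A g : ℝ → ℝ} {ρ κ : ℝ} (h : IsTwoRV f 0 ρ A)
    (hm : Measurable f) (hg : IsRV g κ) (hgm : Measurable g) (hpos : 0 < κ + ρ) :
    Tendsto (fun t => g t * |A t|) atTop atTop := by
  obtain ⟨A', hA'm, hAA, hRV⟩ := h.exists_measurable_aux hm
  have h1 := (hg.mul hRV hgm hA'm.abs).tendsto_atTop (hgm.mul hA'm.abs) hpos
  have h2 := (h1.const_mul_atTop (show (0 : ℝ) < 1 / 2 by norm_num))
  refine tendsto_atTop_mono' _ ?_ h2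
  have hr' := hAA.eventually (gt_mem_nhds (show (1 : ℝ) < 2 by norm_num))
  have hr := hAA.eventually (lt_mem_nhds (show (0 : ℝ) < 1 by norm_num))
  filter_upwards [hr, hr', hg.eventually_pos, h.aux_ne] with t h1 h2 h3 h4
  have h5 : 0 < |A t| := abs_pos.2 h4
  have h6 : |A' t| / |A t| = A' t / A t := by
    rw [← abs_div, abs_of_pos (by linarith)]
  rw [← h6, div_lt_iff₀ h5] at h2
  nlinarith

/-! ### Integrals of regularly varying functions -/

theorem intervalIntegrable_of_bound {h : ℝ → ℝ} (hm : Measurable h) {a b : ℝ} (hab : a ≤ b) (B : ℝ)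
    (hB : ∀ u ∈ Ioc a b, |h u| ≤ B) : IntervalIntegrable h volume a b := by
  rw [intervalIntegrable_iff_integrableOn_Ioc_of_le hab]
  exact IntegrableOn.of_bound measure_Ioc_lt_top hm.aestronglyMeasurable B
    ((ae_restrict_mem measurableSet_Ioc).mono hB)

theorem integral_scale (g c : ℝ → ℝ) {t : ℝ} (ht : 0 < t) :
    ∫ u in (0 : ℝ)..(t / 2), g (u / t) * c u = t * ∫ x in (0 : ℝ)..(1 / 2), g x * c (t * x) := by
  have := intervalIntegral.integral_comp_mul_left (a := 0) (b := 1 / 2)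
    (fun u => g (u / t) * c u) ht.ne'
  rw [mul_zero, mul_one_div, smul_eq_mul] at this
  rw [← mul_right_inj' (inv_ne_zero ht.ne'), ← this, inv_mul_cancel_left₀ ht.ne']
  refine intervalIntegral.integral_congr fun x _ => ?_
  simp only [mul_div_cancel_left₀ _ ht.ne']

/-- Karamata's theorem with a weight vanishing at the origin to an order that makes the limiting
integral converge. -/
theorem IsRV.tendsto_integral {c g : ℝ → ℝ} {γ m K : ℝ} (hc : IsRV c γ) (hm : Measurable c)
    (hpos : ∀ t, 0 < t → 0 ≤ c t) (hbd : ∀ T, ∃ B, ∀ t ∈ Ioc 0 T, c t ≤ B) (hg : Measurable g)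
    (hgb : ∀ x ∈ Ioc (0 : ℝ) (1 / 2), |g x| ≤ K * x ^ m) (hm0 : 0 ≤ m) (hmγ : -1 < m + γ) :
    Tendsto (fun t => (∫ u in (0 : ℝ)..(t / 2), g (u / t) * c u) / (t * c t)) atTop
      (𝓝 (∫ x in (0 : ℝ)..(1 / 2), g x * x ^ γ)) := by
  have hK : 0 ≤ K := by
    have := (abs_nonneg _).trans (hgb (1 / 2) ⟨by norm_num, le_rfl⟩)
    exact nonneg_of_mul_nonneg_left this (by positivity)
  obtain ⟨δ, hδ1, hδ2⟩ : ∃ δ, max 0 (-γ) < δ ∧ δ < m + 1 :=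
    exists_between (max_lt (by linarith) (by linarith))
  obtain ⟨C, hC, t₀, ht₀, h⟩ := hc.potter hm hpos hbd (le_of_lt ((le_max_left _ _).trans_lt hδ1))
    ((le_max_right _ _).trans_lt hδ1)
  have key : Tendsto (fun t => ∫ x in (0 : ℝ)..(1 / 2), g x * (c (t * x) / c t)) atTop
      (𝓝 (∫ x in (0 : ℝ)..(1 / 2), g x * x ^ γ)) := by
    refine intervalIntegral.tendsto_integral_filter_of_dominated_convergence
      (fun x => K * C * x ^ (m - δ)) ?_ ?_ ?_ ?_
    · refine Eventually.of_forall fun t => ?_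
      exact (hg.mul ((hm.comp (measurable_const_mul t)).div_const _)).aestronglyMeasurable
    · filter_upwards [eventually_ge_atTop t₀] with t ht
      refine Eventually.of_forall fun x hx => ?_
      rw [uIoc_of_le (by norm_num)] at hx
      obtain ⟨h1, h2⟩ := h t ht
      have h3 := h2 x ⟨hx.1, by linarith [hx.2]⟩
      have h4 : c (t * x) / c t ≤ C * x ^ (-δ) := by rwa [div_le_iff₀ h1]
      have h5 : 0 ≤ c (t * x) / c t := div_nonneg (hpos _ (mul_pos (ht₀.trans_le ht) hx.1)) h1.le
      rw [norm_mul, Real.norm_eq_abs, Real.norm_eq_abs, abs_of_nonneg h5, sub_eq_add_neg,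
        Real.rpow_add hx.1]
      calc _ ≤ (K * x ^ m) * (C * x ^ (-δ)) :=
            mul_le_mul (hgb x hx) h4 h5 (mul_nonneg hK (Real.rpow_nonneg hx.1.le _))
        _ = _ := by ring
    · exact (intervalIntegral.intervalIntegrable_rpow' (by linarith)).const_mul _
    · refine Eventually.of_forall fun x hx => ?_
      rw [uIoc_of_le (by norm_num)] at hx
      exact (hc.tendsto_ratio x hx.1).const_mul _
  refine key.congr' ?_
  filter_upwards [eventually_gt_atTop 0, hc.eventually_pos] with t ht hct
  rw [integral_scale g c ht, mul_div_mul_left _ _ ht.ne', ← intervalIntegral.integral_div]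
  refine intervalIntegral.integral_congr fun x _ => ?_
  simp only [mul_div_assoc]

/-- Second-order refinement of Karamata's theorem. The condition `0 < γ + ρ + 1` leaves room for an
exponent `δ` such that `x ^ (γ - δ)` is integrable at the origin and dominates the rescaled
difference; `γ < δ` takes care of the arguments `t * x` in a bounded range. -/
theorem IsTwoRV.tendsto_integral {c g A : ℝ → ℝ} {γ ρ K : ℝ} (hc : IsTwoRV c γ ρ A)
    (hm : Measurable c) (hpos : ∀ t, 0 < t → 0 ≤ c t)
    (hbd : ∀ T, ∃ B, ∀ t ∈ Ioc 0 T, c t ≤ B) (hg : Measurable g)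
    (hgb : ∀ x ∈ Ioc (0 : ℝ) (1 / 2), |g x| ≤ K) (hγ : 0 < γ + ρ + 1) :
    Tendsto (fun t => ((∫ u in (0 : ℝ)..(t / 2), g (u / t) * c u) / (t * c t)
      - ∫ x in (0 : ℝ)..(1 / 2), g x * x ^ γ) / A t) atTop
      (𝓝 (∫ x in (0 : ℝ)..(1 / 2), g x * (x ^ γ * powLog ρ x))) := by
  have hρ := hc.rho_nonpos
  have hK : 0 ≤ K := (abs_nonneg _).trans (hgb (1 / 2) ⟨by norm_num, le_rfl⟩)
  obtain ⟨δ, hδ1, hδ2⟩ : ∃ δ, max (max 0 γ) (-ρ) < δ ∧ δ < γ + 1 :=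
    exists_between (max_lt (max_lt (by linarith) (by linarith)) (by linarith))
  have hδ0 : 0 < δ := ((le_max_left _ _).trans (le_max_left _ _)).trans_lt hδ1
  have hδγ : γ < δ := ((le_max_right _ _).trans (le_max_left _ _)).trans_lt hδ1
  have hδρ : -ρ < δ := (le_max_right _ _).trans_lt hδ1
  set f : ℝ → ℝ := fun t => t ^ (-γ) * c t with hf
  have hfm : Measurable f := by fun_prop
  have hf2 : IsTwoRV f 0 ρ A := by
    have := hc.mul_rpow hm (-γ)
    rwa [neg_add_cancel] at this
  obtain ⟨C, hC, t₁, ht₁, hP⟩ := hf2.potter_zero hfm hδρ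
  -- `t ^ δ * |A t|` and `t ^ (δ - γ) * c t * |A t|` tend to infinity, hence are at least one.
  have hA1 := hf2.aux_mul_tendsto hfm (hf2.isRV.mul_rpow hfm δ) (by fun_prop)
    (by linarith : 0 < δ + 0 + ρ)
  have hone : IsRV (fun _ : ℝ => (1 : ℝ)) 0 :=
    ⟨measurable_const, Eventually.of_forall fun _ => one_pos, fun x hx => by simp⟩
  have hA2 := hf2.aux_mul_tendsto hfm (hone.mul_rpow measurable_const δ) (by fun_prop)
    (by linarith : 0 < δ + 0 + ρ)
  obtain ⟨t₂, ht₂⟩ := eventually_atTop.1 (((hA1.eventually_ge_atTop 1).and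
    (hA2.eventually_ge_atTop 1)).and ((hc.eventually_pos.and hc.aux_ne).and
      (eventually_ge_atTop t₁)))
  obtain ⟨B, hB⟩ := hbd t₁
  have hB0 : 0 ≤ B := (hpos t₁ ht₁).trans (hB t₁ ⟨ht₁, le_rfl⟩)
  set C₂ := C + (B * t₁ ^ (δ - γ) + t₁ ^ δ) with hC₂
  have hbound : ∀ t ≥ t₂, ∀ x ∈ Ioc (0 : ℝ) 1,
      |(c (t * x) / c t - x ^ γ) / A t| ≤ C₂ * x ^ (γ - δ) := by
    intro t ht x hx
    obtain ⟨⟨h1, h2⟩, ⟨hct, hAt⟩, htt⟩ := ht₂ t ht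
    have ht0 : 0 < t := ht₁.trans_le htt
    have hx0 := hx.1
    have hft : 0 < f t := mul_pos (Real.rpow_pos_of_pos ht0 _) hct
    have hA0 : 0 < |A t| := abs_pos.2 hAt
    have hxγ := Real.rpow_pos_of_pos hx0 γ
    have hxγδ := Real.rpow_pos_of_pos hx0 (γ - δ)
    have hxδ := Real.rpow_pos_of_pos hx0 δ
    rw [abs_div, div_le_iff₀ hA0]
    rcases le_total t₁ (t * x) with hcase | hcase
    · have h3 := hP (t * x) t hcase (mul_le_of_le_one_right ht0.le hx.2)
      have e1 : t / (t * x) = x⁻¹ := by field_simp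
      rw [e1, Real.inv_rpow hx0.le] at h3
      have e2 : c (t * x) / c t - x ^ γ = x ^ γ * (f (t * x) - f t) / f t := by
        rw [ratio_eq_of_rpow γ ht0 hx0]
        change x ^ γ * (f (t * x) / f t) - x ^ γ = _
        field_simp
      rw [e2, abs_div, abs_mul, abs_of_pos hxγ, abs_of_pos hft, div_le_iff₀ hft]
      calc x ^ γ * |f (t * x) - f t| ≤ x ^ γ * (C * (x ^ δ)⁻¹ * (|A t| * f t)) := by gcongr
        _ = C * x ^ (γ - δ) * |A t| * f t := by rw [Real.rpow_sub hx0]; ring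
        _ ≤ C₂ * x ^ (γ - δ) * |A t| * f t := by
          have : C ≤ C₂ := by rw [hC₂]; linarith [show 0 ≤ B * t₁ ^ (δ - γ) + t₁ ^ δ by positivity]
          gcongr
    · have hcx := hB (t * x) ⟨mul_pos ht0 hx0, hcase⟩
      have hcx0 := hpos (t * x) (mul_pos ht0 hx0)
      have hs1 : (t * x) ^ (δ - γ) ≤ t₁ ^ (δ - γ) :=
        Real.rpow_le_rpow (by positivity) hcase (by linarith)
      have hs2 : (t * x) ^ δ ≤ t₁ ^ δ := Real.rpow_le_rpow (by positivity) hcase hδ0.le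
      rw [Real.mul_rpow ht0.le hx0.le] at hs1 hs2
      have htδ := Real.rpow_pos_of_pos ht0 δ
      have htδγ := Real.rpow_pos_of_pos ht0 (δ - γ)
      have hxδγ := Real.rpow_pos_of_pos hx0 (δ - γ)
      have e3 : x ^ (γ - δ) = (x ^ (δ - γ))⁻¹ := by
        rw [← Real.rpow_neg hx0.le]; congr 1; ring
      have b1 : c (t * x) / c t ≤ B * t₁ ^ (δ - γ) * x ^ (γ - δ) * |A t| := by
        rw [div_le_iff₀ hct]
        have h1' : 1 ≤ t ^ (δ - γ) * c t * |A t| := by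
          have : t ^ (δ - γ) * c t * |A t| = t ^ δ * f t * |A t| := by
            rw [hf, sub_eq_add_neg, Real.rpow_add ht0]; ring
          rw [this]; exact h1
        calc c (t * x) ≤ B * 1 * 1 := by linarith
          _ ≤ B * (t ^ (δ - γ) * c t * |A t|) * 1 := by gcongr
          _ = B * (t ^ (δ - γ) * x ^ (δ - γ)) * x ^ (γ - δ) * |A t| * c t := by
            rw [e3]; field_simp
          _ ≤ B * t₁ ^ (δ - γ) * x ^ (γ - δ) * |A t| * c t := by gcongr
      have b2 : x ^ γ ≤ t₁ ^ δ * x ^ (γ - δ) * |A t| := by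
        have e4 : x ^ γ = x ^ δ * x ^ (γ - δ) := by rw [← Real.rpow_add hx0]; congr 1; ring
        rw [mul_one] at h2
        calc x ^ γ = x ^ δ * x ^ (γ - δ) * 1 := by rw [mul_one]; exact e4
          _ ≤ x ^ δ * x ^ (γ - δ) * (t ^ δ * |A t|) := by gcongr
          _ = (t ^ δ * x ^ δ) * x ^ (γ - δ) * |A t| := by ring
          _ ≤ _ := by gcongr
      have b0 : 0 ≤ c (t * x) / c t := div_nonneg hcx0 hct.le
      have b3 : 0 ≤ C * x ^ (γ - δ) * |A t| := by positivity
      have e5 : C₂ * x ^ (γ - δ) * |A t| = C * x ^ (γ - δ) * |A t|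
        + B * t₁ ^ (δ - γ) * x ^ (γ - δ) * |A t| + t₁ ^ δ * x ^ (γ - δ) * |A t| := by
        rw [hC₂]; ring
      rw [e5, abs_le]
      constructor <;> linarith
  have key : Tendsto (fun t => ∫ x in (0 : ℝ)..(1 / 2),
      g x * ((c (t * x) / c t - x ^ γ) / A t)) atTop
      (𝓝 (∫ x in (0 : ℝ)..(1 / 2), g x * (x ^ γ * powLog ρ x))) := by
    refine intervalIntegral.tendsto_integral_filter_of_dominated_convergence
      (fun x => K * C₂ * x ^ (γ - δ)) ?_ ?_ ?_ ?_
    · refine Eventually.of_forall fun t => Measurable.aestronglyMeasurable ?_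
      exact hg.mul ((((hm.comp (measurable_const_mul t)).div_const _).sub
        (by fun_prop)).div_const _)
    · filter_upwards [eventually_ge_atTop t₂] with t ht
      refine Eventually.of_forall fun x hx => ?_
      rw [uIoc_of_le (by norm_num)] at hx
      have h2 := hbound t ht x ⟨hx.1, by linarith [hx.2]⟩
      rw [norm_mul, Real.norm_eq_abs, Real.norm_eq_abs, mul_assoc]
      exact mul_le_mul (hgb x hx) h2 (abs_nonneg _) hK
    · exact (intervalIntegral.intervalIntegrable_rpow' (by linarith)).const_mul _
    · refine Eventually.of_forall fun x hx => ?_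
      rw [uIoc_of_le (by norm_num)] at hx
      exact (hc.tendsto_second x hx.1).const_mul _
  refine key.congr' ?_
  filter_upwards [eventually_gt_atTop 0, hc.eventually_pos] with t ht hct
  obtain ⟨B', hB'⟩ := hbd (t / 2)
  have i1 : IntervalIntegrable (fun x => g x * (c (t * x) / c t)) volume 0 (1 / 2) := by
    refine intervalIntegrable_of_bound
      (hg.mul ((hm.comp (measurable_const_mul t)).div_const _)) (by norm_num) (K * (B' / c t)) ?_
    intro x hx
    have hx1 : t * x ∈ Ioc 0 (t / 2) := ⟨mul_pos ht hx.1, by nlinarith [hx.2]⟩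
    have h0 : 0 ≤ c (t * x) / c t := div_nonneg (hpos _ hx1.1) hct.le
    change |g x * (c (t * x) / c t)| ≤ _
    rw [abs_mul, abs_of_nonneg h0]
    refine mul_le_mul (hgb x hx) ?_ h0 hK
    gcongr
    exact hB' _ hx1
  have i2 : IntervalIntegrable (fun x => g x * x ^ γ) volume 0 (1 / 2) := by
    have h0 : IntervalIntegrable (fun x => K * x ^ γ) volume 0 (1 / 2) :=
      (intervalIntegral.intervalIntegrable_rpow' (by linarith)).const_mul _
    refine h0.mono_fun (by fun_prop) ?_
    rw [uIoc_of_le (by norm_num)]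
    refine (ae_restrict_mem measurableSet_Ioc).mono fun x hx => ?_
    simp only [norm_mul]
    refine mul_le_mul_of_nonneg_right ?_ (norm_nonneg _)
    exact (hgb x hx).trans (le_abs_self K)
  have e : ∫ u in (0 : ℝ)..(t / 2), g (u / t) * c u
      = t * c t * ∫ x in (0 : ℝ)..(1 / 2), g x * (c (t * x) / c t) := by
    rw [integral_scale g c ht, mul_assoc, ← intervalIntegral.integral_const_mul (c t)]
    congr 1
    refine intervalIntegral.integral_congr fun x _ => ?_
    field_simp
  rw [e, mul_div_cancel_left₀ _ (mul_pos ht hct).ne', ← intervalIntegral.integral_sub i1 i2,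
    ← intervalIntegral.integral_div]
  refine intervalIntegral.integral_congr fun x _ => ?_
  ring

theorem IsRV.integrableOn_Ioi {c : ℝ → ℝ} {γ : ℝ} (hc : IsRV c γ) (hm : Measurable c)
    (hpos : ∀ t, 0 < t → 0 ≤ c t) (hbd : ∀ T, ∃ B, ∀ t ∈ Ioc 0 T, c t ≤ B) (hγ : γ < -1) :
    IntegrableOn c (Ioi 0) := by
  obtain ⟨δ, hδ1, hδ2⟩ := exists_between hγ
  obtain ⟨C, hC, t₀, ht₀, hp, h⟩ := (hc.mul_rpow hm (-δ)).almost_decreasing (by fun_prop)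
    (by linarith : -δ + γ < 0)
  obtain ⟨B, hB⟩ := hbd t₀
  rw [← Ioc_union_Ioi_eq_Ioi ht₀.le]
  refine IntegrableOn.union ?_ ?_
  · refine IntegrableOn.of_bound measure_Ioc_lt_top hm.aestronglyMeasurable B
      ((ae_restrict_mem measurableSet_Ioc).mono fun u hu => ?_)
    rw [Real.norm_eq_abs, abs_of_nonneg (hpos _ hu.1)]
    exact hB u hu
  · refine Integrable.mono' ((integrableOn_Ioi_rpow_of_lt hδ2 ht₀).const_mul
      (C * (t₀ ^ (-δ) * c t₀))) hm.aestronglyMeasurable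
      ((ae_restrict_mem measurableSet_Ioi).mono fun u hu => ?_)
    have hu0 : 0 < u := ht₀.trans hu
    have h1 := h t₀ u le_rfl (le_of_lt hu)
    rw [Real.norm_eq_abs, abs_of_nonneg (hpos _ hu0)]
    rw [Real.rpow_neg hu0.le, inv_mul_le_iff₀ (Real.rpow_pos_of_pos hu0 _)] at h1
    linarith

theorem integral_Ioi_scale (c : ℝ → ℝ) {t : ℝ} (ht : 0 < t) :
    ∫ u in Ioi t, c u = t * ∫ x in Ioi (1 : ℝ), c (t * x) := by
  have := integral_comp_mul_left_Ioi c 1 ht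
  rw [this, mul_one, smul_eq_mul, mul_inv_cancel_left₀ ht.ne']

/-- Karamata's theorem for the tail integral. -/
theorem IsRV.tendsto_integral_Ioi {c : ℝ → ℝ} {γ : ℝ} (hc : IsRV c γ) (hm : Measurable c)
    (hpos : ∀ t, 0 < t → 0 ≤ c t) (hγ : γ < -1) :
    Tendsto (fun t => (∫ u in Ioi (t / 2), c u) / (t * c t)) atTop
      (𝓝 (-1 / ((1 + γ) * (2 : ℝ) ^ (1 + γ)))) := by
  obtain ⟨δ, hδ1, hδ2⟩ := exists_between hγ
  obtain ⟨C, hC, t₀, ht₀, hp, h⟩ := (hc.mul_rpow hm (-δ)).almost_decreasing (by fun_prop)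
    (by linarith : -δ + γ < 0)
  have key : Tendsto (fun t => ∫ x in Ioi (1 : ℝ), c (t * x) / c t) atTop
      (𝓝 (∫ x in Ioi (1 : ℝ), x ^ γ)) := by
    refine tendsto_integral_filter_of_dominated_convergence (fun x => C * x ^ δ) ?_ ?_ ?_ ?_
    · refine Eventually.of_forall fun t => ?_
      exact ((hm.comp (measurable_const_mul t)).div_const _).aestronglyMeasurable
    · filter_upwards [eventually_ge_atTop t₀] with t ht
      refine (ae_restrict_mem measurableSet_Ioi).mono fun x hx => ?_
      have ht0 : 0 < t := ht₀.trans_le ht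
      have hx0 : (0 : ℝ) < x := zero_lt_one.trans hx
      have h1 := h t (t * x) ht (le_mul_of_one_le_right ht0.le (le_of_lt hx))
      have hct : 0 < c t :=
        (pos_iff_pos_of_mul_pos (hp t ht)).1 (Real.rpow_pos_of_pos ht0 _)
      rw [Real.norm_eq_abs, abs_of_nonneg (div_nonneg (hpos _ (by positivity)) hct.le),
        div_le_iff₀ hct]
      rw [Real.mul_rpow ht0.le hx0.le, Real.rpow_neg hx0.le] at h1
      have a1 := Real.rpow_pos_of_pos ht0 (-δ)
      have a2 := Real.rpow_pos_of_pos hx0 δ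
      have e : c (t * x) = (t ^ (-δ) * (x ^ δ)⁻¹ * c (t * x)) * (x ^ δ / t ^ (-δ)) := by
        field_simp
      rw [e]
      calc _ ≤ C * (t ^ (-δ) * c t) * (x ^ δ / t ^ (-δ)) := by gcongr
        _ = _ := by field_simp
    · exact (integrableOn_Ioi_rpow_of_lt hδ2 one_pos).const_mul C
    · refine (ae_restrict_mem measurableSet_Ioi).mono fun x hx => ?_
      exact hc.tendsto_ratio x (zero_lt_one.trans hx)
  rw [integral_Ioi_rpow_of_lt hγ one_pos, Real.one_rpow] at key
  have hhalf : Tendsto (fun t : ℝ => t / 2) atTop atTop := tendsto_id.atTop_div_const two_pos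
  have h2 := (key.comp hhalf).mul ((hc.tendsto_ratio (1 / 2) (by norm_num)).div_const 2)
  have e : -1 / (γ + 1) * ((1 / 2 : ℝ) ^ γ / 2) = -1 / ((1 + γ) * (2 : ℝ) ^ (1 + γ)) := by
    rw [one_div, Real.inv_rpow two_pos.le, Real.rpow_add two_pos, Real.rpow_one]
    have : γ + 1 ≠ 0 := by linarith
    have : 1 + γ ≠ 0 := by linarith
    field_simp
    ring
  rw [e] at h2
  refine h2.congr' ?_
  filter_upwards [eventually_gt_atTop 0, hc.eventually_pos, hhalf.eventually hc.eventually_pos]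
    with t ht hct hct2
  have ht2 : 0 < t / 2 := by positivity
  rw [integral_Ioi_scale c ht2]
  simp only [Function.comp, integral_div, mul_one_div]
  field_simp

/-- For index `-1` the integral over `[a t, b t]` is at least a multiple `log (b / a)` of
`t * f t`. -/
theorem IsRV.integral_ge {f : ℝ → ℝ} (hf : IsRV f (-1)) (hm : Measurable f)
    (hpos : ∀ t, 0 < t → 0 ≤ f t) (hbd : ∀ T, ∃ B, ∀ t ∈ Ioc 0 T, f t ≤ B) {a b : ℝ} (ha : 0 < a)
    (hab : a ≤ b) :
    ∀ᶠ t in atTop, Real.log (b / a) / 2 * (t * f t) ≤ ∫ u in (t * a)..(t * b), f u := by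
  have hb : 0 < b := ha.trans_le hab
  filter_upwards [hf.uniform hm (p := a) (q := b) ha (1 / (2 * b)) (by positivity),
    eventually_gt_atTop 0, hf.eventually_pos] with t h1 ht hft
  have e := intervalIntegral.integral_comp_mul_left (a := a) (b := b) f ht.ne'
  have e' : ∫ u in (t * a)..(t * b), f u = t * ∫ x in a..b, f (t * x) := by
    rw [e, smul_eq_mul, mul_inv_cancel_left₀ ht.ne']
  obtain ⟨B, hB⟩ := hbd (t * b)
  have i1 : IntervalIntegrable (fun x => f (t * x)) volume a b := by
    refine intervalIntegrable_of_bound (hm.comp (measurable_const_mul t)) hab B fun x hx => ?_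
    have hx0 : 0 < t * x := mul_pos ht (ha.trans hx.1)
    change |f (t * x)| ≤ B
    rw [abs_of_nonneg (hpos _ hx0)]
    exact hB _ ⟨hx0, by gcongr; exact hx.2⟩
  have i2 : IntervalIntegrable (fun x : ℝ => f t / 2 * x⁻¹) volume a b := by
    refine (intervalIntegral.intervalIntegrable_inv (fun x hx => ?_) continuousOn_id).const_mul _
    rw [uIcc_of_le hab] at hx
    exact (ha.trans_le hx.1).ne'
  have h2 : ∫ x in a..b, f t / 2 * x⁻¹ ≤ ∫ x in a..b, f (t * x) := by
    refine intervalIntegral.integral_mono_on hab i2 i1 fun x hx => ?_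
    have hx0 : 0 < x := ha.trans_le hx.1
    have h3 := (abs_le.1 (h1 x hx)).1
    rw [Real.rpow_neg_one] at h3
    have h4 : 1 / (2 * b) ≤ x⁻¹ / 2 := by
      rw [div_le_div_iff₀ (by positivity) two_pos, one_mul]
      have : x⁻¹ * b ≥ 1 := by
        rw [ge_iff_le, ← div_eq_inv_mul, le_div_iff₀ hx0]; linarith [hx.2]
      linarith
    have h5 : x⁻¹ / 2 ≤ f (t * x) / f t := by linarith
    rw [le_div_iff₀ hft] at h5
    linarith
  rw [intervalIntegral.integral_const_mul, integral_inv_of_pos ha hb] at h2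
  rw [e']
  calc _ = t * (f t / 2 * Real.log (b / a)) := by ring
    _ ≤ _ := by gcongr

theorem exists_log_ge (M : ℝ) : ∃ N : ℝ, 1 ≤ N ∧ M ≤ Real.log N := by
  refine ⟨Real.exp (|M|), Real.one_le_exp (abs_nonneg _), ?_⟩
  rw [Real.log_exp]; exact le_abs_self M

/-- At the boundary index the tail integral is of larger order than `t * f t`: it contains the
integral over `[t, N t]` for every `N`. -/
theorem IsRV.isLittleO_integral_Ioi {f : ℝ → ℝ} (hf : IsRV f (-1)) (hm : Measurable f)
    (hpos : ∀ t, 0 < t → 0 ≤ f t) (hbd : ∀ T, ∃ B, ∀ t ∈ Ioc 0 T, f t ≤ B)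
    (hint : IntegrableOn f (Ioi 0)) :
    (fun t => t * f t) =o[atTop] fun t => ∫ u in Ioi (t / 2), f u := by
  rw [isLittleO_iff]
  intro ε hε
  obtain ⟨N, hN1, hN⟩ := exists_log_ge (2 / ε)
  filter_upwards [hf.integral_ge hm hpos hbd one_pos hN1, eventually_gt_atTop 0] with t h1 ht
  have h0 : 0 ≤ t * f t := mul_nonneg ht.le (hpos t ht)
  have hle : t * 1 ≤ t * N := by gcongr
  have h2 : ∫ u in (t * 1)..(t * N), f u ≤ ∫ u in Ioi (t / 2), f u := by
    rw [intervalIntegral.integral_of_le hle]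
    refine setIntegral_mono_set (hint.mono_set (Ioi_subset_Ioi (by positivity)))
      ((ae_restrict_mem measurableSet_Ioi).mono fun u hu => hpos u ((half_pos ht).trans hu))
      (LE.le.eventuallyLE fun u hu => ?_)
    have := hu.1
    simp only [mem_Ioi]; linarith
  rw [Real.norm_eq_abs, Real.norm_eq_abs, abs_of_nonneg h0,
    abs_of_nonneg (setIntegral_nonneg measurableSet_Ioi fun u hu =>
      hpos u ((half_pos ht).trans hu))]
  rw [div_one] at h1
  have h3 : 1 / ε * (t * f t) ≤ ∫ u in Ioi (t / 2), f u := by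
    refine le_trans ?_ (h1.trans h2)
    refine mul_le_mul_of_nonneg_right ?_ h0
    calc 1 / ε = (2 / ε) / 2 := by ring
      _ ≤ _ := by gcongr
  calc t * f t = ε * (1 / ε * (t * f t)) := by field_simp
    _ ≤ _ := by gcongr

/-- At the boundary index the truncated integral is of larger order than `t * f t`: it contains the
integral over `[t / (2 N), t / 2]` for every `N`. -/
theorem IsRV.isLittleO_integral_one {f : ℝ → ℝ} (hf : IsRV f (-1)) (hm : Measurable f)
    (hpos : ∀ t, 0 < t → 0 ≤ f t) (hbd : ∀ T, ∃ B, ∀ t ∈ Ioc 0 T, f t ≤ B) :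
    (fun t => t * f t) =o[atTop] fun t => ∫ u in (1 : ℝ)..(t / 2), f u := by
  rw [isLittleO_iff]
  intro ε hε
  obtain ⟨N, hN1, hN⟩ := exists_log_ge (2 / ε)
  have hN0 : 0 < N := by linarith
  have ha : 0 < 1 / (2 * N) := by positivity
  have hab : 1 / (2 * N) ≤ 1 / 2 := by
    rw [div_le_div_iff₀ (by positivity) two_pos]; linarith
  filter_upwards [hf.integral_ge hm hpos hbd ha hab, eventually_ge_atTop (2 * N)]
    with t h1 htN
  have ht : 0 < t := by linarith
  have h0 : 0 ≤ t * f t := mul_nonneg ht.le (hpos t ht)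
  have h1t : 1 ≤ t * (1 / (2 * N)) := by
    rw [mul_one_div, le_div_iff₀ (by positivity)]; linarith
  have hle : t * (1 / (2 * N)) ≤ t * (1 / 2) := by gcongr
  have e : t * (1 / 2) = t / 2 := by ring
  obtain ⟨B, hB⟩ := hbd (t / 2)
  have hint : IntegrableOn f (Ioc 1 (t / 2)) := by
    refine IntegrableOn.of_bound measure_Ioc_lt_top hm.aestronglyMeasurable B
      ((ae_restrict_mem measurableSet_Ioc).mono fun u hu => ?_)
    have hu0 : 0 < u := zero_lt_one.trans hu.1
    rw [Real.norm_eq_abs, abs_of_nonneg (hpos _ hu0)]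
    exact hB u ⟨hu0, hu.2⟩
  have h1t' : (1 : ℝ) ≤ t / 2 := by linarith
  have h2 : ∫ u in (t * (1 / (2 * N)))..(t * (1 / 2)), f u ≤ ∫ u in (1 : ℝ)..(t / 2), f u := by
    rw [intervalIntegral.integral_of_le hle, intervalIntegral.integral_of_le h1t', e]
    refine setIntegral_mono_set hint
      ((ae_restrict_mem measurableSet_Ioc).mono fun u hu => hpos u (zero_lt_one.trans hu.1))
      (LE.le.eventuallyLE (Ioc_subset_Ioc_left h1t))
  have h00 : 0 ≤ ∫ u in (1 : ℝ)..(t / 2), f u :=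
    intervalIntegral.integral_nonneg h1t' fun u hu => hpos u (zero_lt_one.trans_le hu.1)
  rw [Real.norm_eq_abs, Real.norm_eq_abs, abs_of_nonneg h0, abs_of_nonneg h00]
  have e2 : (1 / 2 : ℝ) / (1 / (2 * N)) = N := by field_simp
  rw [e2] at h1
  have h3 : 1 / ε * (t * f t) ≤ ∫ u in (1 : ℝ)..(t / 2), f u := by
    refine le_trans ?_ (h1.trans h2)
    refine mul_le_mul_of_nonneg_right ?_ h0
    calc 1 / ε = (2 / ε) / 2 := by ring
      _ ≤ _ := by gcongr
  calc t * f t = ε * (1 / ε * (t * f t)) := by field_simp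
    _ ≤ _ := by gcongr

theorem tendsto_average_zero {c : ℝ → ℝ} (hm : Measurable c) (hpos : ∀ t, 0 < t → 0 ≤ c t)
    (hbd : ∀ T, ∃ B, ∀ t ∈ Ioc 0 T, c t ≤ B) (hc : Tendsto c atTop (𝓝 0)) :
    Tendsto (fun t => t⁻¹ * ∫ u in (0 : ℝ)..(t / 2), c u) atTop (𝓝 0) := by
  obtain ⟨T, hT⟩ := eventually_atTop.1 (hc.eventually (gt_mem_nhds zero_lt_one))
  obtain ⟨B, hB⟩ := hbd T
  have hbound : ∀ u, 0 < u → c u ≤ max B 1 := by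
    intro u hu
    rcases le_total u T with h | h
    · exact (hB u ⟨hu, h⟩).trans (le_max_left _ _)
    · exact (hT u h).le.trans (le_max_right _ _)
  have key : Tendsto (fun t => ∫ x in (0 : ℝ)..(1 / 2), c (t * x)) atTop
      (𝓝 (∫ x in (0 : ℝ)..(1 / 2), (0 : ℝ))) := by
    refine intervalIntegral.tendsto_integral_filter_of_dominated_convergence
      (fun _ => max B 1) ?_ ?_ ?_ ?_
    · exact Eventually.of_forall fun t => (hm.comp (measurable_const_mul t)).aestronglyMeasurable
    · filter_upwards [eventually_gt_atTop 0] with t ht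
      refine Eventually.of_forall fun x hx => ?_
      rw [uIoc_of_le (by norm_num)] at hx
      have := mul_pos ht hx.1
      rw [Real.norm_eq_abs, abs_of_nonneg (hpos _ this)]
      exact hbound _ this
    · exact intervalIntegrable_const
    · refine Eventually.of_forall fun x hx => ?_
      rw [uIoc_of_le (by norm_num)] at hx
      exact hc.comp (tendsto_id.atTop_mul_const hx.1)
  rw [intervalIntegral.integral_zero] at key
  refine key.congr' ?_
  filter_upwards [eventually_gt_atTop 0] with t ht
  have := integral_scale (fun _ => 1) c ht
  simp only [one_mul] at this
  rw [this, inv_mul_cancel_left₀ ht.ne']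

theorem tendsto_integral_atTop_of_not_integrable {c : ℝ → ℝ} (hm : Measurable c)
    (hpos : ∀ t, 0 < t → 0 ≤ c t) (hbd : ∀ T, ∃ B, ∀ t ∈ Ioc 0 T, c t ≤ B) {a : ℝ} (ha : 0 ≤ a)
    (hnot : ¬ IntegrableOn c (Ioi a)) :
    Tendsto (fun t => ∫ u in a..(t / 2), c u) atTop atTop := by
  have hhalf : Tendsto (fun t : ℝ => t / 2) atTop atTop := tendsto_id.atTop_div_const two_pos
  have hii : ∀ T, IntegrableOn c (Ioc a T) := fun T => by
    obtain ⟨B, hB⟩ := hbd T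
    refine IntegrableOn.of_bound measure_Ioc_lt_top hm.aestronglyMeasurable B
      ((ae_restrict_mem measurableSet_Ioc).mono fun u hu => ?_)
    have hu0 : 0 < u := ha.trans_lt hu.1
    rw [Real.norm_eq_abs, abs_of_nonneg (hpos u hu0)]
    exact hB u ⟨hu0, hu.2⟩
  by_contra hcon
  rw [tendsto_atTop] at hcon
  push Not at hcon
  obtain ⟨M, hM⟩ := hcon
  refine hnot (integrableOn_Ioi_of_intervalIntegral_norm_bounded M a (l := atTop)
    (fun t => hii _) hhalf ?_)
  filter_upwards [eventually_ge_atTop (2 * a)] with t ht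
  obtain ⟨s, hs, hsM⟩ := (frequently_atTop.1 hM) t
  refine le_trans ?_ hsM.le
  have h1 : a ≤ t / 2 := by linarith
  have h2 : t / 2 ≤ s / 2 := by linarith
  rw [intervalIntegral.integral_of_le h1, intervalIntegral.integral_of_le (h1.trans h2),
    setIntegral_congr_fun (g := c) measurableSet_Ioc fun u hu => by
      rw [Real.norm_eq_abs, abs_of_nonneg (hpos u (ha.trans_lt hu.1))]]
  exact setIntegral_mono_set (hii _)
    ((ae_restrict_mem measurableSet_Ioc).mono fun u hu => hpos u (ha.trans_lt hu.1))
    (LE.le.eventuallyLE (Ioc_subset_Ioc_right h2))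

noncomputable section

/-! ### Integration by parts against a distribution -/

theorem tail_nonneg (G : Measure ℝ) (t : ℝ) : 0 ≤ tail G t := measureReal_nonneg

theorem tail_le_one (G : Measure ℝ) [IsProbabilityMeasure G] (t : ℝ) : tail G t ≤ 1 :=
  measureReal_le_one

theorem measurable_tail (G : Measure ℝ) [IsProbabilityMeasure G] : Measurable (tail G) :=
  Antitone.measurable fun _ _ h => measureReal_mono (Ioi_subset_Ioi h)

theorem measureReal_Ioc_eq (G : Measure ℝ) [IsProbabilityMeasure G] {s T : ℝ} (h : s ≤ T) :
    G.real (Ioc s T) = tail G s - tail G T := by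
  unfold tail
  rw [← Ioc_union_Ioi_eq_Ioi h, measureReal_union _ measurableSet_Ioi]
  · ring
  · exact Set.disjoint_left.2 fun x hx hx' => not_lt.2 hx.2 hx'

theorem measureReal_Icc_zero_eq (G : Measure ℝ) [IsProbabilityMeasure G] (h0 : G (Iio 0) = 0)
    {T : ℝ} (hT : 0 ≤ T) : G.real (Icc 0 T) = 1 - tail G T := by
  have h1 : G.real (Iio 0 ∪ (Icc 0 T ∪ Ioi T)) = G.real (Icc 0 T) + tail G T := by
    rw [measureReal_union _ (measurableSet_Icc.union measurableSet_Ioi),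
      measureReal_union _ measurableSet_Ioi]
    · simp [Measure.real, h0, tail]
    · exact Set.disjoint_left.2 fun x hx hx' => not_lt.2 hx.2 hx'
    · refine Set.disjoint_left.2 fun x hx hx' => ?_
      rcases hx' with h | h
      · exact not_lt.2 h.1 hx
      · exact not_lt.2 hT (lt_trans h hx)
  rw [Icc_union_Ioi_eq_Ici hT, Iio_union_Ici, probReal_univ] at h1
  linarith

/-- Integration by parts, by Fubini's theorem from `ψ u = ψ 0 + ∫ s in 0..u, ψ' s`. -/
theorem integral_by_parts (G : Measure ℝ) [IsProbabilityMeasure G] (h0 : G (Iio 0) = 0)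
    {ψ ψ' : ℝ → ℝ} {T B : ℝ} (hT : 0 ≤ T) (hd : ∀ s ∈ Icc 0 T, HasDerivAt ψ (ψ' s) s)
    (hm : Measurable ψ') (hB : ∀ s ∈ Icc 0 T, |ψ' s| ≤ B) :
    ∫ u in Icc 0 T, ψ u ∂G = ψ 0 - ψ T * tail G T + ∫ s in (0 : ℝ)..T, ψ' s * tail G s := by
  -- Truncating `ψ'` makes it bounded on the whole line.
  set p : ℝ → ℝ := (Icc 0 T).indicator ψ' with hp
  have hpm : Measurable p := hm.indicator measurableSet_Icc
  have hB0 : 0 ≤ B := (abs_nonneg _).trans (hB 0 ⟨le_rfl, hT⟩)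
  have hpB : ∀ s, |p s| ≤ B := by
    intro s
    by_cases hs : s ∈ Icc 0 T
    · rw [hp, indicator_of_mem hs]; exact hB s hs
    · rw [hp, indicator_of_notMem hs, abs_zero]; exact hB0
  have hint : ∀ a b, IntervalIntegrable p volume a b := by
    intro a b
    rw [intervalIntegrable_iff]
    exact IntegrableOn.of_bound measure_Ioc_lt_top hpm.aestronglyMeasurable B
      (Eventually.of_forall hpB)
  have hFTC : ∀ u ∈ Icc 0 T, ∫ s in (0 : ℝ)..u, p s = ψ u - ψ 0 := by
    intro u hu
    refine intervalIntegral.integral_eq_sub_of_hasDerivAt (fun s hs => ?_) (hint 0 u)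
    rw [uIcc_of_le hu.1] at hs
    have hs' : s ∈ Icc 0 T := ⟨hs.1, hs.2.trans hu.2⟩
    rw [hp, indicator_of_mem hs']
    exact hd s hs'
  have hker : Measurable (Function.uncurry fun u s : ℝ => if s < u then p s else 0) :=
    Measurable.ite (measurableSet_lt measurable_snd measurable_fst) (hpm.comp measurable_snd)
      measurable_const
  have hswap : ∫ u in Icc 0 T, (∫ s in Ioc 0 T, if s < u then p s else 0) ∂G
      = ∫ s in Ioc 0 T, ∫ u in Icc 0 T, (if s < u then p s else 0) ∂G := by
    refine integral_integral_swap (Integrable.of_bound hker.aestronglyMeasurable B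
      (Eventually.of_forall fun z => ?_))
    simp only [Function.uncurry]
    split_ifs
    · exact hpB _
    · simpa using hB0
  have hL : ∫ u in Icc 0 T, (∫ s in Ioc 0 T, if s < u then p s else 0) ∂G
      = ∫ u in Icc 0 T, (ψ u - ψ 0) ∂G := by
    refine setIntegral_congr_fun measurableSet_Icc fun u hu => ?_
    have e : (fun s => if s < u then p s else 0) = (Iio u).indicator p := by
      funext s; simp [indicator, mem_Iio]
    have e2 : Ioc 0 T ∩ Iio u = Ioo 0 u := by
      ext s
      simp only [mem_inter_iff, mem_Ioc, mem_Iio, mem_Ioo]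
      constructor
      · rintro ⟨⟨h1, -⟩, h2⟩; exact ⟨h1, h2⟩
      · rintro ⟨h1, h2⟩; exact ⟨⟨h1, h2.le.trans hu.2⟩, h2⟩
    simp only [e]
    rw [setIntegral_indicator measurableSet_Iio, e2, ← integral_Ioc_eq_integral_Ioo,
      ← intervalIntegral.integral_of_le hu.1, hFTC u hu]
  have hR : ∫ s in Ioc 0 T, ∫ u in Icc 0 T, (if s < u then p s else 0) ∂G
      = ∫ s in Ioc 0 T, (ψ' s * tail G s - p s * tail G T) := by
    refine setIntegral_congr_fun measurableSet_Ioc fun s hs => ?_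
    have e : (fun u => if s < u then p s else 0) = (Ioi s).indicator (fun _ => p s) := by
      funext u; simp [indicator, mem_Ioi]
    have e2 : Icc 0 T ∩ Ioi s = Ioc s T := by
      ext u
      simp only [mem_inter_iff, mem_Icc, mem_Ioi, mem_Ioc]
      constructor
      · rintro ⟨⟨-, h1⟩, h2⟩; exact ⟨h2, h1⟩
      · rintro ⟨h1, h2⟩; exact ⟨⟨(hs.1.trans h1).le, h2⟩, h1⟩
    simp only [e]
    rw [setIntegral_indicator measurableSet_Ioi, e2, setIntegral_const,
      measureReal_Ioc_eq G hs.2, hp, indicator_of_mem (Ioc_subset_Icc_self hs), smul_eq_mul]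
    ring
  have i1 : IntegrableOn (fun s => ψ' s * tail G s) (Ioc 0 T) := by
    refine IntegrableOn.of_bound measure_Ioc_lt_top
      (hm.mul (measurable_tail G)).aestronglyMeasurable (B * 1)
      ((ae_restrict_mem measurableSet_Ioc).mono fun s hs => ?_)
    rw [norm_mul]
    refine mul_le_mul (hB s (Ioc_subset_Icc_self hs)) ?_ (norm_nonneg _) hB0
    rw [Real.norm_eq_abs, abs_of_nonneg (tail_nonneg G s)]
    exact tail_le_one G s
  have i2 : IntegrableOn (fun s => p s * tail G T) (Ioc 0 T) :=
    ((intervalIntegrable_iff_integrableOn_Ioc_of_le hT).1 (hint 0 T)).mul_const _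
  have i3 : IntegrableOn ψ (Icc 0 T) G :=
    ContinuousOn.integrableOn_compact isCompact_Icc
      fun s hs => (hd s hs).continuousAt.continuousWithinAt
  rw [hL, hR, integral_sub i3 (integrable_const _), integral_sub i1 i2, setIntegral_const,
    integral_mul_const, ← intervalIntegral.integral_of_le hT, ← intervalIntegral.integral_of_le hT,
    hFTC T ⟨hT, le_rfl⟩, measureReal_Icc_zero_eq G h0 hT, smul_eq_mul] at hswap
  linarith

/-- A weight `φ`, differentiable on `[0, 1/2]` with bounded derivative `φ'`. Derivatives are
two-sided at the endpoints, and measurability is required on the whole line. -/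
structure IsWeight (φ φ' : ℝ → ℝ) : Prop where
  meas : Measurable φ
  meas' : Measurable φ'
  hasDerivAt : ∀ x ∈ Icc (0 : ℝ) (1 / 2), HasDerivAt φ (φ' x) x
  bound' : ∃ K, ∀ x ∈ Icc (0 : ℝ) (1 / 2), |φ' x| ≤ K

theorem IsWeight.continuousOn {φ φ' : ℝ → ℝ} (h : IsWeight φ φ') : ContinuousOn φ (Icc 0 (1 / 2)) :=
  fun x hx => (h.hasDerivAt x hx).continuousAt.continuousWithinAt

theorem IsWeight.bound {φ φ' : ℝ → ℝ} (h : IsWeight φ φ') :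
    ∃ K, ∀ x ∈ Icc (0 : ℝ) (1 / 2), |φ x| ≤ K :=
  isCompact_Icc.exists_bound_of_continuousOn h.continuousOn

theorem IsWeight.lipschitz {φ φ' : ℝ → ℝ} (h : IsWeight φ φ') :
    ∃ K ≥ 0, ∀ x ∈ Icc (0 : ℝ) (1 / 2), |φ x - φ 0| ≤ K * x := by
  obtain ⟨K, hK⟩ := h.bound'
  refine ⟨K, (abs_nonneg _).trans (hK 0 ⟨le_rfl, by norm_num⟩), fun x hx => ?_⟩
  have := (convex_Icc (0 : ℝ) (1 / 2)).norm_image_sub_le_of_norm_hasDerivWithin_le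
    (fun y hy => (h.hasDerivAt y hy).hasDerivWithinAt) hK
    ⟨le_rfl, by norm_num⟩ hx
  rwa [sub_zero, Real.norm_eq_abs, Real.norm_eq_abs, abs_of_nonneg hx.1] at this

/-- The integral of `φ (u / t)` over `[0, t / 2]` against the tilted measure `exp (α u) dG(u)`. -/
def expConv (G : Measure ℝ) (α : ℝ) (φ : ℝ → ℝ) (t : ℝ) : ℝ :=
  ∫ u in Icc (0 : ℝ) (t / 2), φ (u / t) * Real.exp (α * u) ∂G

theorem div_mem_half {t u : ℝ} (ht : 0 < t) (hu : u ∈ Icc 0 (t / 2)) :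
    u / t ∈ Icc (0 : ℝ) (1 / 2) :=
  ⟨div_nonneg hu.1 ht.le, by rw [div_le_iff₀ ht]; linarith [hu.2]⟩

theorem integrableOn_expConv (G : Measure ℝ) [IsProbabilityMeasure G] (α : ℝ) {φ : ℝ → ℝ} {K : ℝ}
    (hm : Measurable φ) (hK : ∀ x ∈ Icc (0 : ℝ) (1 / 2), |φ x| ≤ K) {t : ℝ} (ht : 0 < t) :
    IntegrableOn (fun u => φ (u / t) * Real.exp (α * u)) (Icc 0 (t / 2)) G := by
  have h1 : IntegrableOn (fun u => Real.exp (α * u)) (Icc 0 (t / 2)) G :=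
    ContinuousOn.integrableOn_compact isCompact_Icc (by fun_prop)
  refine h1.bdd_mul (c := K) (hm.comp (measurable_id.div_const t)).aestronglyMeasurable
    ((ae_restrict_mem measurableSet_Icc).mono fun u hu => ?_)
  exact hK _ (div_mem_half ht hu)

variable {G : Measure ℝ} {α : ℝ} {c : ℝ → ℝ}

theorem tilt_measurable [IsProbabilityMeasure G] (hc : ∀ t, c t = Real.exp (α * t) * tail G t) :
    Measurable c := by
  rw [funext hc]
  exact (by fun_prop : Measurable fun t => Real.exp (α * t)).mul (measurable_tail G)

theorem tilt_nonneg (hc : ∀ t, c t = Real.exp (α * t) * tail G t) (t : ℝ) : 0 ≤ c t := by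
  rw [hc]; exact mul_nonneg (Real.exp_pos _).le (tail_nonneg G t)

theorem tilt_bounded [IsProbabilityMeasure G] (hα : 0 < α)
    (hc : ∀ t, c t = Real.exp (α * t) * tail G t) (T : ℝ) : ∃ B, ∀ t ∈ Ioc 0 T, c t ≤ B := by
  refine ⟨Real.exp (α * T), fun t ht => ?_⟩
  rw [hc]
  calc _ ≤ Real.exp (α * T) * 1 := by
        refine mul_le_mul (Real.exp_le_exp.2 (by have := ht.2; gcongr)) (tail_le_one G t)
          (tail_nonneg G t) (Real.exp_pos _).le
    _ = _ := mul_one _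

theorem tilt_intervalIntegrable [IsProbabilityMeasure G] (hα : 0 < α)
    (hc : ∀ t, c t = Real.exp (α * t) * tail G t) {g : ℝ → ℝ} (hg : Measurable g) {T K : ℝ}
    (hT : 0 ≤ T) (hK : ∀ u ∈ Ioc 0 T, |g u| ≤ K) :
    IntervalIntegrable (fun u => g u * c u) volume 0 T := by
  obtain ⟨B, hB⟩ := tilt_bounded hα hc T
  refine intervalIntegrable_of_bound (hg.mul (tilt_measurable hc)) hT (|K| * B) fun u hu => ?_
  change |g u * c u| ≤ _
  rw [abs_mul, abs_of_nonneg (tilt_nonneg hc u)]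
  exact mul_le_mul ((hK u hu).trans (le_abs_self K)) (hB u hu) (tilt_nonneg hc u) (abs_nonneg _)

/-- Integration by parts turns an integral against `exp (α u) dG(u)` into Lebesgue integrals
against `c`. -/
theorem expConv_eq [IsProbabilityMeasure G] (h0 : G (Iio 0) = 0) (hα : 0 < α)
    (hc : ∀ t, c t = Real.exp (α * t) * tail G t) {φ φ' : ℝ → ℝ} (hφ : IsWeight φ φ') {t : ℝ}
    (ht : 0 < t) :
    expConv G α φ t = φ 0 - φ (1 / 2) * c (t / 2)
      + α * (∫ u in (0 : ℝ)..(t / 2), φ (u / t) * c u)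
      + t⁻¹ * ∫ u in (0 : ℝ)..(t / 2), φ' (u / t) * c u := by
  obtain ⟨K, hK⟩ := hφ.bound
  obtain ⟨K', hK'⟩ := hφ.bound'
  have hK0 : 0 ≤ K := (abs_nonneg _).trans (hK 0 ⟨le_rfl, by norm_num⟩)
  have hK'0 : 0 ≤ K' := (abs_nonneg _).trans (hK' 0 ⟨le_rfl, by norm_num⟩)
  have hm : Measurable fun u => φ (u / t) := hφ.meas.comp (measurable_id.div_const t)
  have hm' : Measurable fun u => φ' (u / t) := hφ.meas'.comp (measurable_id.div_const t)
  have hexp : Measurable fun u : ℝ => Real.exp (α * u) := by fun_prop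
  have hparts := integral_by_parts G h0 (T := t / 2)
    (ψ := fun u => φ (u / t) * Real.exp (α * u))
    (ψ' := fun u => φ' (u / t) * t⁻¹ * Real.exp (α * u) + φ (u / t) * (Real.exp (α * u) * α))
    (B := K' * t⁻¹ * Real.exp (α * (t / 2)) + K * (Real.exp (α * (t / 2)) * α)) (by positivity)
    (fun s hs => by
      have h1 := (hφ.hasDerivAt _ (div_mem_half ht hs)).comp s ((hasDerivAt_id s).div_const t)
      have h2 : HasDerivAt (fun u => Real.exp (α * u)) (Real.exp (α * s) * α) s := by
        simpa using ((hasDerivAt_id s).const_mul α).exp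
      have h3 := h1.mul h2
      rw [one_div] at h3
      exact h3)
    (((hm'.mul_const _).mul hexp).add (hm.mul (hexp.mul_const _)))
    (fun s hs => by
      have hx := div_mem_half ht hs
      have he : Real.exp (α * s) ≤ Real.exp (α * (t / 2)) :=
        Real.exp_le_exp.2 (by have := hs.2; gcongr)
      refine (abs_add_le _ _).trans ?_
      rw [abs_mul, abs_mul, abs_mul, abs_mul, Real.abs_exp, abs_of_pos (inv_pos.2 ht),
        abs_of_pos hα]
      have := hK _ hx
      have := hK' _ hx
      gcongr)
  unfold expConv
  rw [hparts]
  have i1 := tilt_intervalIntegrable hα hc hm (T := t / 2) (K := K) (by positivity)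
    fun u hu => hK _ (div_mem_half ht (Ioc_subset_Icc_self hu))
  have i2 := tilt_intervalIntegrable hα hc hm' (T := t / 2) (K := K') (by positivity)
    fun u hu => hK' _ (div_mem_half ht (Ioc_subset_Icc_self hu))
  rw [← intervalIntegral.integral_const_mul, ← intervalIntegral.integral_const_mul, add_assoc,
    ← intervalIntegral.integral_add (i1.const_mul _) (i2.const_mul _), hc (t / 2)]
  have e : t / 2 / t = 1 / 2 := by field_simp
  simp only [zero_div, mul_zero, Real.exp_zero, mul_one, e, mul_assoc]
  congr 1
  refine intervalIntegral.integral_congr fun u _ => ?_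
  simp only [hc u]
  ring

theorem isWeight_one : IsWeight (fun _ => 1) (fun _ => 0) :=
  ⟨measurable_const, measurable_const, fun x _ => hasDerivAt_const x 1, 0, by simp⟩

theorem expConv_one_eq [IsProbabilityMeasure G] (h0 : G (Iio 0) = 0) (hα : 0 < α)
    (hc : ∀ t, c t = Real.exp (α * t) * tail G t) {t : ℝ} (ht : 0 < t) :
    expConv G α (fun _ => 1) t = 1 - c (t / 2) + α * ∫ u in (0 : ℝ)..(t / 2), c u := by
  have := expConv_eq h0 hα hc isWeight_one ht
  simpa using this

theorem expConv_one_nonneg (t : ℝ) : 0 ≤ expConv G α (fun _ => 1) t :=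
  integral_nonneg fun u => by simpa using (Real.exp_pos _).le

/-! ### Exponential moments -/

theorem expMoment_lt_top_iff : expMoment G α < ⊤ ↔
    IntegrableOn (fun u => Real.exp (α * u)) (Ici 0) G := by
  unfold expMoment IntegrableOn Integrable
  rw [hasFiniteIntegral_iff_ofReal (Eventually.of_forall fun u => (Real.exp_pos _).le)]
  exact ⟨fun h => ⟨(by fun_prop : Measurable fun u : ℝ => Real.exp (α * u)).aestronglyMeasurable,
    h⟩, fun h => h.2⟩

theorem expMoment_toReal : (expMoment G α).toReal = ∫ u in Ici (0 : ℝ), Real.exp (α * u) ∂G := by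
  unfold expMoment
  rw [integral_eq_lintegral_of_nonneg_ae (Eventually.of_forall fun u => (Real.exp_pos _).le)
    (by fun_prop : Measurable fun u : ℝ => Real.exp (α * u)).aestronglyMeasurable]

theorem integrableOn_Ici_of_bounded [IsProbabilityMeasure G] {f : ℝ → ℝ} (hf : Continuous f)
    (hpos : ∀ u, 0 ≤ u → 0 ≤ f u) (I : ℝ)
    (hI : ∀ᶠ T in atTop, ∫ u in Icc 0 T, f u ∂G ≤ I) : IntegrableOn f (Ici 0) G := by
  have hset : ∀ T : ℝ, (G.restrict (Ici 0)).restrict (Iic T) = G.restrict (Icc 0 T) := by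
    intro T
    rw [Measure.restrict_restrict measurableSet_Iic, inter_comm]
    rfl
  refine (aecover_Iic (μ := G.restrict (Ici 0)) (tendsto_id (α := ℝ) (x := atTop))
    ).integrable_of_integral_bounded_of_nonneg_ae I (fun T => ?_)
    ((ae_restrict_mem measurableSet_Ici).mono fun u hu => hpos u hu) ?_
  · rw [IntegrableOn, id, hset]
    exact hf.continuousOn.integrableOn_compact isCompact_Icc
  · filter_upwards [hI] with T hT
    rw [id, hset]; exact hT

/-- Dominated convergence for weights against the tilted measure, when it is finite. -/
theorem tendsto_expConv (hint : IntegrableOn (fun u => Real.exp (α * u)) (Ici 0) G)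
    {φ φ' : ℝ → ℝ} (hφ : IsWeight φ φ') :
    Tendsto (expConv G α φ) atTop (𝓝 (φ 0 * ∫ u in Ici (0 : ℝ), Real.exp (α * u) ∂G)) := by
  obtain ⟨K, hK⟩ := hφ.bound
  have hK0 : 0 ≤ K := (abs_nonneg _).trans (hK 0 ⟨le_rfl, by norm_num⟩)
  rw [← integral_const_mul]
  have key : Tendsto (fun t => ∫ u in Ici (0 : ℝ),
      (Iic (t / 2)).indicator (fun u => φ (u / t) * Real.exp (α * u)) u ∂G) atTop
      (𝓝 (∫ u in Ici (0 : ℝ), φ 0 * Real.exp (α * u) ∂G)) := by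
    refine tendsto_integral_filter_of_dominated_convergence
      (fun u => K * Real.exp (α * u)) ?_ ?_ (hint.const_mul K) ?_
    · refine Eventually.of_forall fun t => Measurable.aestronglyMeasurable ?_
      exact ((hφ.meas.comp (measurable_id.div_const t)).mul
        (by fun_prop : Measurable fun u : ℝ => Real.exp (α * u))).indicator measurableSet_Iic
    · filter_upwards [eventually_gt_atTop 0] with t ht
      refine (ae_restrict_mem measurableSet_Ici).mono fun u hu => ?_
      by_cases h : u ∈ Iic (t / 2)
      · rw [indicator_of_mem h, norm_mul, Real.norm_eq_abs, Real.norm_eq_abs, Real.abs_exp]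
        exact mul_le_mul_of_nonneg_right (hK _ (div_mem_half ht ⟨hu, h⟩)) (Real.exp_pos _).le
      · rw [indicator_of_notMem h, norm_zero]
        positivity
    · refine Eventually.of_forall fun u => ?_
      have h1 : Tendsto (fun t : ℝ => u / t) atTop (𝓝 0) := tendsto_const_nhds.div_atTop tendsto_id
      have h2 := ((hφ.hasDerivAt 0 ⟨le_rfl, by norm_num⟩).continuousAt.tendsto.comp h1).mul_const
        (Real.exp (α * u))
      refine h2.congr' ?_
      filter_upwards [eventually_ge_atTop (2 * u)] with t ht
      rw [indicator_of_mem (show u ∈ Iic (t / 2) by simp only [mem_Iic]; linarith)]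
      rfl
  refine key.congr fun t => ?_
  rw [setIntegral_indicator measurableSet_Iic]
  rfl

/-- A finite exponential moment bounds the integrals of `c`, by integration by parts. -/
theorem integrableOn_tilt_of_moment [IsProbabilityMeasure G] (h0 : G (Iio 0) = 0) (hα : 0 < α)
    (hc : ∀ t, c t = Real.exp (α * t) * tail G t) (hc0 : Tendsto c atTop (𝓝 0))
    (hint : IntegrableOn (fun u => Real.exp (α * u)) (Ici 0) G) : IntegrableOn c (Ioi 0) := by
  have h1 := tendsto_expConv hint isWeight_one
  have hhalf : Tendsto (fun t : ℝ => t / 2) atTop atTop := tendsto_id.atTop_div_const two_pos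
  have h2 := ((h1.add (hc0.comp hhalf)).sub_const 1).div_const α
  obtain ⟨I, hI⟩ : ∃ I, ∀ᶠ t in atTop, ∫ u in (0 : ℝ)..(t / 2), c u ≤ I := by
    have h3 := h2.eventually_le_const (lt_add_one _)
    refine ⟨(1 * (∫ u in Ici 0, Real.exp (α * u) ∂G) + 0 - 1) / α + 1, ?_⟩
    filter_upwards [h3, eventually_gt_atTop 0] with t ht ht0
    rw [expConv_one_eq h0 hα hc ht0] at ht
    refine le_trans (le_of_eq ?_) ht
    simp only [Function.comp]
    field_simp
    ring
  refine integrableOn_Ioi_of_intervalIntegral_norm_bounded I 0 (l := atTop) (fun t => ?_) hhalf ?_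
  · rcases le_total 0 (t / 2) with h | h
    · rw [← intervalIntegrable_iff_integrableOn_Ioc_of_le h]
      have := tilt_intervalIntegrable hα hc (measurable_const (a := (1 : ℝ))) h
        (K := 1) (by simp)
      simpa using this
    · rw [Ioc_eq_empty (not_lt.2 h)]; exact integrableOn_empty
  · filter_upwards [hI] with t ht
    simpa [abs_of_nonneg (tilt_nonneg hc _)] using ht

theorem moment_of_integrableOn_tilt [IsProbabilityMeasure G] (h0 : G (Iio 0) = 0) (hα : 0 < α)
    (hc : ∀ t, c t = Real.exp (α * t) * tail G t) (hint : IntegrableOn c (Ioi 0)) :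
    IntegrableOn (fun u => Real.exp (α * u)) (Ici 0) G := by
  refine integrableOn_Ici_of_bounded (by fun_prop) (fun u _ => (Real.exp_pos _).le)
    (1 + α * ∫ u in Ioi 0, c u) ?_
  filter_upwards [eventually_gt_atTop 0] with T hT
  have h1 := expConv_one_eq h0 hα hc (t := 2 * T) (by positivity)
  have e : 2 * T / 2 = T := by ring
  simp only [expConv, e, one_mul] at h1
  rw [h1, intervalIntegral.integral_of_le hT.le]
  have h2 : ∫ u in Ioc 0 T, c u ≤ ∫ u in Ioi 0, c u :=
    setIntegral_mono_set hint (Eventually.of_forall fun u => tilt_nonneg hc u)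
      (LE.le.eventuallyLE fun u hu => hu.1)
  have h3 := tilt_nonneg hc T
  nlinarith

theorem moment_eq [IsProbabilityMeasure G] (h0 : G (Iio 0) = 0) (hα : 0 < α)
    (hc : ∀ t, c t = Real.exp (α * t) * tail G t) (hc0 : Tendsto c atTop (𝓝 0))
    (hint : IntegrableOn c (Ioi 0)) :
    ∫ u in Ici (0 : ℝ), Real.exp (α * u) ∂G = 1 + α * ∫ u in Ioi 0, c u := by
  have h1 := tendsto_expConv (moment_of_integrableOn_tilt h0 hα hc hint) isWeight_one
  rw [one_mul] at h1
  have hhalf : Tendsto (fun t : ℝ => t / 2) atTop atTop := tendsto_id.atTop_div_const two_pos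
  have h2 := ((hc0.comp hhalf).const_sub 1).add
    ((intervalIntegral_tendsto_integral_Ioi 0 hint hhalf).const_mul α)
  rw [sub_zero] at h2
  refine tendsto_nhds_unique h1 (h2.congr' ?_)
  filter_upwards [eventually_gt_atTop 0] with t ht
  rw [expConv_one_eq h0 hα hc ht]
  rfl

theorem tendsto_integral_atTop_of_moment_top [IsProbabilityMeasure G] (h0 : G (Iio 0) = 0)
    (hα : 0 < α) (hc : ∀ t, c t = Real.exp (α * t) * tail G t) (htop : expMoment G α = ⊤) :
    Tendsto (fun t => ∫ u in (0 : ℝ)..(t / 2), c u) atTop atTop := by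
  refine tendsto_integral_atTop_of_not_integrable (tilt_measurable hc)
    (fun t _ => tilt_nonneg hc t) (tilt_bounded hα hc) le_rfl fun hint => ?_
  have := expMoment_lt_top_iff.2 (moment_of_integrableOn_tilt h0 hα hc hint)
  rw [htop] at this
  exact lt_irrefl _ this

end

noncomputable section

/-! ### Expansion of the half convolution -/

theorem isWeight_pow (β : ℝ) :
    IsWeight (fun x => (1 - x) ^ β) (fun x => -(β * (1 - x) ^ (β - 1))) := by
  refine ⟨by fun_prop, by fun_prop, fun x hx => ?_, ?_⟩
  · have h1 : (1 - x) ≠ 0 := by linarith [hx.2]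
    have := ((hasDerivAt_id x).const_sub 1).rpow_const (p := β) (Or.inl h1)
    refine this.congr_deriv ?_
    simp only [id]; ring
  · suffices h : ContinuousOn (fun x : ℝ => -(β * (1 - x) ^ (β - 1))) (Icc 0 (1 / 2)) from
      isCompact_Icc.exists_bound_of_continuousOn h
    intro x hx
    have h1 : (1 - x) ≠ 0 := by linarith [hx.2]
    exact ((((continuous_const.sub continuous_id).continuousAt (x := x)).rpow_const
      (Or.inl h1)).const_mul β).neg.continuousWithinAt

theorem isWeight_powLog (β ρ : ℝ) :
    IsWeight (fun x => (1 - x) ^ β * powLog ρ (1 - x))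
      (fun x => -(β * (1 - x) ^ (β - 1)) * powLog ρ (1 - x)
        + (1 - x) ^ β * -((1 - x) ^ (ρ - 1))) := by
  have hm : Measurable fun x : ℝ => powLog ρ (1 - x) :=
    (measurable_powLog ρ).comp (by fun_prop)
  have hd : ∀ x ∈ Icc (0 : ℝ) (1 / 2),
      HasDerivAt (fun x => powLog ρ (1 - x)) (-((1 - x) ^ (ρ - 1))) x := by
    intro x hx
    have h1 : 0 < 1 - x := by linarith [hx.2]
    have := (hasDerivAt_powLog ρ h1).comp x ((hasDerivAt_id x).const_sub 1)
    refine this.congr_deriv (by ring)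
  refine ⟨by fun_prop, by fun_prop, fun x hx => ?_, ?_⟩
  · exact ((isWeight_pow β).hasDerivAt x hx).mul (hd x hx)
  · suffices h : ContinuousOn (fun x : ℝ => -(β * (1 - x) ^ (β - 1)) * powLog ρ (1 - x)
        + (1 - x) ^ β * -((1 - x) ^ (ρ - 1))) (Icc 0 (1 / 2)) from
      isCompact_Icc.exists_bound_of_continuousOn h
    intro x hx
    have h1 : (1 - x) ≠ 0 := by linarith [hx.2]
    have hc : ∀ r : ℝ, ContinuousAt (fun x : ℝ => (1 - x) ^ r) x := fun r =>
      ((continuous_const.sub continuous_id).continuousAt (x := x)).rpow_const (Or.inl h1)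
    exact (((((hc (β - 1)).const_mul β).neg).mul (hd x hx).continuousAt).add
      ((hc β).mul (hc (ρ - 1)).neg)).continuousWithinAt

variable {F G : Measure ℝ} {α β ρ : ℝ} {b c A : ℝ → ℝ}

/-- The uniform second-order expansion of `b (t - u) / b t`, integrated against the tilted
measure. -/
theorem halfConv_expansion [IsProbabilityMeasure F] [IsProbabilityMeasure G]
    (hFpos : ∀ t, 0 < t → 0 < tail F t)
    (hb : ∀ t, b t = Real.exp (α * t) * tail F t) (hb2 : IsTwoRV b β ρ A) :
    (fun t => halfConv F G t / tail F t - expConv G α (fun x => (1 - x) ^ β) t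
      - A t * expConv G α (fun x => (1 - x) ^ β * powLog ρ (1 - x)) t)
    =o[atTop] fun t => A t * expConv G α (fun _ => 1) t := by
  rw [isLittleO_iff]
  intro ε hε
  filter_upwards [hb2.uniform (tilt_measurable hb) (p := 1 / 2) (q := 1) (by norm_num) ε hε,
    eventually_gt_atTop 0] with t ht ht0
  have hF := hFpos t ht0
  have hbt : 0 < b t := by rw [hb]; positivity
  obtain ⟨K₁, hK₁⟩ := (isWeight_pow β).bound
  obtain ⟨K₂, hK₂⟩ := (isWeight_powLog β ρ).bound
  have i1 := integrableOn_expConv G α (isWeight_pow β).meas hK₁ ht0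
  have i2 := integrableOn_expConv G α (isWeight_powLog β ρ).meas hK₂ ht0
  have i3 := integrableOn_expConv G α isWeight_one.meas (K := 1) (by simp) ht0
  have i0 : IntegrableOn (fun u => tail F (t - u)) (Icc 0 (t / 2)) G := by
    refine Integrable.of_bound ((measurable_tail F).comp
      (measurable_const.sub measurable_id)).aestronglyMeasurable 1 (Eventually.of_forall fun u => ?_)
    rw [Real.norm_eq_abs, abs_of_nonneg (tail_nonneg _ _)]
    exact tail_le_one F _
  have hpt : ∀ u, tail F (t - u) / tail F t = b (t * (1 - u / t)) / b t * Real.exp (α * u) := by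
    intro u
    have e : t * (1 - u / t) = t - u := by field_simp
    rw [e, hb, hb]
    have : Real.exp (α * t) = Real.exp (α * (t - u)) * Real.exp (α * u) := by
      rw [← Real.exp_add]; ring_nf
    rw [this]
    have := (Real.exp_pos (α * (t - u))).ne'
    have := (Real.exp_pos (α * u)).ne'
    field_simp
  rw [norm_mul, Real.norm_of_nonneg (expConv_one_nonneg (G := G) (α := α) t), ← mul_assoc]
  have i4 : IntegrableOn (fun u => tail F (t - u) / tail F t - (1 - u / t) ^ β * Real.exp (α * u))
      (Icc 0 (t / 2)) G := (i0.div_const _).sub i1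
  unfold halfConv expConv
  rw [← integral_div, ← integral_const_mul, ← integral_const_mul,
    ← integral_sub (i0.div_const _) i1, ← integral_sub i4 (i2.const_mul _)]
  refine norm_integral_le_of_norm_le (i3.const_mul _)
    ((ae_restrict_mem measurableSet_Icc).mono fun u hu => ?_)
  have hx := div_mem_half ht0 hu
  have h1 := ht (1 - u / t) ⟨by linarith [hx.2], by linarith [hx.1]⟩
  rw [hpt, one_mul]
  have e : b (t * (1 - u / t)) / b t * Real.exp (α * u) - (1 - u / t) ^ β * Real.exp (α * u)
      - A t * ((1 - u / t) ^ β * powLog ρ (1 - u / t) * Real.exp (α * u))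
      = (b (t * (1 - u / t)) / b t - (1 - u / t) ^ β
        - A t * ((1 - u / t) ^ β * powLog ρ (1 - u / t))) * Real.exp (α * u) := by ring
  rw [e, norm_mul, Real.norm_eq_abs, Real.norm_eq_abs, Real.abs_exp, Real.norm_eq_abs]
  gcongr

/-- When the exponential moment is finite, the second-order term of `b` contributes `o(A)`. -/
theorem halfConv_expansion_of_moment [IsProbabilityMeasure F] [IsProbabilityMeasure G]
    (hFpos : ∀ t, 0 < t → 0 < tail F t)
    (hb : ∀ t, b t = Real.exp (α * t) * tail F t) (hb2 : IsTwoRV b β ρ A)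
    (hint : IntegrableOn (fun u => Real.exp (α * u)) (Ici 0) G) :
    (fun t => halfConv F G t / tail F t - expConv G α (fun x => (1 - x) ^ β) t)
    =o[atTop] A := by
  have h1 := halfConv_expansion (G := G) hFpos hb hb2
  have h2 : (fun t => A t * expConv G α (fun x => (1 - x) ^ β * powLog ρ (1 - x)) t)
      =o[atTop] A := by
    have h3 := tendsto_expConv hint (isWeight_powLog β ρ)
    simp only [sub_zero, powLog_one, mul_zero, zero_mul] at h3
    simpa using (isBigO_refl A atTop).mul_isLittleO ((isLittleO_one_iff ℝ).2 h3)
  have h4 : (fun t => A t * expConv G α (fun _ => 1) t) =O[atTop] A := by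
    simpa using (isBigO_refl A atTop).mul
      ((tendsto_expConv hint isWeight_one).isBigO_one ℝ)
  exact ((h1.trans_isBigO h4).add h2).congr_left fun t => by ring

/-! ### Constants -/

theorem abs_powLog_le {ρ δ : ℝ} (hρ : ρ ≤ 0) (hδ : 0 < δ) (hδρ : -ρ ≤ δ) :
    ∃ C, ∀ x ∈ Ioc (0 : ℝ) 1, |powLog ρ x| ≤ C * x ^ (-δ) := by
  rcases hρ.eq_or_lt with rfl | hρ
  · refine ⟨1 / δ, fun x hx => ?_⟩
    have h1 := (Real.abs_log_mul_self_rpow_lt x δ hx.1 hx.2 hδ).le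
    have h2 := Real.rpow_pos_of_pos hx.1 δ
    rw [abs_mul, abs_of_pos h2] at h1
    simp only [powLog, if_true]
    rw [Real.rpow_neg hx.1.le, ← div_eq_mul_inv, le_div_iff₀ h2]
    exact h1
  · refine ⟨1 / (-ρ), fun x hx => ?_⟩
    have h1 : 1 ≤ x ^ ρ := Real.one_le_rpow_of_pos_of_le_one_of_nonpos hx.1 hx.2 hρ.le
    have h2 : x ^ ρ ≤ x ^ (-δ) := Real.rpow_le_rpow_of_exponent_ge hx.1 hx.2 (by linarith)
    simp only [powLog, if_neg hρ.ne]
    rw [abs_div, abs_of_neg hρ, abs_of_nonneg (by linarith), div_mul_eq_mul_div, one_mul]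
    have : 0 < -ρ := by linarith
    gcongr
    linarith

theorem intervalIntegrable_of_rpow_bound {h : ℝ → ℝ} (hm : Measurable h) {K r : ℝ} (hr : -1 < r)
    (hK : ∀ x ∈ Ioc (0 : ℝ) (1 / 2), |h x| ≤ K * x ^ r) :
    IntervalIntegrable h volume 0 (1 / 2) := by
  have h0 : IntervalIntegrable (fun x => K * x ^ r) volume 0 (1 / 2) :=
    (intervalIntegral.intervalIntegrable_rpow' hr).const_mul _
  refine h0.mono_fun hm.aestronglyMeasurable ?_
  rw [uIoc_of_le (by norm_num)]
  refine (ae_restrict_mem measurableSet_Ioc).mono fun x hx => ?_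
  exact (hK x hx).trans (le_abs_self _)

theorem rpow_half_bound (r : ℝ) :
    ∃ K ≥ 0, ∀ x ∈ Ioc (0 : ℝ) (1 / 2), |(1 - x) ^ r| ≤ K := by
  obtain ⟨K, hK⟩ := (isWeight_pow r).bound
  exact ⟨K, (abs_nonneg _).trans (hK 0 ⟨le_rfl, by norm_num⟩),
    fun x hx => hK x (Ioc_subset_Icc_self hx)⟩

theorem intervalIntegrable_pow_mul_pow (r : ℝ) {γ : ℝ} (hγ : -1 < γ) :
    IntervalIntegrable (fun x : ℝ => (1 - x) ^ r * x ^ γ) volume 0 (1 / 2) := by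
  obtain ⟨K, -, hK⟩ := rpow_half_bound r
  refine intervalIntegrable_of_rpow_bound (by fun_prop) (K := K) hγ fun x hx => ?_
  have h1 := Real.rpow_pos_of_pos hx.1 γ
  rw [abs_mul, abs_of_pos h1]
  exact mul_le_mul_of_nonneg_right (hK x hx) h1.le

/-- Integration by parts on `[0, 1/2]` with a factor vanishing at the origin like a power. -/
theorem integral_parts_pow (β : ℝ) {w w' : ℝ → ℝ} {C r : ℝ} (hr : 0 < r)
    (hw : ∀ x ∈ Ioc (0 : ℝ) (1 / 2), HasDerivAt w (w' x) x)
    (hwb : ∀ x ∈ Ioc (0 : ℝ) (1 / 2), |w x| ≤ C * x ^ r)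
    (i1 : IntervalIntegrable (fun x => (1 - x) ^ (β - 1) * w x) volume 0 (1 / 2))
    (i2 : IntervalIntegrable (fun x => (1 - x) ^ β * w' x) volume 0 (1 / 2)) :
    (∫ x in (0 : ℝ)..(1 / 2), (1 - x) ^ β * w' x)
      = (1 / 2 : ℝ) ^ β * w (1 / 2)
        + β * ∫ x in (0 : ℝ)..(1 / 2), (1 - x) ^ (β - 1) * w x := by
  have hhalf : (1 / 2 : ℝ) ∈ Ioc (0 : ℝ) (1 / 2) := ⟨by norm_num, le_rfl⟩
  have hd : ∀ x ∈ Ioc (0 : ℝ) (1 / 2), HasDerivAt (fun x => (1 - x) ^ β * w x)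
      (-(β * ((1 - x) ^ (β - 1) * w x)) + (1 - x) ^ β * w' x) x := fun x hx =>
    (((isWeight_pow β).hasDerivAt x (Ioc_subset_Icc_self hx)).mul (hw x hx)).congr_deriv (by ring)
  have i3 : IntervalIntegrable (fun x => -(β * ((1 - x) ^ (β - 1) * w x))) volume 0 (1 / 2) :=
    (i1.const_mul β).neg
  have key := intervalIntegral.integral_eq_sub_of_hasDerivAt_of_tendsto (a := 0) (b := 1 / 2)
    (fa := 0) (fb := (1 / 2 : ℝ) ^ β * w (1 / 2)) (by norm_num)
    (fun x hx => hd x (Ioo_subset_Ioc_self hx)) (i3.add i2) (by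
      have h1 : Tendsto (fun x : ℝ => C * x ^ r) (𝓝[>] 0) (𝓝 0) := by
        have h2 : ContinuousAt (fun x : ℝ => C * x ^ r) 0 :=
          (Real.continuousAt_rpow_const _ _ (Or.inr hr.le)).const_mul C
        have h3 := h2.tendsto.mono_left (nhdsWithin_le_nhds (s := Ioi 0))
        rwa [Real.zero_rpow hr.ne', mul_zero] at h3
      have h4 : Tendsto w (𝓝[>] 0) (𝓝 0) := by
        refine squeeze_zero_norm' ?_ h1
        filter_upwards [Ioc_mem_nhdsGT (show (0 : ℝ) < 1 / 2 by norm_num)] with x hx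
        exact hwb x hx
      have h5 := ((isWeight_pow β).hasDerivAt 0
        ⟨le_rfl, by norm_num⟩).continuousAt.tendsto.mono_left (nhdsWithin_le_nhds (s := Ioi 0))
      simpa using h5.mul h4) (by
      have h6 := (hd _ hhalf).continuousAt.tendsto.mono_left (nhdsWithin_le_nhds (s := Iio (1 / 2)))
      norm_num at h6 ⊢
      exact h6)
  have e := intervalIntegral.integral_add i3 i2
  rw [intervalIntegral.integral_neg, intervalIntegral.integral_const_mul] at e
  rw [e] at key
  linarith

/-- The coefficient of `t⁻¹` is the boundary term at `1 / 2` plus the integral of the derivative of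
the weight. -/
theorem beta_integral_identity (β : ℝ) {γ : ℝ} (hγ : -1 < γ) :
    β * (∫ u in (0 : ℝ)..(1 / 2), (1 - u) ^ (β - 1) * u ^ γ * (2 * u - 1))
        - 2 * (1 + γ) * (∫ u in (0 : ℝ)..(1 / 2), (1 - u) ^ β * u ^ γ)
      = -((1 / 2 : ℝ) ^ β * (1 / 2) ^ γ)
        + ∫ u in (0 : ℝ)..(1 / 2), -(β * (1 - u) ^ (β - 1)) * u ^ γ := by
  have i0 := intervalIntegrable_pow_mul_pow (β - 1) hγ
  have i1 := intervalIntegrable_pow_mul_pow (β - 1) (show -1 < γ + 1 by linarith)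
  have i2 := intervalIntegrable_pow_mul_pow β hγ
  have hp := integral_parts_pow β (w := fun x => x ^ (γ + 1)) (w' := fun x => (γ + 1) * x ^ γ)
    (C := 1) (r := γ + 1) (by linarith)
    (fun x hx => by
      have := Real.hasDerivAt_rpow_const (p := γ + 1) (Or.inl hx.1.ne')
      rwa [add_sub_cancel_right] at this)
    (fun x hx => by rw [one_mul, abs_of_pos (Real.rpow_pos_of_pos hx.1 _)])
    i1 (by
      refine (i2.const_mul (γ + 1)).congr fun x _ => ?_
      ring)
  have e1 : (∫ x in (0 : ℝ)..(1 / 2), (1 - x) ^ β * ((γ + 1) * x ^ γ))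
      = (γ + 1) * ∫ x in (0 : ℝ)..(1 / 2), (1 - x) ^ β * x ^ γ := by
    rw [← intervalIntegral.integral_const_mul]
    exact intervalIntegral.integral_congr fun x _ => by ring
  have e2 : (∫ u in (0 : ℝ)..(1 / 2), (1 - u) ^ (β - 1) * u ^ γ * (2 * u - 1))
      = 2 * (∫ u in (0 : ℝ)..(1 / 2), (1 - u) ^ (β - 1) * u ^ (γ + 1))
        - ∫ u in (0 : ℝ)..(1 / 2), (1 - u) ^ (β - 1) * u ^ γ := by
    rw [← intervalIntegral.integral_const_mul, ← intervalIntegral.integral_sub (i1.const_mul 2) i0]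
    rw [intervalIntegral.integral_of_le (by norm_num), intervalIntegral.integral_of_le (by norm_num)]
    refine setIntegral_congr_fun measurableSet_Ioc fun u hu => ?_
    simp only [Real.rpow_add_one hu.1.ne']
    ring
  have e3 : (∫ u in (0 : ℝ)..(1 / 2), -(β * (1 - u) ^ (β - 1)) * u ^ γ)
      = -(β * ∫ u in (0 : ℝ)..(1 / 2), (1 - u) ^ (β - 1) * u ^ γ) := by
    rw [← intervalIntegral.integral_const_mul, ← intervalIntegral.integral_neg]
    exact intervalIntegral.integral_congr fun x _ => by ring
  rw [e1, Real.rpow_add_one (by norm_num)] at hp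
  rw [e2, e3]
  linarith

theorem auxCoeff_eq {γ ρ : ℝ} (h : 0 < γ + ρ + 1) :
    auxCoeff γ ρ = -((2 : ℝ) ^ (-ρ) * ((γ + 1) * powLog ρ 2 + 2 ^ ρ) / (γ + ρ + 1)) := by
  have h2 := Real.rpow_pos_of_pos two_pos ρ
  unfold auxCoeff powLog
  split_ifs with h0
  · subst h0
    have : γ + 1 ≠ 0 := by linarith
    simp only [neg_zero, Real.rpow_zero, add_zero]
    field_simp
    ring
  · rw [Real.rpow_neg two_pos.le]
    field_simp
    ring

/-- The coefficient of the second-order term of `c`, by partial integration of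
`u ^ (γ + 1) * powLog ρ (2 u)`, which vanishes at both endpoints. The relation
`x ^ ρ = 1 + ρ * powLog ρ x` treats `ρ = 0` and `ρ < 0` together. -/
theorem second_order_integral_identity (β : ℝ) {γ ρ : ℝ} (hρ : ρ ≤ 0) (h : 0 < γ + ρ + 1) :
    (2 : ℝ) ^ (-ρ) * β / (γ + ρ + 1) *
        (∫ u in (0 : ℝ)..(1 / 2), (1 - u) ^ (β - 1) * u ^ (γ + 1) * powLog ρ (2 * u))
      + auxCoeff γ ρ * (∫ u in (0 : ℝ)..(1 / 2), (1 - u) ^ β * u ^ γ)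
      = ∫ u in (0 : ℝ)..(1 / 2), (1 - u) ^ β * (u ^ γ * powLog ρ u) := by
  obtain ⟨δ, hδ1, hδ2⟩ : ∃ δ, -ρ < δ ∧ δ < γ + 1 := exists_between (by linarith)
  have hδ0 : 0 < δ := by linarith
  obtain ⟨C, hC⟩ := abs_powLog_le hρ hδ0 hδ1.le
  have hγ : -1 < γ := by linarith
  set w : ℝ → ℝ := fun x => x ^ (γ + 1) * powLog ρ (2 * x) with hw
  set w' : ℝ → ℝ := fun x => (2 : ℝ) ^ ρ * (γ + ρ + 1) * (x ^ γ * powLog ρ x)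
    + ((γ + 1) * powLog ρ 2 + 2 ^ ρ) * x ^ γ with hw'
  have hxρ : ∀ x : ℝ, 0 < x → x ^ ρ = 1 + ρ * powLog ρ x := by
    intro x hx
    unfold powLog
    split_ifs with h0
    · simp [h0]
    · field_simp; ring
  have hwd : ∀ x ∈ Ioc (0 : ℝ) (1 / 2), HasDerivAt w (w' x) x := by
    intro x hx
    have h1 := Real.hasDerivAt_rpow_const (p := γ + 1) (Or.inl hx.1.ne')
    rw [add_sub_cancel_right] at h1
    have h2x : 0 < 2 * x := by linarith [hx.1]
    have h2 := (hasDerivAt_powLog ρ h2x).comp x ((hasDerivAt_id x).const_mul 2)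
    refine (h1.mul h2).congr_deriv ?_
    simp only [hw', Function.comp, mul_one]
    rw [Real.rpow_sub_one h2x.ne', Real.rpow_add_one hx.1.ne', mul_comm 2 x,
      powLog_mul ρ hx.1 two_pos, Real.mul_rpow hx.1.le two_pos.le]
    have h3 := hxρ 2 two_pos
    rw [hxρ x hx.1, h3]
    have := hx.1.ne'
    field_simp
    ring
  have hwb : ∀ x ∈ Ioc (0 : ℝ) (1 / 2), |w x| ≤ (C * 2 ^ (-δ)) * x ^ (γ + 1 - δ) := by
    intro x hx
    have h1 := hC (2 * x) ⟨by linarith [hx.1], by linarith [hx.2]⟩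
    have h2 := Real.rpow_pos_of_pos hx.1 (γ + 1)
    rw [Real.mul_rpow two_pos.le hx.1.le] at h1
    rw [hw, abs_mul, abs_of_pos h2, sub_eq_add_neg, Real.rpow_add hx.1 (γ + 1)]
    calc _ ≤ x ^ (γ + 1) * (C * (2 ^ (-δ) * x ^ (-δ))) := by gcongr
      _ = _ := by ring
  have hmw : Measurable w := by
    have : Measurable fun x : ℝ => powLog ρ (2 * x) := (measurable_powLog ρ).comp (by fun_prop)
    fun_prop
  have hmp := measurable_powLog ρ
  obtain ⟨K₁, hK₁0, hK₁⟩ := rpow_half_bound (β - 1)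
  obtain ⟨K₂, hK₂0, hK₂⟩ := rpow_half_bound β
  have i1 : IntervalIntegrable (fun x => (1 - x) ^ (β - 1) * w x) volume 0 (1 / 2) := by
    refine intervalIntegrable_of_rpow_bound (by fun_prop) (K := K₁ * (C * 2 ^ (-δ)))
      (r := γ + 1 - δ) (by linarith) fun x hx => ?_
    rw [abs_mul, mul_assoc]
    exact mul_le_mul (hK₁ x hx) (hwb x hx) (abs_nonneg _) hK₁0
  have i3 : IntervalIntegrable (fun x => (1 - x) ^ β * (x ^ γ * powLog ρ x)) volume 0 (1 / 2) := by
    refine intervalIntegrable_of_rpow_bound (by fun_prop) (K := K₂ * C)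
      (r := γ - δ) (by linarith) fun x hx => ?_
    have h1 := hC x ⟨hx.1, by linarith [hx.2]⟩
    have h2 := Real.rpow_pos_of_pos hx.1 γ
    rw [abs_mul, abs_mul, abs_of_pos h2, mul_assoc]
    refine mul_le_mul (hK₂ x hx) ?_ (by positivity) hK₂0
    rw [sub_eq_add_neg, Real.rpow_add hx.1]
    calc _ ≤ x ^ γ * (C * x ^ (-δ)) := by gcongr
      _ = _ := by ring
  have i4 := intervalIntegrable_pow_mul_pow β hγ
  have i5 := (i3.const_mul ((2 : ℝ) ^ ρ * (γ + ρ + 1))).add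
    (i4.const_mul ((γ + 1) * powLog ρ 2 + 2 ^ ρ))
  have hp := integral_parts_pow β (by linarith) hwd hwb i1 (by
    refine i5.congr fun x _ => ?_
    simp only [hw']
    ring)
  have e1 : (∫ x in (0 : ℝ)..(1 / 2), (1 - x) ^ β * w' x)
      = (2 : ℝ) ^ ρ * (γ + ρ + 1) * (∫ x in (0 : ℝ)..(1 / 2), (1 - x) ^ β * (x ^ γ * powLog ρ x))
        + ((γ + 1) * powLog ρ 2 + 2 ^ ρ) * ∫ x in (0 : ℝ)..(1 / 2), (1 - x) ^ β * x ^ γ := by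
    rw [← intervalIntegral.integral_const_mul, ← intervalIntegral.integral_const_mul,
      ← intervalIntegral.integral_add (i3.const_mul _) (i4.const_mul _)]
    refine intervalIntegral.integral_congr fun x _ => ?_
    simp only [hw']
    ring
  have e2 : w (1 / 2) = 0 := by
    simp only [hw]
    rw [mul_one_div_cancel two_ne_zero, powLog_one, mul_zero]
  have e3 : (∫ u in (0 : ℝ)..(1 / 2), (1 - u) ^ (β - 1) * u ^ (γ + 1) * powLog ρ (2 * u))
      = ∫ u in (0 : ℝ)..(1 / 2), (1 - u) ^ (β - 1) * w u :=
    intervalIntegral.integral_congr fun x _ => by simp only [hw]; ring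
  rw [e1, e2, mul_zero, zero_add] at hp
  rw [e3, auxCoeff_eq h, div_mul_eq_mul_div, mul_assoc ((2 : ℝ) ^ (-ρ)), ← hp,
    Real.rpow_neg two_pos.le]
  have := (Real.rpow_pos_of_pos two_pos ρ).ne'
  field_simp
  ring

/-- Partial integration of `((1 - u) ^ β - 1) * log u`; the first factor compensates the logarithm at
the origin. -/
theorem log_integral_identity (β : ℝ) :
    β * (∫ u in (0 : ℝ)..(1 / 2), (1 - u) ^ (β - 1) * Real.log u)
        + Real.log 2 * (1 - (2 : ℝ) ^ (-β))
      = ∫ u in (0 : ℝ)..(1 / 2), ((1 - u) ^ β - 1) * u ^ (-1 : ℝ) := by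
  obtain ⟨K, hK0, hK⟩ := (isWeight_pow β).lipschitz
  simp only [sub_zero, Real.one_rpow] at hK
  obtain ⟨K₁, hK₁0, hK₁⟩ := rpow_half_bound (β - 1)
  have hlog : ∀ x ∈ Ioc (0 : ℝ) (1 / 2), |Real.log x| ≤ 2 * x ^ (-(1 / 2) : ℝ) := by
    intro x hx
    have h1 := (Real.abs_log_mul_self_rpow_lt x (1 / 2) hx.1 (by linarith [hx.2])
      (by norm_num)).le
    have h2 := Real.rpow_pos_of_pos hx.1 (1 / 2)
    rw [abs_mul, abs_of_pos h2] at h1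
    rw [Real.rpow_neg hx.1.le, ← div_eq_mul_inv, le_div_iff₀ h2]
    linarith
  have i1 : IntervalIntegrable (fun x : ℝ => (1 - x) ^ (β - 1) * Real.log x) volume 0 (1 / 2) := by
    refine intervalIntegrable_of_rpow_bound (by fun_prop) (K := K₁ * 2)
      (r := -(1 / 2)) (by norm_num) fun x hx => ?_
    rw [abs_mul, mul_assoc]
    exact mul_le_mul (hK₁ x hx) (hlog x hx) (abs_nonneg _) hK₁0
  have i2 : IntervalIntegrable (fun x : ℝ => ((1 - x) ^ β - 1) * x ^ (-1 : ℝ)) volume 0 (1 / 2) := by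
    refine intervalIntegrable_of_bound (by fun_prop) (by norm_num) K fun x hx => ?_
    have h1 := hK x (Ioc_subset_Icc_self hx)
    change |((1 - x) ^ β - 1) * x ^ (-1 : ℝ)| ≤ K
    rw [abs_mul, Real.rpow_neg_one, abs_of_pos (inv_pos.2 hx.1), ← div_eq_mul_inv,
      div_le_iff₀ hx.1]
    exact h1
  have hd : ∀ x ∈ Ioc (0 : ℝ) (1 / 2), HasDerivAt (fun x => ((1 - x) ^ β - 1) * Real.log x)
      (-(β * ((1 - x) ^ (β - 1) * Real.log x)) + ((1 - x) ^ β - 1) * x ^ (-1 : ℝ)) x := by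
    intro x hx
    refine ((((isWeight_pow β).hasDerivAt x (Ioc_subset_Icc_self hx)).sub_const 1).mul
      (Real.hasDerivAt_log hx.1.ne')).congr_deriv ?_
    rw [Real.rpow_neg_one]
    ring
  have i3 : IntervalIntegrable (fun x => -(β * ((1 - x) ^ (β - 1) * Real.log x)))
      volume 0 (1 / 2) := (i1.const_mul β).neg
  have key := intervalIntegral.integral_eq_sub_of_hasDerivAt_of_tendsto (a := 0) (b := 1 / 2)
    (fa := 0) (fb := ((1 / 2 : ℝ) ^ β - 1) * Real.log (1 / 2)) (by norm_num)
    (fun x hx => hd x (Ioo_subset_Ioc_self hx)) (i3.add i2) (by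
      have h1 : Tendsto (fun x : ℝ => K * |x * Real.log x|) (𝓝[>] 0) (𝓝 0) := by
        have h2 := (Real.continuous_mul_log.abs.const_mul K).tendsto 0
        simp only [zero_mul, abs_zero, mul_zero] at h2
        exact h2.mono_left nhdsWithin_le_nhds
      refine squeeze_zero_norm' ?_ h1
      filter_upwards [Ioc_mem_nhdsGT (show (0 : ℝ) < 1 / 2 by norm_num)] with x hx
      rw [norm_mul, Real.norm_eq_abs, Real.norm_eq_abs, abs_mul, abs_of_pos hx.1, ← mul_assoc]
      exact mul_le_mul_of_nonneg_right (hK x (Ioc_subset_Icc_self hx)) (abs_nonneg _)) (by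
      have h6 := (hd _ ⟨by norm_num, le_rfl⟩).continuousAt.tendsto.mono_left
        (nhdsWithin_le_nhds (s := Iio (1 / 2)))
      norm_num at h6 ⊢
      exact h6)
  have e := intervalIntegral.integral_add i3 i2
  rw [intervalIntegral.integral_neg, intervalIntegral.integral_const_mul] at e
  rw [e] at key
  rw [Real.rpow_neg two_pos.le, ← Real.inv_rpow two_pos.le, ← one_div]
  rw [one_div, Real.log_inv] at key
  rw [one_div]
  linarith

end

noncomputable section

variable {F G : Measure ℝ} {α β γ ρ : ℝ} {b c A : ℝ → ℝ}

/-! ### Asymptotics of the tilted integrals -/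

theorem IsRV.tendsto_half {f : ℝ → ℝ} {κ : ℝ} (hf : IsRV f κ) :
    Tendsto (fun t => f (t / 2) / f t) atTop (𝓝 ((1 / 2) ^ κ)) := by
  simpa only [mul_one_div] using hf.tendsto_ratio (1 / 2) (by norm_num)

theorem IsRV.eventually_mul_ne {f : ℝ → ℝ} {κ : ℝ} (hf : IsRV f κ) :
    ∀ᶠ t in atTop, t * f t ≠ 0 := by
  filter_upwards [hf.eventually_pos, eventually_gt_atTop 0] with t h1 h2
  exact (mul_pos h2 h1).ne'

theorem IsRV.half_isLittleO {f : ℝ → ℝ} {κ : ℝ} (hf : IsRV f κ) :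
    (fun t => f (t / 2)) =o[atTop] fun t => t * f t := by
  refine (isLittleO_iff_tendsto' (hf.eventually_mul_ne.mono fun t h h' => absurd h' h)).2 ?_
  have h1 := hf.tendsto_half.mul tendsto_inv_atTop_zero
  rw [mul_zero] at h1
  refine h1.congr' ?_
  filter_upwards [hf.eventually_mul_ne] with t ht
  have h2 := left_ne_zero_of_mul ht
  have h3 := right_ne_zero_of_mul ht
  field_simp

theorem isLittleO_sub_of_tendsto_div {u v : ℝ → ℝ} {k : ℝ} (hv : ∀ᶠ t in atTop, v t ≠ 0)
    (h : Tendsto (fun t => u t / v t) atTop (𝓝 k)) :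
    (fun t => u t - k * v t) =o[atTop] v := by
  refine (isLittleO_iff_tendsto' (hv.mono fun t h h' => absurd h' h)).2 ?_
  have h1 := h.sub_const k
  rw [sub_self] at h1
  refine h1.congr' ?_
  filter_upwards [hv] with t ht
  field_simp

theorem integral_weight_isBigO [IsProbabilityMeasure G] (hα : 0 < α)
    (hc : ∀ t, c t = Real.exp (α * t) * tail G t) {g : ℝ → ℝ} {K : ℝ}
    (hK : ∀ x ∈ Icc (0 : ℝ) (1 / 2), |g x| ≤ K) :
    (fun t => ∫ u in (0 : ℝ)..(t / 2), g (u / t) * c u)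
      =O[atTop] fun t => ∫ u in (0 : ℝ)..(t / 2), c u := by
  refine IsBigO.of_bound K ?_
  filter_upwards [eventually_gt_atTop 0] with t ht
  have ht2 : 0 ≤ t / 2 := by positivity
  have hcpos : 0 ≤ ∫ u in (0 : ℝ)..(t / 2), c u :=
    intervalIntegral.integral_nonneg ht2 fun u _ => tilt_nonneg hc u
  have hci : IntervalIntegrable c volume 0 (t / 2) := by
    simpa using tilt_intervalIntegrable hα hc (measurable_const (a := (1 : ℝ))) ht2
      (K := 1) (by simp)
  rw [Real.norm_of_nonneg hcpos, ← intervalIntegral.integral_const_mul]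
  refine intervalIntegral.norm_integral_le_of_norm_le ht2 (Eventually.of_forall fun u hu => ?_)
    (hci.const_mul K)
  rw [norm_mul, Real.norm_eq_abs, Real.norm_of_nonneg (tilt_nonneg hc u)]
  exact mul_le_mul_of_nonneg_right (hK _ (div_mem_half ht (Ioc_subset_Icc_self hu)))
    (tilt_nonneg hc u)

/-- A weight vanishing at the origin sees `exp (α u) dG(u)` as `α c(u) du` on the scale `t`; all
other terms of the integration by parts are of lower order. -/
theorem expConv_expansion_of_zero [IsProbabilityMeasure G] (h0 : G (Iio 0) = 0) (hα : 0 < α)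
    (hc : ∀ t, c t = Real.exp (α * t) * tail G t) (hcRV : IsRV c γ) (hγ : -2 < γ)
    {φ φ' : ℝ → ℝ} (hφ : IsWeight φ φ') (hφ0 : φ 0 = 0) {g : ℝ → ℝ}
    (h1 : (fun t => t * c t) =O[atTop] g)
    (h2 : (fun t => t⁻¹ * ∫ u in (0 : ℝ)..(t / 2), c u) =o[atTop] g) :
    (fun t => expConv G α φ t
      - α * (∫ x in (0 : ℝ)..(1 / 2), φ x * x ^ γ) * (t * c t)) =o[atTop] g := by
  obtain ⟨K, -, hK⟩ := hφ.lipschitz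
  obtain ⟨K', hK'⟩ := hφ.bound'
  have hlim := hcRV.tendsto_integral (tilt_measurable hc) (fun t _ => tilt_nonneg hc t)
    (tilt_bounded hα hc) hφ.meas (m := 1) (K := K) (fun x hx => by
      have := hK x (Ioc_subset_Icc_self hx)
      rw [Real.rpow_one]
      rwa [hφ0, sub_zero] at this) zero_le_one (by linarith)
  have p1 := (isLittleO_sub_of_tendsto_div hcRV.eventually_mul_ne hlim).trans_isBigO h1
  have p2 := hcRV.half_isLittleO.trans_isBigO h1
  have p3 : (fun t => t⁻¹ * ∫ u in (0 : ℝ)..(t / 2), φ' (u / t) * c u) =o[atTop] g :=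
    ((isBigO_refl (fun t : ℝ => t⁻¹) atTop).mul
      (integral_weight_isBigO hα hc hK')).trans_isLittleO h2
  refine (((p2.const_mul_left (-(φ (1 / 2)))).add (p1.const_mul_left α)).add p3).congr' ?_
    EventuallyEq.rfl
  filter_upwards [eventually_gt_atTop 0] with t ht
  rw [expConv_eq h0 hα hc hφ ht, hφ0]
  ring

theorem isWeight_pow_sub_one (β : ℝ) :
    IsWeight (fun x => (1 - x) ^ β - 1) (fun x => -(β * (1 - x) ^ (β - 1))) :=
  ⟨by fun_prop, (isWeight_pow β).meas', fun x hx => ((isWeight_pow β).hasDerivAt x hx).sub_const 1,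
    (isWeight_pow β).bound'⟩

theorem expConv_pow_sub_one [IsProbabilityMeasure G] {t : ℝ} (ht : 0 < t) :
    expConv G α (fun x => (1 - x) ^ β - 1) t
      = expConv G α (fun x => (1 - x) ^ β) t - expConv G α (fun _ => 1) t := by
  obtain ⟨K, hK⟩ := (isWeight_pow β).bound
  unfold expConv
  rw [← integral_sub (integrableOn_expConv G α (isWeight_pow β).meas hK ht)
    (integrableOn_expConv G α isWeight_one.meas (K := 1) (by simp) ht)]
  exact integral_congr_ae (Eventually.of_forall fun u => by ring)

/-- Taylor's formula to second order, from the Lipschitz bound for `(1 - x) ^ (β - 1)`. -/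
theorem pow_sub_one_taylor (β : ℝ) :
    ∃ K ≥ 0, ∀ x ∈ Icc (0 : ℝ) (1 / 2), |(1 - x) ^ β - 1 + β * x| ≤ K * x ^ 2 := by
  obtain ⟨K, hK0, hK⟩ := (isWeight_pow (β - 1)).lipschitz
  simp only [sub_zero, Real.one_rpow] at hK
  refine ⟨|β| * K, by positivity, fun x hx => ?_⟩
  have h := (convex_Icc (0 : ℝ) x).norm_image_sub_le_of_norm_hasDerivWithin_le
    (f := fun y => (1 - y) ^ β - 1 + β * y) (f' := fun y => -(β * (1 - y) ^ (β - 1)) + β * 1)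
    (C := |β| * K * x)
    (fun y hy => ((((isWeight_pow β).hasDerivAt y ⟨hy.1, hy.2.trans hx.2⟩).sub_const 1).add
      ((hasDerivAt_id y).const_mul β)).hasDerivWithinAt) (fun y hy => by
      have h1 := hK y ⟨hy.1, hy.2.trans hx.2⟩
      have e : -(β * (1 - y) ^ (β - 1)) + β * 1 = -β * ((1 - y) ^ (β - 1) - 1) := by ring
      rw [e, norm_mul, norm_neg, Real.norm_eq_abs, Real.norm_eq_abs, mul_assoc]
      gcongr
      exact h1.trans (by gcongr; exact hy.2)) ⟨le_rfl, hx.1⟩ ⟨hx.1, le_rfl⟩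
  simp only [sub_zero, Real.one_rpow, sub_self, mul_zero, add_zero, Real.norm_eq_abs,
    abs_of_nonneg hx.1] at h
  calc _ ≤ _ := h
    _ = _ := by ring

/-- The truncated exponential moment in terms of the full one. -/
theorem expConv_one_eq_moment [IsProbabilityMeasure G] (h0 : G (Iio 0) = 0) (hα : 0 < α)
    (hc : ∀ t, c t = Real.exp (α * t) * tail G t) (hc0 : Tendsto c atTop (𝓝 0))
    (hint : IntegrableOn c (Ioi 0)) {t : ℝ} (ht : 0 < t) :
    expConv G α (fun _ => 1) t = (expMoment G α).toReal - c (t / 2)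
      - α * ∫ u in Ioi (t / 2), c u := by
  have ht2 : 0 ≤ t / 2 := by positivity
  have h1 := setIntegral_union (μ := volume) (f := c) (s := Ioc 0 (t / 2)) (t := Ioi (t / 2))
    (Set.disjoint_left.2 fun x hx hx' => not_lt.2 hx.2 hx') measurableSet_Ioi
    (hint.mono_set Ioc_subset_Ioi_self) (hint.mono_set (Ioi_subset_Ioi ht2))
  rw [Ioc_union_Ioi_eq_Ioi ht2] at h1
  rw [expConv_one_eq h0 hα hc ht, expMoment_toReal, moment_eq h0 hα hc hc0 hint,
    intervalIntegral.integral_of_le ht2, h1]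
  ring

theorem integral_isBigO_one (hint : IntegrableOn c (Ioi 0)) :
    (fun t => ∫ u in (0 : ℝ)..(t / 2), c u) =O[atTop] fun _ => (1 : ℝ) := by
  have hhalf : Tendsto (fun t : ℝ => t / 2) atTop atTop := tendsto_id.atTop_div_const two_pos
  exact (intervalIntegral_tendsto_integral_Ioi 0 hint hhalf).isBigO_one ℝ

/-- The remainder is defined by solving for it, which the positivity of the tail permits. -/
theorem exists_remainder (hFpos : ∀ t, 0 < t → 0 < tail F t) {X g : ℝ → ℝ}
    (h : (fun t => halfConv F G t / tail F t - X t) =o[atTop] g) :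
    ∃ R : ℝ → ℝ, R =o[atTop] g ∧
      ∀ᶠ t in atTop, halfConv F G t = tail F t * (X t + R t) := by
  refine ⟨_, h, ?_⟩
  filter_upwards [eventually_gt_atTop 0] with t ht
  have := (hFpos t ht).ne'
  field_simp
  ring

theorem isLittleO_add_abs {u v g A : ℝ → ℝ} (hu : u =o[atTop] g) (hv : v =o[atTop] A)
    (hg : ∀ᶠ t in atTop, 0 ≤ g t) :
    (fun t => u t + v t) =o[atTop] fun t => g t + |A t| := by
  refine (hu.trans_isBigO ?_).add (hv.trans_isBigO ?_)
  · refine IsBigO.of_bound 1 ?_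
    filter_upwards [hg] with t ht
    rw [Real.norm_of_nonneg ht, Real.norm_of_nonneg (by positivity), one_mul]
    linarith [abs_nonneg (A t)]
  · refine IsBigO.of_bound 1 ?_
    filter_upwards [hg] with t ht
    rw [Real.norm_of_nonneg (by positivity : 0 ≤ g t + |A t|), one_mul, Real.norm_eq_abs]
    linarith

theorem inv_isLittleO_mul (hcm : Measurable c) (hcRV : IsRV c γ) (hγ : -2 < γ) :
    (fun t : ℝ => t⁻¹) =o[atTop] fun t => t * c t := by
  refine (isLittleO_iff_tendsto' (hcRV.eventually_mul_ne.mono fun t h h' => absurd h' h)).2 ?_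
  have h1 := ((hcRV.mul_rpow hcm 2).tendsto_atTop (by fun_prop) (by linarith)).inv_tendsto_atTop
  refine h1.congr fun t => ?_
  rw [Pi.inv_apply, Real.rpow_two, div_eq_mul_inv, ← mul_inv]
  congr 1
  ring

theorem IsRV.mul_id (hcRV : IsRV c γ) (hcm : Measurable c) : IsRV (fun t => t * c t) (1 + γ) := by
  simpa using hcRV.mul_rpow hcm 1

/-! ### The six regimes -/

variable [IsProbabilityMeasure F] [IsProbabilityMeasure G]

/-- Index `-1` with infinite moment: the truncated moment `1 + α L(t)` diverges slowly and the
weight `(1 - x) ^ β - 1` contributes on the scale `t c(t)`. -/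
theorem expansion_neg_one_infinite (hFpos : ∀ t, 0 < t → 0 < tail F t) (h0 : G (Iio 0) = 0)
    (hα : 0 < α) (hb : ∀ t, b t = Real.exp (α * t) * tail F t)
    (hc : ∀ t, c t = Real.exp (α * t) * tail G t) (hb2 : IsTwoRV b β ρ A)
    (hcRV : IsRV c (-1)) (htop : expMoment G α = ⊤) :
    ∃ R : ℝ → ℝ,
      (R =o[atTop] fun t => (1 + t * c t) / (∫ u in (0 : ℝ)..(t / 2), c u) + |A t|) ∧
      ∀ᶠ t in atTop, halfConv F G t = tail F t *
        ((∫ u in (0 : ℝ)..(t / 2), c u) *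
          (α + α * t * c t / (∫ u in (0 : ℝ)..(t / 2), c u) *
              (β * (∫ u in (0 : ℝ)..(1 / 2), (1 - u) ^ (β - 1) * Real.log u)
                + Real.log 2 * (1 - (2 : ℝ) ^ (-β)))
            + 1 / (∫ u in (0 : ℝ)..(t / 2), c u) + R t)) := by
  have hcm := tilt_measurable hc
  have hcp : ∀ t, 0 < t → 0 ≤ c t := fun t _ => tilt_nonneg hc t
  have hcb := tilt_bounded hα hc
  have hc0 := hcRV.tendsto_zero hcm (by norm_num)
  rw [log_integral_identity]
  -- All errors are first measured by `1 + t * c t` and `A t * L t`, then divided by `L t`.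
  have hLtop := tendsto_integral_atTop_of_moment_top h0 hα hc htop
  set L : ℝ → ℝ := fun t => ∫ u in (0 : ℝ)..(t / 2), c u with hL
  set k := ∫ u in (0 : ℝ)..(1 / 2), ((1 - u) ^ β - 1) * u ^ (-1 : ℝ) with hk
  set g : ℝ → ℝ := fun t => 1 + t * c t with hg
  have hg0 : ∀ᶠ t in atTop, 0 ≤ g t := by
    filter_upwards [eventually_gt_atTop 0] with t ht
    have := mul_nonneg ht.le (hcp t ht)
    simp only [hg]; linarith
  have h1g : (fun _ : ℝ => (1 : ℝ)) =O[atTop] g := by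
    refine IsBigO.of_bound 1 ?_
    filter_upwards [eventually_gt_atTop 0, hg0] with t ht hgt
    have := mul_nonneg ht.le (hcp t ht)
    rw [norm_one, Real.norm_of_nonneg hgt, one_mul]
    simp only [hg]; linarith
  have htg : (fun t => t * c t) =O[atTop] g := by
    refine IsBigO.of_bound 1 ?_
    filter_upwards [eventually_gt_atTop 0, hg0] with t ht hgt
    have := mul_nonneg ht.le (hcp t ht)
    rw [Real.norm_of_nonneg this, Real.norm_of_nonneg hgt, one_mul]
    simp only [hg]; linarith
  have hLt : (fun t => t⁻¹ * L t) =o[atTop] g :=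
    ((isLittleO_one_iff ℝ).2 (tendsto_average_zero hcm hcp hcb hc0)).trans_isBigO h1g
  have e1 := expConv_expansion_of_zero h0 hα hc hcRV (by norm_num) (isWeight_pow_sub_one β)
    (by simp) htg hLt
  have e2 : expConv G α (fun x => (1 - x) ^ β * powLog ρ (1 - x)) =O[atTop] g := by
    have h := expConv_expansion_of_zero h0 hα hc hcRV (by norm_num) (isWeight_powLog β ρ)
      (by simp [powLog_one]) htg hLt
    exact (h.isBigO.add (htg.const_mul_left _)).congr_left fun t => sub_add_cancel _ _
  have e3 : (fun t => A t * expConv G α (fun x => (1 - x) ^ β * powLog ρ (1 - x)) t)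
      =o[atTop] g := by
    simpa using ((isLittleO_one_iff ℝ).2 hb2.aux_tendsto).mul_isBigO e2
  have e4 : (fun t => A t * expConv G α (fun _ => 1) t) =O[atTop] fun t => A t * L t := by
    refine (isBigO_refl A atTop).mul (IsBigO.of_bound (1 + α) ?_)
    filter_upwards [eventually_gt_atTop 0, hLtop.eventually_ge_atTop 1] with t ht hLt
    rw [Real.norm_of_nonneg (expConv_one_nonneg t), Real.norm_of_nonneg (by linarith),
      expConv_one_eq h0 hα hc ht]
    have := tilt_nonneg hc (t / 2)
    change 1 - c (t / 2) + α * L t ≤ (1 + α) * L t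
    linarith
  have e5 := (halfConv_expansion (G := G) hFpos hb hb2).trans_isBigO e4
  have e6 := hcRV.half_isLittleO.trans_isBigO htg
  have hsum := isLittleO_add_abs ((e1.sub e6).add e3) e5 hg0
  refine ⟨fun t => (halfConv F G t / tail F t) / L t
    - (α + α * t * c t / L t * k + 1 / L t), ?_, ?_⟩
  · have hinv := (isBigO_refl (fun t => (L t)⁻¹) atTop).mul_isLittleO hsum
    refine hinv.congr' ?_ ?_
    · filter_upwards [eventually_gt_atTop 0, hLtop.eventually_gt_atTop 0] with t ht hLt
      have h1 := expConv_pow_sub_one (G := G) (α := α) (β := β) ht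
      have h2 := expConv_one_eq h0 hα hc ht
      rw [h1, h2]
      change (L t)⁻¹ * (expConv G α (fun x => (1 - x) ^ β) t - (1 - c (t / 2) + α * L t)
        - α * k * (t * c t) - c (t / 2) + _ + _) = _
      field_simp
      ring
    · filter_upwards [hLtop.eventually_gt_atTop 0] with t hLt
      rw [abs_mul, abs_of_pos hLt]
      change (L t)⁻¹ * (1 + t * c t + |A t| * L t) = (1 + t * c t) / L t + |A t|
      field_simp
  · filter_upwards [eventually_gt_atTop 0, hLtop.eventually_gt_atTop 0] with t ht hLt
    have hF := (hFpos t ht).ne'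
    have hLt' := hLt.ne'
    simp only [hL] at hLt' ⊢
    field_simp
    ring

/-- Index `-1` with finite moment: `t c(t)` is negligible against the tail integral of `c`, so only
the missing part of the moment is visible. -/
theorem expansion_neg_one_finite (hFpos : ∀ t, 0 < t → 0 < tail F t) (h0 : G (Iio 0) = 0)
    (hα : 0 < α) (hb : ∀ t, b t = Real.exp (α * t) * tail F t)
    (hc : ∀ t, c t = Real.exp (α * t) * tail G t) (hb2 : IsTwoRV b β ρ A)
    (hcRV : IsRV c (-1)) (hfin : expMoment G α < ⊤) :
    IntegrableOn c (Ioi 0) ∧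
      ∃ R : ℝ → ℝ,
        (R =o[atTop] fun t => (∫ u in Ioi (t / 2), c u) + |A t|) ∧
        ∀ᶠ t in atTop, halfConv F G t = tail F t *
          ((expMoment G α).toReal - α * (∫ u in Ioi (t / 2), c u) + R t) := by
  have hcm := tilt_measurable hc
  have hcp : ∀ t, 0 < t → 0 ≤ c t := fun t _ => tilt_nonneg hc t
  have hcb := tilt_bounded hα hc
  have hc0 := hcRV.tendsto_zero hcm (by norm_num)
  have hmom := expMoment_lt_top_iff.1 hfin
  have hint := integrableOn_tilt_of_moment h0 hα hc hc0 hmom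
  refine ⟨hint, exists_remainder hFpos ?_⟩
  have htail := hcRV.isLittleO_integral_Ioi hcm hcp hcb hint
  have hL : (fun t => t⁻¹ * ∫ u in (0 : ℝ)..(t / 2), c u)
      =o[atTop] fun t => ∫ u in Ioi (t / 2), c u := by
    have h1 := (isBigO_refl (fun t : ℝ => t⁻¹) atTop).mul (integral_isBigO_one hint)
    simp only [mul_one] at h1
    exact h1.trans_isLittleO ((inv_isLittleO_mul hcm hcRV (by norm_num)).trans htail)
  have e1 := expConv_expansion_of_zero h0 hα hc hcRV (by norm_num) (isWeight_pow_sub_one β)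
    (by simp) htail.isBigO hL
  have e2 := htail.const_mul_left
    (α * ∫ x in (0 : ℝ)..(1 / 2), ((1 - x) ^ β - 1) * x ^ (-1 : ℝ))
  have e3 := hcRV.half_isLittleO.trans htail
  have e4 := halfConv_expansion_of_moment (G := G) hFpos hb hb2 hmom
  refine (isLittleO_add_abs ((e1.add e2).sub e3) e4 ?_).congr' ?_ EventuallyEq.rfl
  · exact Eventually.of_forall fun t => integral_nonneg fun u => tilt_nonneg hc u
  · filter_upwards [eventually_gt_atTop 0] with t ht
    rw [expConv_pow_sub_one ht, expConv_one_eq_moment h0 hα hc hc0 hint ht]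
    ring

/-- Index in `(-2, -1)`: the missing part of the moment and the weight `(1 - x) ^ β - 1` both
contribute on the scale `t c(t)`. -/
theorem expansion_between (hFpos : ∀ t, 0 < t → 0 < tail F t) (h0 : G (Iio 0) = 0)
    (hα : 0 < α) (hb : ∀ t, b t = Real.exp (α * t) * tail F t)
    (hc : ∀ t, c t = Real.exp (α * t) * tail G t) (hb2 : IsTwoRV b β ρ A)
    (hcRV : IsRV c γ) (hγ : -2 < γ) (hγ' : γ < -1) :
    expMoment G α < ⊤ ∧
      ∃ R : ℝ → ℝ,
        (R =o[atTop] fun t => t * c t + |A t|) ∧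
        ∀ᶠ t in atTop, halfConv F G t = tail F t *
          ((expMoment G α).toReal
            + α * ((∫ u in (0 : ℝ)..(1 / 2), ((1 - u) ^ β - 1) * u ^ γ)
                + 1 / ((1 + γ) * (2 : ℝ) ^ (1 + γ))) * (t * c t) + R t) := by
  have hcm := tilt_measurable hc
  have hcp : ∀ t, 0 < t → 0 ≤ c t := fun t _ => tilt_nonneg hc t
  have hcb := tilt_bounded hα hc
  have hc0 := hcRV.tendsto_zero hcm (by linarith)
  have hint := hcRV.integrableOn_Ioi hcm hcp hcb hγ'
  have hmom := moment_of_integrableOn_tilt h0 hα hc hint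
  refine ⟨expMoment_lt_top_iff.2 hmom, exists_remainder hFpos ?_⟩
  have hL : (fun t => t⁻¹ * ∫ u in (0 : ℝ)..(t / 2), c u) =o[atTop] fun t => t * c t := by
    have h1 := (isBigO_refl (fun t : ℝ => t⁻¹) atTop).mul (integral_isBigO_one hint)
    simp only [mul_one] at h1
    exact h1.trans_isLittleO (inv_isLittleO_mul hcm hcRV hγ)
  have e1 := expConv_expansion_of_zero h0 hα hc hcRV hγ (isWeight_pow_sub_one β)
    (by simp) (isBigO_refl _ _) hL
  have e2 := (isLittleO_sub_of_tendsto_div hcRV.eventually_mul_ne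
    (hcRV.tendsto_integral_Ioi hcm hcp hγ')).const_mul_left α
  have e3 := hcRV.half_isLittleO
  have e4 := halfConv_expansion_of_moment (G := G) hFpos hb hb2 hmom
  refine (isLittleO_add_abs ((e1.sub e2).sub e3) e4 ?_).congr' ?_ EventuallyEq.rfl
  · filter_upwards [eventually_gt_atTop 0] with t ht
    exact mul_nonneg ht.le (hcp t ht)
  · filter_upwards [eventually_gt_atTop 0] with t ht
    rw [expConv_pow_sub_one ht, expConv_one_eq_moment h0 hα hc hc0 hint ht]
    ring

/-- Index `-2` with infinite first moment: the linear part of `(1 - x) ^ β - 1` gives the truncated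
first moment, which dominates `t ^ 2 c(t)`; the quadratic remainder is of that lower order. -/
theorem expansion_neg_two (hFpos : ∀ t, 0 < t → 0 < tail F t) (h0 : G (Iio 0) = 0)
    (hα : 0 < α) (hb : ∀ t, b t = Real.exp (α * t) * tail F t)
    (hc : ∀ t, c t = Real.exp (α * t) * tail G t) (hb2 : IsTwoRV b β ρ A)
    (hcRV : IsRV c (-2)) (htop : (∫⁻ u in Ioi (1 : ℝ), ENNReal.ofReal (u * c u)) = ⊤) :
    expMoment G α < ⊤ ∧
      ∃ R : ℝ → ℝ,
        (R =o[atTop] fun t => t⁻¹ * (∫ u in (1 : ℝ)..(t / 2), u * c u) + |A t|) ∧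
        ∀ᶠ t in atTop, halfConv F G t = tail F t *
          ((expMoment G α).toReal
            - α * β * t⁻¹ * (∫ u in (1 : ℝ)..(t / 2), u * c u) + R t) := by
  have hcm := tilt_measurable hc
  have hcp : ∀ t, 0 < t → 0 ≤ c t := fun t _ => tilt_nonneg hc t
  have hcb := tilt_bounded hα hc
  have hc0 := hcRV.tendsto_zero hcm (by norm_num)
  have hint := hcRV.integrableOn_Ioi hcm hcp hcb (by norm_num)
  have hmom := moment_of_integrableOn_tilt h0 hα hc hint
  refine ⟨expMoment_lt_top_iff.2 hmom, exists_remainder hFpos ?_⟩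
  set f : ℝ → ℝ := fun u => u * c u with hf
  have hfRV : IsRV f (-1) := by
    have := hcRV.mul_id hcm
    norm_num at this
    exact this
  have hfm : Measurable f := measurable_id.mul hcm
  have hfp : ∀ t, 0 < t → 0 ≤ f t := fun t ht => mul_nonneg ht.le (hcp t ht)
  have hfb : ∀ T, ∃ B, ∀ t ∈ Ioc 0 T, f t ≤ B := fun T => by
    obtain ⟨B, hB⟩ := hcb T
    exact ⟨T * B, fun t ht => mul_le_mul ht.2 (hB t ht) (tilt_nonneg hc t) (ht.1.le.trans ht.2)⟩
  have hnot : ¬ IntegrableOn f (Ioi 1) := fun h => by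
    have := (hasFiniteIntegral_iff_ofReal ((ae_restrict_mem measurableSet_Ioi).mono fun u hu =>
      hfp u (zero_lt_one.trans hu))).1 h.2
    rw [htop] at this
    exact lt_irrefl _ this
  have hUtop := tendsto_integral_atTop_of_not_integrable hfm hfp hfb zero_le_one hnot
  have hfU := hfRV.isLittleO_integral_one hfm hfp hfb
  set U : ℝ → ℝ := fun t => ∫ u in (1 : ℝ)..(t / 2), f u with hU
  have htc : (fun t => t * c t) =o[atTop] fun t => t⁻¹ * U t := by
    refine ((isBigO_refl (fun t : ℝ => t⁻¹) atTop).mul_isLittleO hfU).congr' ?_ EventuallyEq.rfl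
    filter_upwards [eventually_gt_atTop 0] with t ht
    simp only [hf]
    field_simp
  have hinv : (fun t : ℝ => t⁻¹) =o[atTop] fun t => t⁻¹ * U t := by
    have h1 : (fun _ : ℝ => (1 : ℝ)) =o[atTop] U :=
      isLittleO_const_left.2 (Or.inr (tendsto_norm_atTop_atTop.comp hUtop))
    simpa using (isBigO_refl (fun t : ℝ => t⁻¹) atTop).mul_isLittleO h1
  obtain ⟨K, hK0, hK⟩ := pow_sub_one_taylor β
  have hlim := hcRV.tendsto_integral hcm hcp hcb
    (g := fun x => (1 - x) ^ β - 1 + β * x) (by fun_prop) (m := 2) (K := K)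
    (fun x hx => by rw [Real.rpow_two]; exact hK x (Ioc_subset_Icc_self hx)) two_pos.le
    (by norm_num)
  have e1 : (fun t => ∫ u in (0 : ℝ)..(t / 2), ((1 - u / t) ^ β - 1 + β * (u / t)) * c u)
      =o[atTop] fun t => t⁻¹ * U t := by
    have h1 := (isLittleO_sub_of_tendsto_div hcRV.eventually_mul_ne hlim).trans htc
    exact (h1.add (htc.const_mul_left _)).congr_left fun t => sub_add_cancel _ _
  have e2 : (fun t => ∫ u in Ioi (t / 2), c u) =o[atTop] fun t => t⁻¹ * U t := by
    have h1 := (isLittleO_sub_of_tendsto_div hcRV.eventually_mul_ne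
      (hcRV.tendsto_integral_Ioi hcm hcp (by norm_num))).trans htc
    exact (h1.add (htc.const_mul_left _)).congr_left fun t => sub_add_cancel _ _
  have e3 := hcRV.half_isLittleO.trans htc
  have e4 := halfConv_expansion_of_moment (G := G) hFpos hb hb2 hmom
  obtain ⟨K', hK'⟩ := (isWeight_pow_sub_one β).bound'
  have e5 : (fun t => t⁻¹ * ∫ u in (0 : ℝ)..(t / 2), -(β * (1 - u / t) ^ (β - 1)) * c u)
      =o[atTop] fun t => t⁻¹ * U t := by
    have h1 := (isBigO_refl (fun t : ℝ => t⁻¹) atTop).mul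
      ((integral_weight_isBigO hα hc hK').trans (integral_isBigO_one hint))
    simp only [mul_one] at h1
    exact h1.trans_isLittleO hinv
  have hfi : ∀ T, IntervalIntegrable f volume 0 T := fun T => by
    rcases le_total 0 T with hT | hT
    · obtain ⟨B, hB⟩ := hfb T
      exact intervalIntegrable_of_bound hfm hT B fun u hu => by
        rw [abs_of_nonneg (hfp u hu.1)]; exact hB u hu
    · refine (intervalIntegrable_iff_integrableOn_Ioc_of_le hT).2 ?_ |>.symm
      have hce : IntegrableOn (fun u : ℝ => |u| * 1) (Ioc T 0) :=
        ((by fun_prop : Continuous fun u : ℝ => |u| * 1).integrableOn_Ioc)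
      refine hce.mono' hfm.aestronglyMeasurable
        ((ae_restrict_mem measurableSet_Ioc).mono fun u hu => ?_)
      rw [hf, norm_mul, Real.norm_eq_abs, Real.norm_of_nonneg (tilt_nonneg hc u)]
      refine mul_le_mul_of_nonneg_left ?_ (abs_nonneg u)
      rw [hc]
      calc _ ≤ (1 : ℝ) * 1 := mul_le_mul (Real.exp_le_one_iff.2
            (mul_nonpos_of_nonneg_of_nonpos hα.le hu.2)) (tail_le_one G u) (tail_nonneg G u)
            zero_le_one
        _ = 1 := one_mul 1
  -- The last summand accounts for the constant by which the integrals of `f` over `[0, t / 2]` and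
  -- `[1, t / 2]` differ.
  refine (isLittleO_add_abs (((((e3.const_mul_left (-((1 - 1 / 2 : ℝ) ^ β))).sub
    (e2.const_mul_left α)).add (e1.const_mul_left α)).add e5).sub
    (hinv.const_mul_left (α * β * ∫ u in (0 : ℝ)..1, f u))) e4 ?_).congr' ?_ EventuallyEq.rfl
  · filter_upwards [hUtop.eventually_ge_atTop 0, eventually_gt_atTop 0] with t h1 h2
    exact mul_nonneg (inv_pos.2 h2).le h1
  · filter_upwards [eventually_gt_atTop 0] with t ht
    have h1 := expConv_pow_sub_one (G := G) (α := α) (β := β) ht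
    rw [expConv_one_eq_moment h0 hα hc hc0 hint ht,
      expConv_eq h0 hα hc (isWeight_pow_sub_one β) ht] at h1
    have h2 : (∫ u in (0 : ℝ)..(t / 2), ((1 - u / t) ^ β - 1 + β * (u / t)) * c u)
        = (∫ u in (0 : ℝ)..(t / 2), ((1 - u / t) ^ β - 1) * c u)
          + β * t⁻¹ * ((∫ u in (0 : ℝ)..1, f u) + U t) := by
      rw [hU, intervalIntegral.integral_add_adjacent_intervals (hfi 1)
        ((hfi 1).symm.trans (hfi (t / 2))), ← intervalIntegral.integral_const_mul,
        ← intervalIntegral.integral_add ?_ ((hfi _).const_mul _)]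
      · refine intervalIntegral.integral_congr fun u _ => ?_
        simp only [hf]
        ring
      · obtain ⟨K'', hK''⟩ := (isWeight_pow_sub_one β).bound
        exact tilt_intervalIntegrable hα hc
          ((isWeight_pow_sub_one β).meas.comp (measurable_id.div_const t)) (by positivity)
          fun u hu => hK'' _ (div_mem_half ht (Ioc_subset_Icc_self hu))
    rw [h2]
    simp only [sub_zero, Real.one_rpow, sub_self] at h1
    linear_combination h1

/-- Finite first moment: dominated convergence for the difference quotient of `(1 - x) ^ β`. -/
theorem expansion_le_neg_two (hFpos : ∀ t, 0 < t → 0 < tail F t) (h0 : G (Iio 0) = 0)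
    (hα : 0 < α) (hb : ∀ t, b t = Real.exp (α * t) * tail F t)
    (hc : ∀ t, c t = Real.exp (α * t) * tail G t) (hb2 : IsTwoRV b β ρ A)
    (hcRV : IsRV c γ) (hγ : γ ≤ -2)
    (hfin : (∫⁻ u in Ioi (1 : ℝ), ENNReal.ofReal (u * c u)) < ⊤) :
    expMoment G α < ⊤ ∧
      IntegrableOn (fun u => u * Real.exp (α * u)) (Ici 0) G ∧
      ∃ R : ℝ → ℝ,
        (R =o[atTop] fun t => t⁻¹ + |A t|) ∧
        ∀ᶠ t in atTop, halfConv F G t = tail F t *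
          ((expMoment G α).toReal
            - β * t⁻¹ * (∫ u in Ici (0 : ℝ), u * Real.exp (α * u) ∂G) + R t) := by
  have hcm := tilt_measurable hc
  have hcp : ∀ t, 0 < t → 0 ≤ c t := fun t _ => tilt_nonneg hc t
  have hcb := tilt_bounded hα hc
  have hint := hcRV.integrableOn_Ioi hcm hcp hcb (by linarith)
  have hmom := moment_of_integrableOn_tilt h0 hα hc hint
  have hfint : IntegrableOn (fun u => u * c u) (Ioi 0) := by
    rw [← Ioc_union_Ioi_eq_Ioi zero_le_one]
    refine IntegrableOn.union ?_ ⟨(measurable_id.mul hcm).aestronglyMeasurable,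
      (hasFiniteIntegral_iff_ofReal ((ae_restrict_mem measurableSet_Ioi).mono fun u hu =>
        mul_nonneg (zero_lt_one.trans hu).le (tilt_nonneg hc u))).2 hfin⟩
    exact (intervalIntegrable_iff_integrableOn_Ioc_of_le zero_le_one).1
      (tilt_intervalIntegrable hα hc measurable_id zero_le_one (K := 1) fun u hu => by
        rw [id, abs_of_pos hu.1]; exact hu.2)
  have hmom1 : IntegrableOn (fun u => u * Real.exp (α * u)) (Ici 0) G := by
    have hint2 : IntegrableOn (fun u => (1 + α * u) * c u) (Ioi 0) := by
      refine (hint.add (hfint.const_mul α)).congr_fun (fun u _ => ?_) measurableSet_Ioi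
      simp only [Pi.add_apply]
      ring
    refine integrableOn_Ici_of_bounded (by fun_prop)
      (fun u hu => mul_nonneg hu (Real.exp_pos _).le) (∫ u in Ioi 0, (1 + α * u) * c u) ?_
    filter_upwards [eventually_gt_atTop 0] with T hT
    have hp := integral_by_parts G h0 (T := T) (ψ := fun u => u * Real.exp (α * u))
      (ψ' := fun u => 1 * Real.exp (α * u) + u * (Real.exp (α * u) * α))
      (B := Real.exp (α * T) + T * (Real.exp (α * T) * α)) hT.le
      (fun s _ => by
        have h2 : HasDerivAt (fun u => Real.exp (α * u)) (Real.exp (α * s) * α) s := by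
          simpa using ((hasDerivAt_id s).const_mul α).exp
        exact (hasDerivAt_id s).mul h2)
      (by fun_prop) (fun s hs => by
        have he : Real.exp (α * s) ≤ Real.exp (α * T) :=
          Real.exp_le_exp.2 (by have := hs.2; gcongr)
        have hs0 := hs.1
        rw [abs_of_nonneg (by positivity), one_mul]
        gcongr
        exact hs.2)
    rw [hp, intervalIntegral.integral_of_le hT.le]
    have h1 : ∫ u in Ioc 0 T, (1 * Real.exp (α * u) + u * (Real.exp (α * u) * α)) * tail G u
        = ∫ u in Ioc 0 T, (1 + α * u) * c u := by
      refine integral_congr_ae (Eventually.of_forall fun u => ?_)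
      simp only [hc u]
      ring
    rw [h1]
    have h2 : ∫ u in Ioc 0 T, (1 + α * u) * c u ≤ ∫ u in Ioi 0, (1 + α * u) * c u :=
      setIntegral_mono_set hint2 ((ae_restrict_mem measurableSet_Ioi).mono fun u hu => by
          have hu0 : (0 : ℝ) < u := hu
          exact mul_nonneg (by positivity) (tilt_nonneg hc u))
        (LE.le.eventuallyLE fun u hu => hu.1)
    have h3 : 0 ≤ T * Real.exp (α * T) * tail G T := by
      have := tail_nonneg G T
      positivity
    linarith
  refine ⟨expMoment_lt_top_iff.2 hmom, hmom1, exists_remainder hFpos ?_⟩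
  obtain ⟨K, hK0, hK⟩ := pow_sub_one_taylor β
  obtain ⟨K₁, hK₁0, hK₁⟩ := (isWeight_pow β).lipschitz
  simp only [sub_zero, Real.one_rpow] at hK₁
  -- The whole moment is compared at once: outside `[0, t / 2]` the factor `t` is at most `2 * u`,
  -- so `u * exp (α * u)` dominates there as well.
  have key : Tendsto (fun t => ∫ u in Ici (0 : ℝ),
      t * ((Iic (t / 2)).indicator (fun u => (1 - u / t) ^ β) u - 1) * Real.exp (α * u) ∂G) atTop
      (𝓝 (∫ u in Ici (0 : ℝ), -β * (u * Real.exp (α * u)) ∂G)) := by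
    refine tendsto_integral_filter_of_dominated_convergence
      (fun u => (K₁ + 2) * (u * Real.exp (α * u))) ?_ ?_ (hmom1.const_mul _) ?_
    · refine Eventually.of_forall fun t => Measurable.aestronglyMeasurable ?_
      have : Measurable ((Iic (t / 2)).indicator (fun u : ℝ => (1 - u / t) ^ β)) :=
        (by fun_prop : Measurable (fun u : ℝ => (1 - u / t) ^ β)).indicator measurableSet_Iic
      fun_prop
    · filter_upwards [eventually_gt_atTop 0] with t ht
      refine (ae_restrict_mem measurableSet_Ici).mono fun u hu => ?_
      have hu0 : (0 : ℝ) ≤ u := hu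
      rw [norm_mul, Real.norm_of_nonneg (Real.exp_pos _).le, ← mul_assoc]
      refine mul_le_mul_of_nonneg_right ?_ (Real.exp_pos _).le
      rw [norm_mul, Real.norm_of_nonneg ht.le, Real.norm_eq_abs]
      by_cases h : u ∈ Iic (t / 2)
      · rw [indicator_of_mem h]
        have h1 := hK₁ _ (div_mem_half ht ⟨hu, h⟩)
        calc _ ≤ t * (K₁ * (u / t)) := by gcongr
          _ = K₁ * u := by field_simp
          _ ≤ _ := by nlinarith
      · rw [indicator_of_notMem h, zero_sub, abs_neg, abs_one, mul_one]
        simp only [mem_Iic, not_le] at h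
        nlinarith
    · refine (ae_restrict_mem measurableSet_Ici).mono fun u hu => ?_
      have hu0 : (0 : ℝ) ≤ u := hu
      have h1 : Tendsto (fun t : ℝ => t * ((1 - u / t) ^ β - 1)) atTop (𝓝 (-β * u)) := by
        rw [tendsto_iff_norm_sub_tendsto_zero]
        have h2 : Tendsto (fun t : ℝ => K * u ^ 2 * t⁻¹) atTop (𝓝 0) := by
          simpa using tendsto_inv_atTop_zero.const_mul (K * u ^ 2)
        refine squeeze_zero' (Eventually.of_forall fun t => norm_nonneg _) ?_ h2
        filter_upwards [eventually_gt_atTop 0, eventually_ge_atTop (2 * u)] with t ht htu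
        have h3 := hK _ (div_mem_half ht ⟨hu0, by linarith⟩)
        have e : t * ((1 - u / t) ^ β - 1) - -β * u
            = t * ((1 - u / t) ^ β - 1 + β * (u / t)) := by field_simp; ring
        rw [e, norm_mul, Real.norm_of_nonneg ht.le, Real.norm_eq_abs]
        calc _ ≤ t * (K * (u / t) ^ 2) := by gcongr
          _ = _ := by field_simp
      have h2 := h1.mul_const (Real.exp (α * u))
      rw [mul_assoc] at h2
      refine h2.congr' ?_
      filter_upwards [eventually_ge_atTop (2 * u)] with t ht
      rw [indicator_of_mem (show u ∈ Iic (t / 2) by simp only [mem_Iic]; linarith)]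
  rw [integral_const_mul] at key
  have e1 : (fun t => (expConv G α (fun x => (1 - x) ^ β) t - (expMoment G α).toReal)
      - -β * (∫ u in Ici (0 : ℝ), u * Real.exp (α * u) ∂G) * t⁻¹) =o[atTop] fun t : ℝ => t⁻¹ := by
    refine isLittleO_sub_of_tendsto_div
      ((eventually_ne_atTop 0).mono fun t ht => inv_ne_zero ht) (key.congr' ?_)
    filter_upwards [eventually_gt_atTop 0] with t ht
    obtain ⟨K₂, hK₂⟩ := (isWeight_pow β).bound
    have i1 := integrableOn_expConv G α (isWeight_pow β).meas hK₂ ht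
    have hset : (G.restrict (Ici 0)).restrict (Iic (t / 2)) = G.restrict (Icc 0 (t / 2)) := by
      rw [Measure.restrict_restrict measurableSet_Iic, inter_comm]
      rfl
    have i2 : IntegrableOn ((Iic (t / 2)).indicator
        (fun u => (1 - u / t) ^ β * Real.exp (α * u))) (Ici 0) G := by
      refine IntegrableOn.integrable_indicator ?_ measurableSet_Iic
      rw [IntegrableOn, hset]
      exact i1
    have e : ∀ u, t * ((Iic (t / 2)).indicator (fun u => (1 - u / t) ^ β) u - 1)
          * Real.exp (α * u)
        = t * ((Iic (t / 2)).indicator (fun u => (1 - u / t) ^ β * Real.exp (α * u)) u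
          - Real.exp (α * u)) := by
      intro u
      by_cases h : u ∈ Iic (t / 2)
      · rw [indicator_of_mem h, indicator_of_mem h]; ring
      · rw [indicator_of_notMem h, indicator_of_notMem h]; ring
    simp only [e]
    rw [integral_const_mul, integral_sub i2 hmom, integral_indicator measurableSet_Iic, hset,
      ← expMoment_toReal, div_inv_eq_mul, mul_comm]
    rfl
  have e4 := halfConv_expansion_of_moment (G := G) hFpos hb hb2 hmom
  refine (isLittleO_add_abs e1 e4 ?_).congr_left fun t => ?_
  · filter_upwards [eventually_gt_atTop 0] with t ht
    exact (inv_pos.2 ht).le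
  · ring

/-- For index above `-1` the tilted measure, rescaled by `t`, has the limiting density
`α x ^ γ` relative to `t c(t)`. -/
theorem expConv_div_tendsto (h0 : G (Iio 0) = 0) (hα : 0 < α)
    (hc : ∀ t, c t = Real.exp (α * t) * tail G t) (hcRV : IsRV c γ) (hγ : -1 < γ)
    {φ φ' : ℝ → ℝ} (hφ : IsWeight φ φ') :
    Tendsto (fun t => expConv G α φ t / (t * c t)) atTop
      (𝓝 (α * ∫ x in (0 : ℝ)..(1 / 2), φ x * x ^ γ)) := by
  have hcm := tilt_measurable hc
  have hcp : ∀ t, 0 < t → 0 ≤ c t := fun t _ => tilt_nonneg hc t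
  have hcb := tilt_bounded hα hc
  obtain ⟨K, hK⟩ := hφ.bound
  obtain ⟨K', hK'⟩ := hφ.bound'
  have h1 := hcRV.tendsto_integral hcm hcp hcb hφ.meas (m := 0) (K := K)
    (fun x hx => by simpa using hK x (Ioc_subset_Icc_self hx)) le_rfl (by linarith)
  have h2 := hcRV.tendsto_integral hcm hcp hcb hφ.meas' (m := 0) (K := K')
    (fun x hx => by simpa using hK' x (Ioc_subset_Icc_self hx)) le_rfl (by linarith)
  have h3 := ((hcRV.mul_id hcm).tendsto_atTop (by fun_prop) (by linarith)).inv_tendsto_atTop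
  have h4 := hcRV.half_isLittleO.tendsto_div_nhds_zero
  have h5 := (((h3.const_mul (φ 0)).sub (h4.const_mul (φ (1 / 2)))).add (h1.const_mul α)).add
    (tendsto_inv_atTop_zero.mul h2)
  simp only [mul_zero, zero_mul, sub_zero, zero_add, add_zero] at h5
  refine h5.congr' ?_
  filter_upwards [eventually_gt_atTop 0, hcRV.eventually_pos] with t ht hct
  rw [expConv_eq h0 hα hc hφ ht]
  simp only [Pi.inv_apply]
  field_simp

set_option maxHeartbeats 1000000 in
/-- Index above `-1`: each of the three error scales comes from one source, namely `A` from the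
expansion of `b`, `A₃` from that of `c`, and `t⁻¹` from the integration by parts. -/
theorem expansion_gt_neg_one (hFpos : ∀ t, 0 < t → 0 < tail F t) (h0 : G (Iio 0) = 0)
    (hα : 0 < α) (hb : ∀ t, b t = Real.exp (α * t) * tail F t)
    (hc : ∀ t, c t = Real.exp (α * t) * tail G t) (hb2 : IsTwoRV b β ρ A)
    (hγ : -1 < γ) {ρ₃ : ℝ} {A₃ : ℝ → ℝ} (hc2 : IsTwoRV c γ ρ₃ A₃) (hγρ : 0 < γ + ρ₃ + 1) :
    ∃ R : ℝ → ℝ,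
      (R =o[atTop] fun t => t⁻¹ + |A t| + |A₃ t|) ∧
      ∀ᶠ t in atTop, halfConv F G t = tail F t *
        (t * c t *
          (α * (∫ u in (0 : ℝ)..(1 / 2), (1 - u) ^ β * u ^ γ)
            + α * (∫ u in (0 : ℝ)..(1 / 2),
                powLog ρ (1 - u) * (1 - u) ^ β * u ^ γ) * A t
            + (β * (∫ u in (0 : ℝ)..(1 / 2), (1 - u) ^ (β - 1) * u ^ γ * (2 * u - 1))
                - 2 * (1 + γ) * (∫ u in (0 : ℝ)..(1 / 2), (1 - u) ^ β * u ^ γ)) * t⁻¹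
            + α * ((2 : ℝ) ^ (-ρ₃) * β / (γ + ρ₃ + 1) *
                  (∫ u in (0 : ℝ)..(1 / 2),
                    (1 - u) ^ (β - 1) * u ^ (γ + 1) * powLog ρ₃ (2 * u))
                + auxCoeff γ ρ₃ *
                  (∫ u in (0 : ℝ)..(1 / 2), (1 - u) ^ β * u ^ γ)) * A₃ t
            + R t)) := by
  have hcRV := hc2.isRV
  have hcm := tilt_measurable hc
  have hcp : ∀ t, 0 < t → 0 ≤ c t := fun t _ => tilt_nonneg hc t
  have hcb := tilt_bounded hα hc
  rw [second_order_integral_identity β hc2.rho_nonpos hγρ, beta_integral_identity β hγ]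
  have hperm : (∫ u in (0 : ℝ)..(1 / 2), powLog ρ (1 - u) * (1 - u) ^ β * u ^ γ)
      = ∫ u in (0 : ℝ)..(1 / 2), (1 - u) ^ β * powLog ρ (1 - u) * u ^ γ :=
    intervalIntegral.integral_congr fun u _ => by ring
  rw [hperm]
  set I := ∫ u in (0 : ℝ)..(1 / 2), (1 - u) ^ β * u ^ γ with hI
  set S := ∫ u in (0 : ℝ)..(1 / 2), (1 - u) ^ β * (u ^ γ * powLog ρ₃ u) with hS
  set I₂ := ∫ u in (0 : ℝ)..(1 / 2), (1 - u) ^ β * powLog ρ (1 - u) * u ^ γ with hI₂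
  set Q := ∫ u in (0 : ℝ)..(1 / 2), -(β * (1 - u) ^ (β - 1)) * u ^ γ with hQ
  set g : ℝ → ℝ := fun t => t⁻¹ + |A t| + |A₃ t| with hg
  have hgpos : ∀ t, 0 < t → 0 < t⁻¹ ∧ 0 ≤ g t := fun t ht => by
    have := inv_pos.2 ht
    exact ⟨this, by simp only [hg]; positivity⟩
  have hg1 : (fun t : ℝ => t⁻¹) =O[atTop] g := by
    refine IsBigO.of_bound 1 ?_
    filter_upwards [eventually_gt_atTop 0] with t ht
    obtain ⟨h1, h2⟩ := hgpos t ht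
    rw [Real.norm_of_nonneg h1.le, Real.norm_of_nonneg h2, one_mul]
    simp only [hg]; linarith [abs_nonneg (A t), abs_nonneg (A₃ t)]
  have hg2 : A =O[atTop] g := by
    refine IsBigO.of_bound 1 ?_
    filter_upwards [eventually_gt_atTop 0] with t ht
    obtain ⟨h1, h2⟩ := hgpos t ht
    rw [Real.norm_eq_abs, Real.norm_of_nonneg h2, one_mul]
    simp only [hg]; linarith [abs_nonneg (A t), abs_nonneg (A₃ t)]
  have hg3 : A₃ =O[atTop] g := by
    refine IsBigO.of_bound 1 ?_
    filter_upwards [eventually_gt_atTop 0] with t ht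
    obtain ⟨h1, h2⟩ := hgpos t ht
    rw [Real.norm_eq_abs, Real.norm_of_nonneg h2, one_mul]
    simp only [hg]; linarith [abs_nonneg (A t), abs_nonneg (A₃ t)]
  obtain ⟨K, hK⟩ := (isWeight_pow β).bound
  obtain ⟨K', hK'⟩ := (isWeight_pow β).bound'
  set P : ℝ → ℝ := fun t => ∫ u in (0 : ℝ)..(t / 2), (1 - u / t) ^ β * c u with hP
  set P' : ℝ → ℝ := fun t => ∫ u in (0 : ℝ)..(t / 2), -(β * (1 - u / t) ^ (β - 1)) * c u with hP'
  have l1 : Tendsto (fun t => (P t / (t * c t) - I) / A₃ t) atTop (𝓝 S) :=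
    hc2.tendsto_integral hcm hcp hcb (isWeight_pow β).meas (K := K)
      (fun x hx => hK x (Ioc_subset_Icc_self hx)) hγρ
  have l2 : Tendsto (fun t => P' t / (t * c t)) atTop (𝓝 Q) :=
    hcRV.tendsto_integral hcm hcp hcb (isWeight_pow β).meas' (m := 0) (K := K')
      (fun x hx => by simpa using hK' x (Ioc_subset_Icc_self hx)) le_rfl (by linarith)
  have l3 := expConv_div_tendsto h0 hα hc hcRV hγ (isWeight_powLog β ρ)
  have l4 := expConv_div_tendsto h0 hα hc hcRV hγ isWeight_one
  have l5 := hcRV.tendsto_half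
  -- The boundary term at the origin has index `-1 - γ`, below the index `ρ₃` of `A₃`.
  have r1 : (fun t => (t * c t)⁻¹) =o[atTop] A₃ := by
    refine (isLittleO_iff_tendsto' (hc2.aux_ne.mono fun t h h' => absurd h' h)).2 ?_
    have hf2 : IsTwoRV (fun t => t ^ (-γ) * c t) 0 ρ₃ A₃ := by
      have := hc2.mul_rpow hcm (-γ)
      rwa [neg_add_cancel] at this
    have h1 := (hf2.aux_mul_tendsto (by fun_prop) (hcRV.mul_id hcm) (by fun_prop)
      (by linarith)).inv_tendsto_atTop
    rw [tendsto_zero_iff_abs_tendsto_zero]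
    refine h1.congr' ?_
    filter_upwards [eventually_gt_atTop 0, hcRV.eventually_pos] with t ht hct
    rw [Function.comp, abs_div, abs_of_pos (inv_pos.2 (mul_pos ht hct)), Pi.inv_apply, mul_inv,
      div_eq_mul_inv]
  have r2 : (fun t : ℝ => t⁻¹ * (-((1 / 2) ^ β * (c (t / 2) / c t)) + P' t / (t * c t)
      - (-((1 / 2 : ℝ) ^ β * (1 / 2) ^ γ) + Q))) =o[atTop] g := by
    have h1 := ((l5.const_mul ((1 / 2 : ℝ) ^ β)).neg.add l2).sub_const
      (-((1 / 2 : ℝ) ^ β * (1 / 2) ^ γ) + Q)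
    rw [sub_self] at h1
    simpa using hg1.mul_isLittleO ((isLittleO_one_iff ℝ).2 h1)
  have r3 : (fun t => A₃ t * (α * ((P t / (t * c t) - I) / A₃ t - S))) =o[atTop] g := by
    have h1 := (l1.sub_const S).const_mul α
    rw [sub_self, mul_zero] at h1
    simpa using hg3.mul_isLittleO ((isLittleO_one_iff ℝ).2 h1)
  have r4 : (fun t => A t * (expConv G α (fun x => (1 - x) ^ β * powLog ρ (1 - x)) t / (t * c t)
      - α * I₂)) =o[atTop] g := by
    have h1 := l3.sub_const (α * I₂)
    rw [sub_self] at h1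
    simpa using hg2.mul_isLittleO ((isLittleO_one_iff ℝ).2 h1)
  have r5 : (fun t => (halfConv F G t / tail F t - expConv G α (fun x => (1 - x) ^ β) t
      - A t * expConv G α (fun x => (1 - x) ^ β * powLog ρ (1 - x)) t) * (t * c t)⁻¹)
      =o[atTop] g := by
    have h1 := (halfConv_expansion (G := G) hFpos hb hb2).mul_isBigO
      (isBigO_refl (fun t => (t * c t)⁻¹) atTop)
    refine h1.trans_isBigO ?_
    have h2 := hg2.mul (l4.isBigO_one ℝ)
    simp only [mul_one] at h2
    refine h2.congr_left fun t => ?_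
    rw [div_eq_mul_inv]; ring
  have hsum := ((((r1.trans_isBigO hg3).add r2).add r3).add r4).add r5
  refine ⟨fun t => (halfConv F G t / tail F t) / (t * c t)
    - (α * I + α * I₂ * A t + (-((1 / 2 : ℝ) ^ β * (1 / 2) ^ γ) + Q) * t⁻¹ + α * S * A₃ t),
    ?_, ?_⟩
  · refine hsum.congr' ?_ EventuallyEq.rfl
    filter_upwards [eventually_gt_atTop 0, hcRV.eventually_pos, hc2.aux_ne] with t ht hct hA
    rw [expConv_eq h0 hα hc (isWeight_pow β) ht]
    have e : (1 - 1 / 2 : ℝ) = 1 / 2 := by norm_num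
    simp only [sub_zero, Real.one_rpow, e]
    change (t * c t)⁻¹ + _ + _ + _ + (_ - (1 - (1 / 2) ^ β * c (t / 2) + α * P t + t⁻¹ * P' t)
      - _) * _ = _
    field_simp
    ring
  · filter_upwards [eventually_gt_atTop 0, hcRV.eventually_pos] with t ht hct
    have hF := (hFpos t ht).ne'
    have htc := (mul_pos ht hct).ne'
    rw [add_sub_cancel, mul_div_cancel₀ _ htc, mul_div_cancel₀ _ hF]

end

theorem mainTheorem2 (F G : Measure ℝ) (α β γ ρ₂ : ℝ) (A₂ b c : ℝ → ℝ)
    (hα : 0 < α) (hF : ExpTailClass α F) (hG : ExpTailClass α G)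
    (hb : ∀ t, b t = Real.exp (α * t) * tail F t)
    (hc : ∀ t, c t = Real.exp (α * t) * tail G t)
    (hb2 : IsTwoRV b β ρ₂ A₂) (hcRV : IsRV c γ) :
    -- `γ = -1`, infinite exponential moment
    (γ = -1 → expMoment G α = ⊤ →
      ∃ R : ℝ → ℝ,
        (R =o[atTop] fun t => (1 + t * c t) / (∫ u in (0 : ℝ)..(t / 2), c u) + |A₂ t|) ∧
        ∀ᶠ t in atTop, halfConv F G t = tail F t *
          ((∫ u in (0 : ℝ)..(t / 2), c u) *
            (α + α * t * c t / (∫ u in (0 : ℝ)..(t / 2), c u) *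
                (β * (∫ u in (0 : ℝ)..(1 / 2), (1 - u) ^ (β - 1) * Real.log u)
                  + Real.log 2 * (1 - (2 : ℝ) ^ (-β)))
              + 1 / (∫ u in (0 : ℝ)..(t / 2), c u) + R t))) ∧
    -- `γ = -1`, finite exponential moment
    (γ = -1 → expMoment G α < ⊤ →
      IntegrableOn c (Ioi 0) ∧
      ∃ R : ℝ → ℝ,
        (R =o[atTop] fun t => (∫ u in Ioi (t / 2), c u) + |A₂ t|) ∧
        ∀ᶠ t in atTop, halfConv F G t = tail F t *
          ((expMoment G α).toReal - α * (∫ u in Ioi (t / 2), c u) + R t)) ∧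
    -- `-2 < γ < -1`
    (-2 < γ → γ < -1 →
      expMoment G α < ⊤ ∧
      ∃ R : ℝ → ℝ,
        (R =o[atTop] fun t => t * c t + |A₂ t|) ∧
        ∀ᶠ t in atTop, halfConv F G t = tail F t *
          ((expMoment G α).toReal
            + α * ((∫ u in (0 : ℝ)..(1 / 2), ((1 - u) ^ β - 1) * u ^ γ)
                + 1 / ((1 + γ) * (2 : ℝ) ^ (1 + γ))) * (t * c t) + R t)) ∧
    -- `γ = -2`, infinite integral of `u * c u`
    (γ = -2 → (∫⁻ u in Ioi (1 : ℝ), ENNReal.ofReal (u * c u)) = ⊤ →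
      expMoment G α < ⊤ ∧
      ∃ R : ℝ → ℝ,
        (R =o[atTop] fun t => t⁻¹ * (∫ u in (1 : ℝ)..(t / 2), u * c u) + |A₂ t|) ∧
        ∀ᶠ t in atTop, halfConv F G t = tail F t *
          ((expMoment G α).toReal
            - α * β * t⁻¹ * (∫ u in (1 : ℝ)..(t / 2), u * c u) + R t)) ∧
    -- `γ ≤ -2`, finite integral of `u * c u`
    (γ ≤ -2 → (∫⁻ u in Ioi (1 : ℝ), ENNReal.ofReal (u * c u)) < ⊤ →
      expMoment G α < ⊤ ∧
      IntegrableOn (fun u => u * Real.exp (α * u)) (Ici 0) G ∧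
      ∃ R : ℝ → ℝ,
        (R =o[atTop] fun t => t⁻¹ + |A₂ t|) ∧
        ∀ᶠ t in atTop, halfConv F G t = tail F t *
          ((expMoment G α).toReal
            - β * t⁻¹ * (∫ u in Ici (0 : ℝ), u * Real.exp (α * u) ∂G) + R t)) ∧
    -- `γ > -1`
    (-1 < γ → ∀ (ρ₃ : ℝ) (A₃ : ℝ → ℝ), IsTwoRV c γ ρ₃ A₃ → 0 < γ + ρ₃ + 1 →
      ∃ R : ℝ → ℝ,
        (R =o[atTop] fun t => t⁻¹ + |A₂ t| + |A₃ t|) ∧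
        ∀ᶠ t in atTop, halfConv F G t = tail F t *
          (t * c t *
            (α * (∫ u in (0 : ℝ)..(1 / 2), (1 - u) ^ β * u ^ γ)
              + α * (∫ u in (0 : ℝ)..(1 / 2),
                  powLog ρ₂ (1 - u) * (1 - u) ^ β * u ^ γ) * A₂ t
              + (β * (∫ u in (0 : ℝ)..(1 / 2), (1 - u) ^ (β - 1) * u ^ γ * (2 * u - 1))
                  - 2 * (1 + γ) * (∫ u in (0 : ℝ)..(1 / 2), (1 - u) ^ β * u ^ γ)) * t⁻¹
              + α * ((2 : ℝ) ^ (-ρ₃) * β / (γ + ρ₃ + 1) *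
                    (∫ u in (0 : ℝ)..(1 / 2),
                      (1 - u) ^ (β - 1) * u ^ (γ + 1) * powLog ρ₃ (2 * u))
                  + auxCoeff γ ρ₃ *
                    (∫ u in (0 : ℝ)..(1 / 2), (1 - u) ^ β * u ^ γ)) * A₃ t
              + R t))) := by
  have := hF.isProbabilityMeasure
  have := hG.isProbabilityMeasure
  have hFp := hF.tail_pos
  have hG0 := hG.nonneg_support
  refine ⟨?_, ?_, fun h1 h2 => expansion_between hFp hG0 hα hb hc hb2 hcRV h1 h2, ?_,
    fun h1 h2 => expansion_le_neg_two hFp hG0 hα hb hc hb2 hcRV h1 h2,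
    fun h1 ρ₃ A₃ h2 h3 => expansion_gt_neg_one hFp hG0 hα hb hc hb2 h1 h2 h3⟩
  · rintro rfl h
    exact expansion_neg_one_infinite hFp hG0 hα hb hc hb2 hcRV h
  · rintro rfl h
    exact expansion_neg_one_finite hFp hG0 hα hb hc hb2 hcRV h
  · rintro rfl h
    exact expansion_neg_two hFp hG0 hα hb hc hb2 hcRV h
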